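/- Let $\mathbb B$ be a category. A class $\mathcal D$ of maps of $\mathbb B$ (the \emph{display maps}) is a \emph{class of display maps}, and $(\mathbb B,\mathcal D)$ a \emph{display map category}, if $\mathcal D$ contains the identities, every display map has a pullback along every map with the same codomain, and in every pullback square over a display map the opposite side is again a display map. Let $\mathcal D/I$ be the full subcategory of $\mathbb B/I$ on the display maps, and $\mathcal D_I$ the class of maps of $\mathcal D/I$ whose underlying map is in $\mathcal D$; each $h:I\to J$ gives a pullback functor $h^*:\mathcal D/J\to\mathcal D/I$. Write ${}^\square\mathcal F$ for the class of maps with the left lifting property against all maps in $\mathcal F$. We say that $(\mathbb B,\mathcal D)$ - is \emph{well-rooted} if $\mathbb B$ has a terminal object $1$ and every map $X\to 1$ is in $\mathcal D$; - has \emph{$\Sigma$-types} if $\mathcal D$ is closed under composition; - has \emph{$\Pi$-types} if for all $f:B\to A$ and $g:C\to B$ in $\mathcal D$ there is a couniversal arrow from the pullback functor $f^*:\mathbb B/A\to\mathbb B/B$ to $g$ whose domain is in $\mathcal D$; - has \emph{identity types} if for each $I$ every map of $\mathcal D/I$ factors as a map in ${}^\square\mathcal D_I$ followed by a map in $\mathcal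 D_I$, and $h^*$ maps ${}^\square\mathcal D_J$ into ${}^\square\mathcal D_I$ for every $h:I\to J$; - has \emph{finite sum types} if every $\mathcal D/I$ has finite coproducts and every $h^*$ preserves them; - is \emph{extensive} if it has finite sum types and for all $f:A\to I$, $g:B\to I$ in $\mathcal D$, reindexing along the coproduct inclusions is an equivalence $\mathcal D/\mathrm{dom}(f+_I g)\to\mathcal D/A\times\mathcal D/B$; - is \emph{strongly extensive} if it is extensive and every category $\mathcal D/I$ is extensive, where a category with finite coproducts is \emph{extensive} if, in every commutative diagram with bottom row a coproduct diagram $A\to A+B\leftarrow B$, top row $X\to C\leftarrow Y$, and vertical maps $X\to A$, $C\to A+B$, $Y\to B$, the top row is a coproduct diagram if and only if both squares are pullbacks. A \emph{universe} is a display map $u$ such that the class $\mathcal D_u\subseteq\mathcal D$ of all pullbacks of $u$ is a class of display maps. It is \emph{closed under $\Sigma$-, $\Pi$-, identity and finite sum types} if $(\mathbb B,\mathcal D_u)$ has $\Sigma$-types and $\Pi$-types, for each $I$ every map of $\mathcal D_u/I$ factors in $\mathcal D_u/I$ as a map in ${}^\square\mathcal D_I$ followed by a map in $(\mathcal D_u)_I$,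 and $(\mathbb B,\mathcal D_u)$ has finite sum types which are preserved by the inclusions $\mathcal D_u/I\to\mathcal D/I$. Let $p:\mathsf{Poly}\to\mathbb B$ be the fibration opposite to the codomain fibration $\mathcal D\to\mathbb B$: an object over $I$ is a display map $f:A\to I$, and a map from $(g:B\to J)$ to $(f:A\to I)$ is a pair of a map $h:J\to I$ and a map $\phi:h^*A\to B$ over $J$, so that the fibre over $I$ is $(\mathcal D/I)^{\mathrm{op}}$. Let $\mathcal G$ be the class of maps of $\mathsf{Poly}$ that are a vertical map which is a product projection in its fibre, followed by a $p$-cartesian map lying over a map in $\mathcal D$. \textbf{Theorem.} Let $(\mathbb B,\mathcal D)$ be a strongly extensive, well-rooted display map category with $\Sigma$-, $\Pi$- and identity types. Then $(\mathsf{Poly},\mathcal G)$ is a strongly extensive, well-rooted display map category with $\Sigma$-, $\Pi$- and identity types. Moreover, if $(\mathbb B,\mathcal D)$ has a universe closed under $\Sigma$-, $\Pi$-, identity and finite sum types, then so does $(\mathsf{Poly},\mathcal G)$. -/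

import Mathlib

open CategoryTheory CategoryTheory.Limits

universe v u

/-! ## Extensive categories -/

/-- A category with finite coproducts is extensive if, in every commutative diagram
```
X ---> C <--- Y
|      |      |
v      v      v
A --> A+B <-- B
```
whose bottom row is a coproduct diagram, the top row is a coproduct diagram if and only if
both squares are pullbacks. -/
structure IsExtensiveCategory (C : Type u) [Category.{v} C] : Prop where
  hasFiniteCoproducts : HasFiniteCoproducts C
  coproduct_iff_pullbacks : ∀ {A B X Y : C} (c : BinaryCofan A B) (c' : BinaryCofan X Y)
    (a : X ⟶ A) (b : Y ⟶ B) (f : c'.pt ⟶ c.pt), Nonempty (IsColimit c) →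
    c'.inl ≫ f = a ≫ c.inl → c'.inr ≫ f = b ≫ c.inr →
    (Nonempty (IsColimit c') ↔
      IsPullback c'.inl a f c.inl ∧ IsPullback c'.inr b f c.inr)

/-! ## Display map categories -/

section DisplayMaps

variable {B : Type u} [Category.{v} B]

/-- `D` is a class of display maps in `B`, i.e. `(B, D)` is a display map category: `D` contains
the identities, display maps have pullbacks along arbitrary maps, and in every pullback square
over a display map the opposite side is a display map. -/
class IsDisplayClass (D : MorphismProperty B) : Prop extends
  D.ContainsIdentities, D.HasPullbacks, D.IsStableUnderBaseChange

/-- Arbitrary maps have pullbacks along a display map. -/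
theorem IsDisplayClass.hasPullbacksAlong {D : MorphismProperty B} [IsDisplayClass D]
    {X Y : B} {f : X ⟶ Y} (hf : D f) : HasPullbacksAlong f := fun g =>
  haveI : HasPullback f g := MorphismProperty.HasPullbacks.hasPullback g hf
  hasPullback_symmetry f g

/-- `(B, D)` is well-rooted: `B` has a terminal object and every map into it is a display map. -/
structure IsWellRooted (D : MorphismProperty B) : Prop where
  hasTerminal : HasTerminal B
  toTerminal : ∀ {X T : B}, IsTerminal T → ∀ f : X ⟶ T, D f

/-- `(B, D)` has `Σ`-types: display maps are closed under composition. -/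
def HasSigmaTypes (D : MorphismProperty B) : Prop :=
  D.IsStableUnderComposition

/-- `(B, D)` has `Π`-types: for display maps `f : Y ⟶ A` and `g : C ⟶ Y` there is a couniversal
arrow from the pullback functor `f^* : B/A ⥤ B/Y` to `g` (a terminal object of the comma category
`f^* ↓ g`), whose domain is (an object over `A` given by) a display map. -/
def HasPiTypes (D : MorphismProperty B) [IsDisplayClass D] : Prop :=
  ∀ {A Y C : B} (f : Y ⟶ A) (g : C ⟶ Y) (hf : D f), D g →
    haveI : HasPullbacksAlong f := IsDisplayClass.hasPullbacksAlong hf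
    ∃ t : CostructuredArrow (Over.pullback f) (Over.mk g),
      D t.left.hom ∧ Nonempty (IsTerminal t)

/-- The display slice category `D/I`: the full subcategory of `B/I` on the display maps. -/
abbrev DisplaySlice (D : MorphismProperty B) (I : B) : Type (max u v) :=
  D.Over ⊤ I

/-- The class `D_I` of those maps in `D/I` whose underlying map in `B` is a display map. -/
def sliceDisplay (D : MorphismProperty B) (I : B) : MorphismProperty (DisplaySlice D I) :=
  fun _ _ f => D f.left

/-- The pullback functor `h^* : D/J ⥤ D/I` along `h : I ⟶ J`. -/
noncomputable abbrev slicePullback (D : MorphismProperty B) [IsDisplayClass D] {I J : B}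
    (h : I ⟶ J) : DisplaySlice D J ⥤ DisplaySlice D I :=
  MorphismProperty.Over.pullback D ⊤ h

/-- `(B, D)` has identity types: each display slice has factorizations into a map with the left
lifting property against `D_I` followed by a map in `D_I`, and the left classes are preserved by
pullback functors. -/
structure HasIdentityTypes (D : MorphismProperty B) [IsDisplayClass D] : Prop where
  stableLeftClasses : ∀ {I J : B} (h : I ⟶ J) {X Y : DisplaySlice D J} (m : X ⟶ Y),
    (sliceDisplay D J).llp m → (sliceDisplay D I).llp ((slicePullback D h).map m)
  factorizations : ∀ I : B,
    MorphismProperty.HasFactorization (sliceDisplay D I).llp (sliceDisplay D I)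

/-- `(B, D)` has finite sum types: the codomain fibration `D ⥤ B` has fibred finite coproducts,
i.e. every `D/I` has finite coproducts and they are preserved by pullback functors. -/
structure HasFiniteSumTypes (D : MorphismProperty B) [IsDisplayClass D] : Prop where
  hasFiniteCoproducts : ∀ I : B, HasFiniteCoproducts (DisplaySlice D I)
  preserves : ∀ {I J : B} (h : I ⟶ J), PreservesFiniteCoproducts (slicePullback D h)

/-- `(B, D)` is extensive: it has finite sum types and, for every coproduct `X +_I Y` in `D/I`,
reindexing along the coproduct inclusions is an equivalence
`D/dom(X +_I Y) ≌ D/dom X × D/dom Y`. -/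
structure IsExtensive (D : MorphismProperty B) [IsDisplayClass D] : Prop where
  hasFiniteSumTypes : HasFiniteSumTypes D
  isEquivalence : ∀ {I : B} {X Y : DisplaySlice D I} (c : BinaryCofan X Y),
    Nonempty (IsColimit c) →
    (Functor.prod' (slicePullback D c.inl.left) (slicePullback D c.inr.left)).IsEquivalence

/-- `(B, D)` is strongly extensive: it is extensive and every category `D/I` is extensive. -/
structure IsStronglyExtensive (D : MorphismProperty B) [IsDisplayClass D] : Prop where
  isExtensive : IsExtensive D
  slice : ∀ I : B, IsExtensiveCategory (DisplaySlice D I)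

/-! ### Universes -/

/-- The class `D_u` of `u`-small maps: those that arise as a pullback of `u`. -/
def smallMaps {E U : B} (u : E ⟶ U) : MorphismProperty B :=
  fun X Y f => ∃ (a : X ⟶ E) (b : Y ⟶ U), IsPullback a f u b

/-- A universe in `(B, D)`: a display map `u` whose pullbacks form a class of display maps. -/
structure IsUniverse (D : MorphismProperty B) {E U : B} (u : E ⟶ U) : Prop where
  display : D u
  isDisplayClass : IsDisplayClass (smallMaps u)

theorem IsUniverse.smallMaps_le {D : MorphismProperty B} [IsDisplayClass D] {E U : B} {u : E ⟶ U}
    (hu : IsUniverse D u) : smallMaps u ≤ D := by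
  rintro X Y f ⟨a, b, h⟩
  exact MorphismProperty.of_isPullback h hu.display

/-- The inclusion `D_u/I ⥤ D/I`. -/
abbrev IsUniverse.inclusion {D : MorphismProperty B} [IsDisplayClass D] {E U : B} {u : E ⟶ U}
    (hu : IsUniverse D u) (I : B) : DisplaySlice (smallMaps u) I ⥤ DisplaySlice D I :=
  MorphismProperty.Over.changeProp I hu.smallMaps_le le_rfl

/-- The universe `u` has identity types: every `D_u/I` has factorizations into a map of the
left class of `D_I` (not of `(D_u)_I`) followed by a map of `(D_u)_I`. -/
def IsUniverse.HasIdentityTypes {D : MorphismProperty B} [IsDisplayClass D] {E U : B}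
    {u : E ⟶ U} (hu : IsUniverse D u) : Prop :=
  ∀ I : B, MorphismProperty.HasFactorization
    ((sliceDisplay D I).llp.inverseImage (hu.inclusion I)) (sliceDisplay (smallMaps u) I)

/-- `(B, D)` has a universe closed under `Σ`-, `Π`-, identity and finite sum types. -/
def HasClosedUniverse (D : MorphismProperty B) [IsDisplayClass D] : Prop :=
  ∃ (E U : B) (u : E ⟶ U) (hu : IsUniverse D u),
    haveI : IsDisplayClass (smallMaps u) := hu.isDisplayClass
    HasSigmaTypes (smallMaps u) ∧ HasPiTypes (smallMaps u) ∧ hu.HasIdentityTypes ∧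
    HasFiniteSumTypes (smallMaps u) ∧ ∀ I : B, PreservesFiniteCoproducts (hu.inclusion I)

end DisplayMaps

/-! ## Gluing -/

/-- The product projections in a category. -/
def productProjections (C : Type u) [Category.{v} C] : MorphismProperty C :=
  fun X _ f => ∃ (Z : C) (g : X ⟶ Z), Nonempty (IsLimit (BinaryFan.mk f g))

/-- Given `p : E ⥤ B`, a class `D` of maps in `B` and a class `F I` of maps in each fibre `E(I)`,
the glued class consists of the maps in `E` that are a vertical map belonging to the class of its
fibre, followed by a `p`-cartesian map lying over a map in `D`. -/
def gluedClass {E : Type*} {B : Type*} [Category* E] [Category* B] (p : E ⥤ B)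
    (D : MorphismProperty B) (F : ∀ I : B, MorphismProperty (p.Fiber I)) : MorphismProperty E :=
  fun X Y f => ∃ (Z : p.Fiber (p.obj X)) (v : Functor.Fiber.mk (p := p) (a := X) rfl ⟶ Z)
    (c : Functor.Fiber.fiberInclusion.obj Z ⟶ Y),
    Functor.Fiber.fiberInclusion.map v ≫ c = f ∧ F (p.obj X) v ∧
    p.IsStronglyCartesian (p.map c) c ∧ D (p.map c)

/-! ## The polynomial model -/

/-- The total category `PolyModel D`, written `Poly`, of the fibration opposite to the codomain
fibration `D ⥤ B`. An object over `I = base` is a display map `map : total ⟶ I`, that is,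
an object of `D/I`. -/
structure PolyModel {B : Type u} [Category.{v} B] (D : MorphismProperty B) where
  base : B
  total : B
  map : total ⟶ base
  display : D map

namespace PolyModel

variable {B : Type u} [Category.{v} B] {D : MorphismProperty B} [IsDisplayClass D]

instance (X : PolyModel D) {J : B} (h : J ⟶ X.base) : HasPullback X.map h :=
  MorphismProperty.HasPullbacks.hasPullback h X.display

/-- A map `X ⟶ Y` in `Poly` is a map `base` of bases together with a vertical map
`X ⟶ base^* Y` of the opposite fibration, that is, a map `fam : base^* Y ⟶ X` in `D/X.base`. -/
structure Hom (X Y : PolyModel D) where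
  base : X.base ⟶ Y.base
  fam : pullback Y.map base ⟶ X.total
  fam_map : fam ≫ X.map = pullback.snd Y.map base

theorem Hom.mk_congr {X Y : PolyModel D} {a b : X.base ⟶ Y.base}
    {φ : pullback Y.map a ⟶ X.total} {ψ : pullback Y.map b ⟶ X.total}
    {hφ : φ ≫ X.map = pullback.snd Y.map a} {hψ : ψ ≫ X.map = pullback.snd Y.map b}
    (h : a = b)
    (h' : φ = pullback.lift (pullback.fst Y.map a) (pullback.snd Y.map a)
      (by rw [pullback.condition, h]) ≫ ψ) : Hom.mk a φ hφ = Hom.mk b ψ hψ := by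
  subst h
  congr 1
  rw [h']
  convert Category.id_comp ψ
  apply pullback.hom_ext <;> simp

/-- The base change along `h : J ⟶ Y.base` of the map `g.fam : g.base^* Z ⟶ Y` of `D/Y.base`,
as a map `(h ≫ g.base)^* Z ⟶ h^* Y` in `D/J`. -/
noncomputable def Hom.reindex {Y Z : PolyModel D} (g : Hom Y Z) {J : B} (h : J ⟶ Y.base) :
    pullback Z.map (h ≫ g.base) ⟶ pullback Y.map h :=
  pullback.lift
    (pullback.lift (pullback.fst _ _) (pullback.snd _ _ ≫ h)
      (by rw [pullback.condition, Category.assoc]) ≫ g.fam)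
    (pullback.snd _ _)
    (by rw [Category.assoc, g.fam_map, pullback.lift_snd])

/-- Identities are given by `1^* X ≅ X`, and the composite of `f : X ⟶ Y` and `g : Y ⟶ Z` by
`(f.base ≫ g.base)^* Z ≅ f.base^* (g.base^* Z) ⟶ f.base^* Y ⟶ X`. -/
noncomputable instance : Category (PolyModel D) where
  Hom := Hom
  id X :=
    { base := 𝟙 X.base
      fam := pullback.fst X.map (𝟙 X.base)
      fam_map := by rw [pullback.condition, Category.comp_id] }
  comp f g :=
    { base := f.base ≫ g.base
      fam := g.reindex f.base ≫ f.fam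
      fam_map := by rw [Category.assoc, f.fam_map, Hom.reindex, pullback.lift_snd] }
  id_comp f := by
    apply Hom.mk_congr (Category.id_comp _)
    rw [Hom.reindex, pullback.lift_fst]
    congr 1
    apply pullback.hom_ext <;> simp
  comp_id f := by
    apply Hom.mk_congr (Category.comp_id _)
    congr 1
    apply pullback.hom_ext
    · rw [Hom.reindex, pullback.lift_fst, pullback.lift_fst, pullback.lift_fst]
    · rw [Hom.reindex, pullback.lift_snd, pullback.lift_snd]
  assoc f g h := by
    apply Hom.mk_congr (Category.assoc _ _ _)
    simp only [← Category.assoc]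
    congr 1
    apply pullback.hom_ext
    · refine (Category.assoc _ _ _).trans (Eq.trans ?_ (Category.assoc _ _ _).symm)
      simp only [Hom.reindex, pullback.lift_fst]
      simp only [← Category.assoc]
      congr 1
      apply pullback.hom_ext
      · simp only [Category.assoc, pullback.lift_fst]
        simp only [← Category.assoc]
        congr 1
        apply pullback.hom_ext
        · simp only [Category.assoc, pullback.lift_fst]
        · simp only [Category.assoc, pullback.lift_snd, pullback.lift_snd_assoc]
      · simp only [Category.assoc, pullback.lift_snd, pullback.lift_snd_assoc]
    · simp only [Hom.reindex, Category.assoc, pullback.lift_snd]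

variable (D) in
/-- The fibration `p : Poly ⥤ B`, opposite to the codomain fibration. -/
noncomputable def proj : PolyModel D ⥤ B where
  obj X := X.base
  map f := Hom.base f
  map_id _ := rfl
  map_comp _ _ := rfl

variable (D) in
/-- The display maps of the polynomial model: the glued class obtained from `p : Poly ⥤ B`, the
display maps in `B`, and the product projections in the fibres `Poly(I) = (D/I)ᵒᵖ`. -/
noncomputable def displayMaps : MorphismProperty (PolyModel D) :=
  gluedClass (proj D) D fun I => productProjections ((proj D).Fiber I)

end PolyModel

/-! The hypotheses are first made elementary. Over a well-rooted base, strong extensivity says that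
`B` is extensive and that `D` contains coproduct inclusions and maps out of initial objects and is
closed under copairing (`IsStronglyExtensive.sumClosed`). Conversely, in an extensive category such
a class of display maps is strongly extensive if it is closed under composition
(`IsStronglyExtensive.of_sumClosed`). `Π`-types become the universal property `IsPi`, which is
stable under base change, and identity types become statements about `D.llp` in `B` itself.

Think of an object of `Poly` as a base `I` with a family of sets `A_i`; a map to `(J, B)` is `h : I
⟶ J` with functions `B_{h i} ⟶ A_i`. Maps into `(K, 0)` are just maps of bases, and a pullback over
`(K, 0)` is the pullback of the bases carrying the sum of the two families. The display maps of
`Poly` are exactly the pullbacks of maps `C ⟶ (K, 0)` lying over a display map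
(`displayMaps_eq_glued`). Everything is proved for this description, and for a subclass `F` of `D`
as well where the universe needs it.

Coproducts in `Poly` are sums of bases and of families, with cartesian inclusions, so extensivity
comes from `B`.

For `Π`-types, base change reduces to maps `Y ⟶ (J, 0)` and `C ⟶ (Y.base, 0)`. A map from `W
×_{(J,0)} Y` to `C` chooses, for `w` and `y` over the same `j`, some `c` in `C.base` over `y`, and
for each `n` in `C_c` an element of `W_w + Y_y`. The latter is an element of `1 + Y_y` together with
an element of `W_w` whenever the value is in `1`. So the product has base `Π_y Σ_c Π_n (1 + Y_y)`,
and its family consists of the pairs `(y, n)` with value in `1` (`isPi_toZero`).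

For identity types, let `n : X ⟶ Z` lie over `J`. Then `n` is in the left class if its base is and
its vertical part has a retraction over `J`: first the base is lifted, then the family, as a section
of a dependent product (`hasLiftingProperty_toZero`). Maps between display objects factor through
such maps, and by the retract argument every left map between them has this form, which is visibly
stable under base change.

If `u : E ⟶ U` is the given universe, the new one lives over `(V, 0)`, where `V` consists of `a` in
`U` with a function `E_a ⟶ U`: such a point names a small type together with a small family on it
(`exists_smallMaps_eq_glued`). -/

/-! ## Binary coproducts and extensivity -/

section Coproducts

variable {C : Type u} [Category.{v} C]

/-- `a` and `b` are the inclusions of a binary coproduct. -/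
def IsCoprod {X Y Z : C} (a : X ⟶ Z) (b : Y ⟶ Z) : Prop :=
  Nonempty (IsColimit (BinaryCofan.mk a b))

theorem isPullback_of_exists_lift {P X Y Z : C} {f : P ⟶ X} {g : P ⟶ Y} {h : X ⟶ Z} {k : Y ⟶ Z}
    (w : f ≫ h = g ≫ k)
    (hl : ∀ {W : C} (p : W ⟶ X) (q : W ⟶ Y), p ≫ h = q ≫ k → ∃ m : W ⟶ P, m ≫ f = p ∧ m ≫ g = q)
    (he : ∀ {W : C} (m m' : W ⟶ P), m ≫ f = m' ≫ f → m ≫ g = m' ≫ g → m = m') :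
    IsPullback f g h k :=
  ⟨⟨w⟩, ⟨PullbackCone.IsLimit.mk _ (fun s => (hl s.fst s.snd s.condition).choose)
    (fun s => (hl s.fst s.snd s.condition).choose_spec.1)
    (fun s => (hl s.fst s.snd s.condition).choose_spec.2) fun s _ h₁ h₂ =>
      he _ _ (h₁.trans (hl s.fst s.snd s.condition).choose_spec.1.symm)
        (h₂.trans (hl s.fst s.snd s.condition).choose_spec.2.symm)⟩⟩

namespace IsCoprod

theorem of_isColimit {X Y : C} {c : BinaryCofan X Y} (hc : IsColimit c) :
    IsCoprod c.inl c.inr :=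
  ⟨hc.ofIsoColimit (isoBinaryCofanMk c)⟩

theorem nonempty_isColimit {X Y : C} {c : BinaryCofan X Y} (h : IsCoprod c.inl c.inr) :
    Nonempty (IsColimit c) :=
  ⟨h.some.ofIsoColimit (isoBinaryCofanMk c).symm⟩

theorem coprod (X Y : C) [HasBinaryCoproduct X Y] :
    IsCoprod (coprod.inl : X ⟶ X ⨿ Y) coprod.inr :=
  ⟨coprodIsCoprod X Y⟩

variable {X Y Z : C} {a : X ⟶ Z} {b : Y ⟶ Z}

theorem hom_ext (h : IsCoprod a b) {W : C} {f g : Z ⟶ W} (h₁ : a ≫ f = a ≫ g)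
    (h₂ : b ≫ f = b ≫ g) : f = g :=
  BinaryCofan.IsColimit.hom_ext h.some h₁ h₂

/-- The copairing of two maps out of a binary coproduct. -/
noncomputable def desc (h : IsCoprod a b) {W : C} (f : X ⟶ W) (g : Y ⟶ W) : Z ⟶ W :=
  (BinaryCofan.IsColimit.desc' h.some f g).1

@[simp]
theorem inl_desc (h : IsCoprod a b) {W : C} (f : X ⟶ W) (g : Y ⟶ W) : a ≫ h.desc f g = f :=
  (BinaryCofan.IsColimit.desc' h.some f g).2.1

@[simp]
theorem inl_desc_assoc (h : IsCoprod a b) {W V : C} (f : X ⟶ W) (g : Y ⟶ W) (k : W ⟶ V) :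
    a ≫ h.desc f g ≫ k = f ≫ k := by
  rw [← Category.assoc, inl_desc]

@[simp]
theorem inr_desc (h : IsCoprod a b) {W : C} (f : X ⟶ W) (g : Y ⟶ W) : b ≫ h.desc f g = g :=
  (BinaryCofan.IsColimit.desc' h.some f g).2.2

@[simp]
theorem inr_desc_assoc (h : IsCoprod a b) {W V : C} (f : X ⟶ W) (g : Y ⟶ W) (k : W ⟶ V) :
    b ≫ h.desc f g ≫ k = g ≫ k := by
  rw [← Category.assoc, inr_desc]

theorem of_unique (h : ∀ {W : C} (f : X ⟶ W) (g : Y ⟶ W), ∃ k : Z ⟶ W, a ≫ k = f ∧ b ≫ k = g)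
    (h' : ∀ {W : C} (f g : Z ⟶ W), a ≫ f = a ≫ g → b ≫ f = b ≫ g → f = g) : IsCoprod a b :=
  ⟨BinaryCofan.IsColimit.mk _ (fun f g => (h f g).choose) (fun f g => (h f g).choose_spec.1)
    (fun f g => (h f g).choose_spec.2) fun f g _ h₁ h₂ =>
      h' _ _ (h₁.trans (h f g).choose_spec.1.symm) (h₂.trans (h f g).choose_spec.2.symm)⟩

theorem symm (h : IsCoprod a b) : IsCoprod b a :=
  of_unique (fun f g => ⟨h.desc g f, by simp, by simp⟩) fun _ _ h₁ h₂ => h.hom_ext h₂ h₁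

theorem of_iso (h : IsCoprod a b) {X' Y' Z' : C} {a' : X' ⟶ Z'} {b' : Y' ⟶ Z'} (i : X' ≅ X)
    (j : Y' ≅ Y) (k : Z' ≅ Z) (ha : a' ≫ k.hom = i.hom ≫ a) (hb : b' ≫ k.hom = j.hom ≫ b) :
    IsCoprod a' b' := by
  refine of_unique (fun f g => ⟨k.hom ≫ h.desc (i.inv ≫ f) (j.inv ≫ g), ?_, ?_⟩)
    fun f g h₁ h₂ => ?_
  · simp [reassoc_of% ha]
  · simp [reassoc_of% hb]
  · rw [← cancel_epi k.inv]
    apply h.hom_ext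
    · rw [← cancel_epi i.hom, ← reassoc_of% ha, ← reassoc_of% ha]
      simpa using h₁
    · rw [← cancel_epi j.hom, ← reassoc_of% hb, ← reassoc_of% hb]
      simpa using h₂

/-- Two binary coproducts of the same objects are isomorphic. -/
noncomputable def uniqueUpToIso (h : IsCoprod a b) {Z' : C} {a' : X ⟶ Z'} {b' : Y ⟶ Z'}
    (h' : IsCoprod a' b') : Z ≅ Z' where
  hom := h.desc a' b'
  inv := h'.desc a b
  hom_inv_id := by apply h.hom_ext <;> simp
  inv_hom_id := by apply h'.hom_ext <;> simp

theorem of_isInitial_right (hY : IsInitial Y) (a : X ⟶ Z) [IsIso a] (b : Y ⟶ Z) : IsCoprod a b :=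
  of_unique (fun f g => ⟨inv a ≫ f, by simp, hY.hom_ext _ _⟩) fun f g h _ => by
    rwa [cancel_epi] at h

theorem isIso_inl_of_isInitial (h : IsCoprod a b) (hY : IsInitial Y) : IsIso a := by
  refine ⟨h.desc (𝟙 X) (hY.to X), by simp, ?_⟩
  apply h.hom_ext
  · simp
  · exact hY.hom_ext _ _

end IsCoprod

/-- A category whose finite coproducts make it extensive, as a class. -/
class HasExtensiveSums (C : Type u) [Category.{v} C] : Prop where
  isExtensiveCategory : IsExtensiveCategory C

instance [HasExtensiveSums C] : HasFiniteCoproducts C :=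
  HasExtensiveSums.isExtensiveCategory.hasFiniteCoproducts

instance [HasExtensiveSums C] : HasInitial C := inferInstance

instance [HasExtensiveSums C] : HasBinaryCoproducts C := inferInstance

namespace IsCoprod

variable [HasExtensiveSums C] {X Y Z : C} {a : X ⟶ Z} {b : Y ⟶ Z}

theorem of_isPullback (h : IsCoprod a b) {X' Y' Z' : C} {a' : X' ⟶ Z'} {b' : Y' ⟶ Z'}
    {f : X' ⟶ X} {g : Y' ⟶ Y} {k : Z' ⟶ Z} (hX : IsPullback a' f k a) (hY : IsPullback b' g k b) :
    IsCoprod a' b' :=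
  (HasExtensiveSums.isExtensiveCategory.coproduct_iff_pullbacks (BinaryCofan.mk a b)
    (BinaryCofan.mk a' b') f g k h hX.w hY.w).2 ⟨hX, hY⟩

theorem isPullback (h : IsCoprod a b) {X' Y' Z' : C} {a' : X' ⟶ Z'} {b' : Y' ⟶ Z'}
    (h' : IsCoprod a' b') {f : X' ⟶ X} {g : Y' ⟶ Y} {k : Z' ⟶ Z} (hX : a' ≫ k = f ≫ a)
    (hY : b' ≫ k = g ≫ b) : IsPullback a' f k a ∧ IsPullback b' g k b :=
  (HasExtensiveSums.isExtensiveCategory.coproduct_iff_pullbacks (BinaryCofan.mk a b)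
    (BinaryCofan.mk a' b') f g k h hX hY).1 h'

end IsCoprod

section Extensive

variable [HasExtensiveSums C]

/-- Initial objects of extensive categories are strict. -/
noncomputable def isInitialOfHom {O P : C} (hO : IsInitial O) (f : P ⟶ O) : IsInitial P := by
  -- Pull `O = O + O` back along `f`: then `P` is a coproduct of two copies of itself along
  -- identities, so any two maps out of `P` agree.
  have hO' : IsCoprod (𝟙 O) (𝟙 O) := IsCoprod.of_isInitial_right hO _ _
  have hP : IsCoprod (𝟙 P) (𝟙 P) :=
    hO'.of_isPullback (IsPullback.of_horiz_isIso ⟨by simp⟩ : IsPullback (𝟙 P) f f (𝟙 O))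
      (IsPullback.of_horiz_isIso ⟨by simp⟩ : IsPullback (𝟙 P) f f (𝟙 O))
  refine IsInitial.ofUniqueHom (fun W => f ≫ hO.to W) fun W m => ?_
  have h₁ := hP.inl_desc m (f ≫ hO.to W)
  rw [← h₁, hP.inr_desc]

theorem isPullback_of_isInitial {O O' X Z : C} (hO : IsInitial O) (hO' : IsInitial O')
    (f : O ⟶ X) (g : X ⟶ Z) (h : O' ⟶ Z) : IsPullback (hO.to O') f h g :=
  ⟨⟨hO.hom_ext _ _⟩, ⟨PullbackCone.IsLimit.mk _
    (fun s => (isInitialOfHom hO' s.fst).to O)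
    (fun s => (isInitialOfHom hO' s.fst).hom_ext _ _)
    (fun s => (isInitialOfHom hO' s.fst).hom_ext _ _)
    (fun s _ _ _ => (isInitialOfHom hO' s.fst).hom_ext _ _)⟩⟩

namespace IsCoprod

variable {X Y Z : C} {a : X ⟶ Z} {b : Y ⟶ Z}

/-- Compare the coproducts `X + 0` and `X + Y` along `a`; the left square is the kernel pair of `a`.
-/
theorem isPullback_inl_self (h : IsCoprod a b) : IsPullback (𝟙 X) (𝟙 X) a a :=
  (h.isPullback (of_isInitial_right initialIsInitial (𝟙 X) (initial.to X)) (f := 𝟙 X)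
    (g := initial.to Y) (k := a) (by simp) (initialIsInitial.hom_ext _ _)).1

theorem mono_inl (h : IsCoprod a b) : Mono a :=
  ⟨fun f g w => by
    have H := h.isPullback_inl_self
    have h₁ := H.lift_fst f g w
    have h₂ := H.lift_snd f g w
    simp only [Category.comp_id] at h₁ h₂
    exact h₁.symm.trans h₂⟩

/-- Binary coproducts are stable under pullback. -/
theorem of_isPullback_over (h : IsCoprod a b) {I J : C} {z : Z ⟶ J} {i : I ⟶ J} {X' Y' Z' : C}
    {fX : X' ⟶ X} {fY : Y' ⟶ Y} {fZ : Z' ⟶ Z} {x' : X' ⟶ I} {y' : Y' ⟶ I} {z' : Z' ⟶ I}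
    (hX : IsPullback fX x' (a ≫ z) i) (hY : IsPullback fY y' (b ≫ z) i)
    (hZ : IsPullback fZ z' z i) {a' : X' ⟶ Z'} {b' : Y' ⟶ Z'} (ha : a' ≫ fZ = fX ≫ a)
    (ha' : a' ≫ z' = x') (hb : b' ≫ fZ = fY ≫ b) (hb' : b' ≫ z' = y') : IsCoprod a' b' := by
  subst ha' hb'
  exact h.of_isPullback (IsPullback.of_right hX.flip ha hZ.flip)
    (IsPullback.of_right hY.flip hb hZ.flip)

end IsCoprod

end Extensive

end Coproducts

/-! ## Display slices -/

section Slices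

variable {B : Type u} [Category.{v} B] {D : MorphismProperty B}

namespace DisplaySlice

variable {I : B}

/-- The domain of an object of `D/I`. -/
abbrev dom (X : DisplaySlice D I) : B := X.left

/-- The underlying display map of an object of `D/I`. -/
def arr (X : DisplaySlice D I) : X.dom ⟶ I := X.hom

theorem display (X : DisplaySlice D I) : D X.arr := X.prop

/-- The object of `D/I` given by a display map. -/
abbrev of {A : B} (f : A ⟶ I) (hf : D f) : DisplaySlice D I where
  left := A
  right := ⟨⟨⟩⟩
  hom := f
  prop := hf

/-- The underlying map of a map of `D/I`. -/
def domMap {X Y : DisplaySlice D I} (f : X ⟶ Y) : X.dom ⟶ Y.dom := f.left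

theorem domMap_arr {X Y : DisplaySlice D I} (f : X ⟶ Y) : domMap f ≫ Y.arr = X.arr :=
  MorphismProperty.Over.w f

theorem domMap_arr_assoc {X Y : DisplaySlice D I} (f : X ⟶ Y) {Z : B} (k : I ⟶ Z) :
    domMap f ≫ Y.arr ≫ k = X.arr ≫ k := by
  rw [← Category.assoc, domMap_arr]

/-- A map of `D/I` from a commutative triangle. -/
def homOf {X Y : DisplaySlice D I} (f : X.dom ⟶ Y.dom) (w : f ≫ Y.arr = X.arr) : X ⟶ Y :=
  MorphismProperty.Over.homMk f w trivial

@[simp]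
theorem domMap_homOf {X Y : DisplaySlice D I} (f : X.dom ⟶ Y.dom) (w : f ≫ Y.arr = X.arr) :
    domMap (homOf f w) = f := rfl

@[simp]
theorem domMap_id (X : DisplaySlice D I) : domMap (𝟙 X) = 𝟙 X.dom := rfl

@[simp]
theorem domMap_comp {X Y Z : DisplaySlice D I} (f : X ⟶ Y) (g : Y ⟶ Z) :
    domMap (f ≫ g) = domMap f ≫ domMap g := rfl

theorem hom_ext {X Y : DisplaySlice D I} {f g : X ⟶ Y} (h : domMap f = domMap g) : f = g :=
  MorphismProperty.Over.Hom.ext h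

instance {X Y : DisplaySlice D I} (f : X ⟶ Y) [IsIso f] : IsIso (domMap f) :=
  ⟨domMap (inv f), by rw [← domMap_comp]; simp, by rw [← domMap_comp]; simp⟩

theorem isCoprod_of_domMap {X Y Z : DisplaySlice D I} {a : X ⟶ Z} {b : Y ⟶ Z}
    (h : IsCoprod (domMap a) (domMap b)) : IsCoprod a b := by
  refine IsCoprod.of_unique (fun f g => ⟨homOf (h.desc (domMap f) (domMap g)) ?_, ?_, ?_⟩)
    fun f g h₁ h₂ => hom_ext (h.hom_ext ?_ ?_)
  · apply h.hom_ext <;> simp [domMap_arr]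
  · apply hom_ext; simp
  · apply hom_ext; simp
  · rw [← domMap_comp, h₁, domMap_comp]
  · rw [← domMap_comp, h₂, domMap_comp]

/-- An object of `D/I` with initial domain is initial. -/
def isInitialOfDom {X : DisplaySlice D I} (h : IsInitial X.dom) : IsInitial X :=
  IsInitial.ofUniqueHom (fun Y => homOf (h.to Y.dom) (h.hom_ext _ _))
    fun _ _ => hom_ext (h.hom_ext _ _)

theorem isPullback_of_domMap {X Y Z W : DisplaySlice D I} {f : X ⟶ Y} {g : X ⟶ Z} {k : Y ⟶ W}
    {l : Z ⟶ W} (h : IsPullback (domMap f) (domMap g) (domMap k) (domMap l)) :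
    IsPullback f g k l := by
  have w : f ≫ k = g ≫ l := hom_ext h.w
  have w' : ∀ s : PullbackCone k l, domMap s.fst ≫ domMap k = domMap s.snd ≫ domMap l :=
    fun s => congrArg domMap s.condition
  refine ⟨⟨w⟩, ⟨PullbackCone.IsLimit.mk _
    (fun s => homOf (h.lift (domMap s.fst) (domMap s.snd) (w' s)) ?_) ?_ ?_ ?_⟩⟩
  · rw [← domMap_arr f, h.lift_fst_assoc, domMap_arr]
  · intro s
    apply hom_ext
    simp
  · intro s
    apply hom_ext
    simp
  · intro s m h₁ h₂
    apply hom_ext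
    apply h.hom_ext
    · simp [← h₁]
    · simp [← h₂]

variable [IsDisplayClass D] {J : B} (h : I ⟶ J)

instance (X : DisplaySlice D J) : HasPullback X.arr h :=
  MorphismProperty.HasPullbacks.hasPullback h X.display

/-- The projection from the pullback of an object of `D/J`. -/
noncomputable def pullbackFst (X : DisplaySlice D J) : ((slicePullback D h).obj X).dom ⟶ X.dom :=
  pullback.fst X.arr h

theorem isPullback (X : DisplaySlice D J) :
    IsPullback (pullbackFst h X) ((slicePullback D h).obj X).arr X.arr h :=
  IsPullback.of_hasPullback X.arr h

theorem pullback_domMap_fst {X Y : DisplaySlice D J} (f : X ⟶ Y) :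
    domMap ((slicePullback D h).map f) ≫ pullbackFst h Y = pullbackFst h X ≫ domMap f :=
  pullback.lift_fst (f := Y.arr) (g := h) _ _ _

theorem pullback_domMap_fst_assoc {X Y : DisplaySlice D J} (f : X ⟶ Y) {Z : B} (k : Y.dom ⟶ Z) :
    domMap ((slicePullback D h).map f) ≫ pullbackFst h Y ≫ k =
      pullbackFst h X ≫ domMap f ≫ k := by
  rw [← Category.assoc, pullback_domMap_fst, Category.assoc]

theorem isPullback_domMap {X Y : DisplaySlice D J} (f : X ⟶ Y) :
    IsPullback (pullbackFst h X) (domMap ((slicePullback D h).map f)) (domMap f)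
      (pullbackFst h Y) := by
  refine IsPullback.of_bot ?_ (pullback_domMap_fst h f).symm (isPullback h Y)
  rw [domMap_arr, domMap_arr]
  exact isPullback h X

end DisplaySlice

end Slices

/-! ## Consequences of strong extensivity -/

/-- The class `F` contains the maps out of initial objects and the inclusions of binary coproducts,
and is closed under copairing. -/
class SumClosed {C : Type u} [Category.{v} C] (F : MorphismProperty C) : Prop where
  of_isInitial : ∀ {O I : C}, IsInitial O → ∀ f : O ⟶ I, F f
  of_inl_of_inr : ∀ {X Y Z I : C} {a : X ⟶ Z} {b : Y ⟶ Z}, IsCoprod a b → ∀ f : Z ⟶ I,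
    F (a ≫ f) → F (b ≫ f) → F f
  inl : ∀ {X Y Z : C} {a : X ⟶ Z} {b : Y ⟶ Z}, IsCoprod a b → F a

theorem SumClosed.inr {C : Type u} [Category.{v} C] {F : MorphismProperty C} [SumClosed F]
    {X Y Z : C} {a : X ⟶ Z} {b : Y ⟶ Z} (h : IsCoprod a b) : F b :=
  SumClosed.inl h.symm

section Descent

variable {B : Type u} [Category.{v} B] {D : MorphismProperty B}

open DisplaySlice

/-! ### Transfer between `B` and the slice over the terminal object. -/

namespace IsWellRooted

variable [HasTerminal B] (hroot : IsWellRooted D)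

/-- An object of `B`, as an object of `D/1`. -/
noncomputable abbrev toSlice (hroot : IsWellRooted D) (X : B) : DisplaySlice D (⊤_ B) :=
  of (terminal.from X) (hroot.toTerminal terminalIsTerminal _)

/-- A map of `B`, as a map of `D/1`. -/
noncomputable def homToSlice {X : DisplaySlice D (⊤_ B)} {Y : B} (f : X.dom ⟶ Y) :
    X ⟶ hroot.toSlice Y :=
  homOf f (terminalIsTerminal.hom_ext _ _)

include hroot

/-- Well-rootedness lifts every object and every map of `B` to `D/1`, so universal properties in
`D/1` can be tested in `B`. -/
theorem isCoprod_domMap {X Y Z : DisplaySlice D (⊤_ B)} {a : X ⟶ Z} {b : Y ⟶ Z}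
    (h : IsCoprod a b) : IsCoprod (domMap a) (domMap b) := by
  refine IsCoprod.of_unique (fun {W} f g =>
    ⟨domMap (h.desc (hroot.homToSlice f) (hroot.homToSlice g)), ?_, ?_⟩) fun f g h₁ h₂ => ?_
  · rw [← domMap_comp, h.inl_desc]; rfl
  · rw [← domMap_comp, h.inr_desc]; rfl
  · exact congrArg domMap (h.hom_ext (f := hroot.homToSlice f) (g := hroot.homToSlice g)
      (DisplaySlice.hom_ext h₁) (DisplaySlice.hom_ext h₂))

theorem isPullback_domMap {X Y Z W : DisplaySlice D (⊤_ B)} {f : X ⟶ Y} {g : X ⟶ Z} {k : Y ⟶ W}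
    {l : Z ⟶ W} (h : IsPullback f g k l) :
    IsPullback (domMap f) (domMap g) (domMap k) (domMap l) := by
  have w : domMap f ≫ domMap k = domMap g ≫ domMap l := congrArg domMap h.w
  refine ⟨⟨w⟩, ⟨PullbackCone.IsLimit.mk _ (fun s => domMap (h.lift (W := hroot.toSlice s.pt)
    (homOf s.fst (terminalIsTerminal.hom_ext _ _)) (homOf s.snd (terminalIsTerminal.hom_ext _ _))
    (DisplaySlice.hom_ext s.condition))) ?_ ?_ ?_⟩⟩
  · intro s
    rw [← domMap_comp, h.lift_fst]; rfl
  · intro s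
    rw [← domMap_comp, h.lift_snd]; rfl
  · intro s m h₁ h₂
    refine congrArg domMap (h.hom_ext (W := hroot.toSlice s.pt)
      (k := homOf m (terminalIsTerminal.hom_ext _ _)) ?_ ?_)
    · rw [h.lift_fst]; exact DisplaySlice.hom_ext h₁
    · rw [h.lift_snd]; exact DisplaySlice.hom_ext h₂

theorem hasExtensiveSums (hslice : IsExtensiveCategory (DisplaySlice D (⊤_ B))) :
    HasExtensiveSums B := by
  have := hslice.hasFiniteCoproducts
  refine ⟨⟨?_, ?_⟩⟩
  · have : HasInitial B := by
      refine IsInitial.hasInitial (X := (⊥_ (DisplaySlice D (⊤_ B))).dom) ?_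
      exact IsInitial.ofUniqueHom (fun W => domMap (initial.to (hroot.toSlice W)))
        fun W m => congrArg domMap (initialIsInitial.hom_ext (hroot.homToSlice m) _)
    have : HasBinaryCoproducts B := by
      refine @hasBinaryCoproducts_of_hasColimit_pair _ _ fun {X Y} => ?_
      have h := hroot.isCoprod_domMap (IsCoprod.coprod (hroot.toSlice X) (hroot.toSlice Y))
      exact ⟨⟨⟨_, h.some⟩⟩⟩
    exact hasFiniteCoproducts_of_has_binary_and_initial
  · intro A A' X Y c c' a b f hc h₁ h₂
    let o : ∀ {P Q : B} (k : P ⟶ Q), hroot.toSlice P ⟶ hroot.toSlice Q := fun {P Q} k =>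
      hroot.homToSlice (X := hroot.toSlice P) k
    have hc' : IsCoprod (o c.inl) (o c.inr) := isCoprod_of_domMap (IsCoprod.of_isColimit hc.some)
    have key := hslice.coproduct_iff_pullbacks (BinaryCofan.mk (o c.inl) (o c.inr))
      (BinaryCofan.mk (o c'.inl) (o c'.inr)) (o a) (o b) (o f) hc' (DisplaySlice.hom_ext h₁)
      (DisplaySlice.hom_ext h₂)
    constructor
    · intro h
      have h' := key.1 (isCoprod_of_domMap (a := o c'.inl) (b := o c'.inr)
        (IsCoprod.of_isColimit h.some))
      exact ⟨hroot.isPullback_domMap h'.1, hroot.isPullback_domMap h'.2⟩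
    · intro h
      have h' : IsCoprod (o c'.inl) (o c'.inr) := key.2
        ⟨isPullback_of_domMap (f := o c'.inl) (g := o a) (k := o f) (l := o c.inl) h.1,
          isPullback_of_domMap (f := o c'.inr) (g := o b) (k := o f) (l := o c.inr) h.2⟩
      exact IsCoprod.nonempty_isColimit (hroot.isCoprod_domMap h')

end IsWellRooted

/-! ### Coproducts in display slices and closure of `D` under sums. -/

namespace IsStronglyExtensive

variable [IsDisplayClass D]

/-- Initial objects of `D/I` have initial domain. -/
theorem isInitial_dom [HasTerminal B] [HasExtensiveSums B] (hroot : IsWellRooted D)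
    (hext : IsStronglyExtensive D) {I : B} {X : DisplaySlice D I} (hX : IsInitial X) :
    Nonempty (IsInitial X.dom) := by
  have := hext.isExtensive.hasFiniteSumTypes.hasFiniteCoproducts (⊤_ B)
  have := hext.isExtensive.hasFiniteSumTypes.preserves (terminal.from I)
  have h₀ : IsInitial (⊥_ (DisplaySlice D (⊤_ B))).dom :=
    IsInitial.ofUniqueHom (fun W => domMap (initial.to (hroot.toSlice W)))
      fun W m => congrArg domMap (initialIsInitial.hom_ext (hroot.homToSlice m) _)
  -- `X` maps to the reindexed initial object of `D/1`, whose domain projects to an initial object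
  -- of `B`; these are strict.
  exact ⟨isInitialOfHom h₀ (domMap (hX.to _) ≫ pullbackFst (terminal.from I) _)⟩

theorem isEquivalence (hext : IsStronglyExtensive D) {I : B} {X Y Z : DisplaySlice D I}
    {a : X ⟶ Z} {b : Y ⟶ Z} (h : IsCoprod a b) :
    (Functor.prod' (slicePullback D (domMap a)) (slicePullback D (domMap b))).IsEquivalence :=
  hext.isExtensive.isEquivalence (BinaryCofan.mk a b) h

/-- Binary coproducts in `D/I` are binary coproducts in `B`. -/
theorem isCoprod_domMap [HasTerminal B] (hroot : IsWellRooted D)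
    (hext : IsStronglyExtensive D) {I : B} {X Y Z : DisplaySlice D I}
    {a : X ⟶ Z} {b : Y ⟶ Z} (h : IsCoprod a b) : IsCoprod (domMap a) (domMap b) := by
  have := hext.isEquivalence h
  let Φ := Functor.prod' (slicePullback D (domMap a)) (slicePullback D (domMap b))
  -- A map `Z ⟶ W` is a section of `Z × W ⟶ Z`, that is, a map from `U` to `V = Z × W` in `D/Z`.
  -- Since `Φ` is fully faithful, such maps correspond to pairs of sections over `X` and `Y`, hence
  -- to pairs of maps into `W`.
  let U : DisplaySlice D Z.dom := of (𝟙 Z.dom) (D.id_mem _)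
  have hV : ∀ W : B, ∃ (V : DisplaySlice D Z.dom) (ev : V.dom ⟶ W),
      (∀ {T : B} (t : T ⟶ Z.dom) (w : T ⟶ W), ∃ k : T ⟶ V.dom, k ≫ V.arr = t ∧ k ≫ ev = w) ∧
      ∀ {T : B} (f g : T ⟶ V.dom), f ≫ V.arr = g ≫ V.arr → f ≫ ev = g ≫ ev → f = g := by
    intro W
    have H := DisplaySlice.isPullback (terminal.from Z.dom) (hroot.toSlice W)
    exact ⟨(slicePullback D (terminal.from Z.dom)).obj (hroot.toSlice W), pullbackFst _ _,
      fun t w => ⟨H.lift w t (terminalIsTerminal.hom_ext _ _), H.lift_snd _ _ _,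
        H.lift_fst _ _ _⟩, fun f g h₁ h₂ => H.hom_ext h₂ h₁⟩
  refine IsCoprod.of_unique (fun {W} f g => ?_) (fun {W} f g h₁ h₂ => ?_)
  · obtain ⟨V, ev, hV, -⟩ := hV W
    have push : ∀ {A : DisplaySlice D I} (s : A ⟶ Z) (k : A.dom ⟶ W),
        ∃ m : (slicePullback D (domMap s)).obj U ⟶ (slicePullback D (domMap s)).obj V,
          domMap m ≫ pullbackFst (domMap s) V ≫ ev =
            ((slicePullback D (domMap s)).obj U).arr ≫ k := by
      intro A s k
      have H := DisplaySlice.isPullback (domMap s) V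
      obtain ⟨t, ht, ht'⟩ := hV (((slicePullback D (domMap s)).obj U).arr ≫ domMap s)
        (((slicePullback D (domMap s)).obj U).arr ≫ k)
      refine ⟨homOf (H.lift t ((slicePullback D (domMap s)).obj U).arr ht) (H.lift_snd _ _ _), ?_⟩
      rw [domMap_homOf, H.lift_fst_assoc, ht']
    obtain ⟨m₁, hm₁⟩ := push a f
    obtain ⟨m₂, hm₂⟩ := push b g
    obtain ⟨m, hm⟩ : ∃ m : U ⟶ V, Φ.map m = (m₁, m₂) := Φ.map_surjective _
    let n : Z.dom ⟶ V.dom := domMap m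
    have pull : ∀ {A : DisplaySlice D I} (s : A ⟶ Z) (k : A.dom ⟶ W)
        (_ : domMap ((slicePullback D (domMap s)).map m) ≫ pullbackFst (domMap s) V ≫ ev =
            ((slicePullback D (domMap s)).obj U).arr ≫ k), domMap s ≫ n ≫ ev = k := by
      intro A s k e
      have H : IsPullback (pullbackFst (domMap s) U) ((slicePullback D (domMap s)).obj U).arr
        (𝟙 Z.dom) (domMap s) := DisplaySlice.isPullback (domMap s) U
      let l : A.dom ⟶ _ := H.lift (domMap s) (𝟙 A.dom) (by rw [Category.comp_id, Category.id_comp])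
      have e₁ : l ≫ _ = _ := H.lift_fst _ _ _
      have e₂ : l ≫ _ = _ := H.lift_snd _ _ _
      rw [pullback_domMap_fst_assoc] at e
      have e₃ := congrArg (l ≫ ·) e
      simp only [reassoc_of% e₁, reassoc_of% e₂] at e₃
      exact e₃
    refine ⟨n ≫ ev, pull a f ?_, pull b g ?_⟩
    · rw [← hm₁]
      exact congrArg (fun t => domMap t ≫ pullbackFst (domMap a) V ≫ ev) (congrArg Prod.fst hm)
    · rw [← hm₂]
      exact congrArg (fun t => domMap t ≫ pullbackFst (domMap b) V ≫ ev) (congrArg Prod.snd hm)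
  · obtain ⟨V, ev, hV, hV'⟩ := hV W
    obtain ⟨tf, htf, htf'⟩ := hV (𝟙 _) f
    obtain ⟨tg, htg, htg'⟩ := hV (𝟙 _) g
    let mf : U ⟶ V := homOf tf htf
    let mg : U ⟶ V := homOf tg htg
    have push : ∀ {A : DisplaySlice D I} (s : A ⟶ Z), domMap s ≫ f = domMap s ≫ g →
        (slicePullback D (domMap s)).map mf = (slicePullback D (domMap s)).map mg := by
      intro A s hs
      apply DisplaySlice.hom_ext
      apply (DisplaySlice.isPullback (domMap s) V).hom_ext
      · rw [pullback_domMap_fst, pullback_domMap_fst]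
        apply hV'
        · rw [Category.assoc, Category.assoc, domMap_arr, domMap_arr]
        · have H : IsPullback (pullbackFst (domMap s) U) ((slicePullback D (domMap s)).obj U).arr
            (𝟙 Z.dom) (domMap s) := DisplaySlice.isPullback (domMap s) U
          have e := H.w
          rw [Category.comp_id] at e
          have ef : domMap mf ≫ ev = f := htf'
          have eg : domMap mg ≫ ev = g := htg'
          rw [Category.assoc, Category.assoc, ef, eg, e, Category.assoc, Category.assoc, hs]
      · rw [domMap_arr, domMap_arr]
    have e := congrArg domMap (Φ.map_injective (Prod.ext (push a h₁) (push b h₂)))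
    rw [← htf', ← htg']
    exact congrArg (· ≫ ev) e

/-- A strongly extensive class of display maps is closed under finite sums. -/
theorem sumClosed [HasTerminal B] [HasExtensiveSums B] (hroot : IsWellRooted D)
    (hext : IsStronglyExtensive D) : SumClosed D where
  of_isInitial {O I} hO f := by
    have := hext.isExtensive.hasFiniteSumTypes.hasFiniteCoproducts I
    have h := (hext.isInitial_dom hroot (initialIsInitial (C := DisplaySlice D I))).some
    have : f = (hO.uniqueUpToIso h).hom ≫ (⊥_ (DisplaySlice D I)).arr := hO.hom_ext _ _
    rw [this, D.cancel_left_of_respectsIso]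
    exact display _
  of_inl_of_inr {X Y Z I a b} h f h₁ h₂ := by
    have := hext.isExtensive.hasFiniteSumTypes.hasFiniteCoproducts I
    have h' := hext.isCoprod_domMap hroot (IsCoprod.coprod (of (a ≫ f) h₁) (of (b ≫ f) h₂))
    have : f = (h.uniqueUpToIso h').hom ≫ (of (a ≫ f) h₁ ⨿ of (b ≫ f) h₂).arr := by
      apply h.hom_ext
      · exact ((h.inl_desc_assoc _ _ _).trans (domMap_arr _)).symm
      · exact ((h.inr_desc_assoc _ _ _).trans (domMap_arr _)).symm
    rw [this, D.cancel_left_of_respectsIso]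
    exact display _
  inl {X Y Z a b} h := by
    have := hext.isExtensive.hasFiniteSumTypes.hasFiniteCoproducts Y
    have h' : IsCoprod (hroot.homToSlice (X := hroot.toSlice X) a)
      (hroot.homToSlice (X := hroot.toSlice Y) b) := isCoprod_of_domMap h
    have := hext.isEquivalence h'
    let Φ := Functor.prod' (slicePullback D a) (slicePullback D b)
    have : Φ.IsEquivalence := this
    -- Essential surjectivity provides `E` over `Z` restricting to the identity over `X` and to an
    -- initial object over `Y`. By extensivity `E` is the sum of its restrictions, so its display
    -- map is `a` up to isomorphism.
    let E := Φ.objPreimage (of (𝟙 X) (D.id_mem X), ⊥_ (DisplaySlice D Y))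
    let e := Φ.objObjPreimageIso (of (𝟙 X) (D.id_mem X), ⊥_ (DisplaySlice D Y))
    let e₁ : (slicePullback D a).obj E ⟶ of (𝟙 X) (D.id_mem X) := e.hom.1
    have : IsIso e₁ := ⟨e.inv.1, congrArg Prod.fst e.hom_inv_id, congrArg Prod.fst e.inv_hom_id⟩
    let e₂ : (slicePullback D b).obj E ⟶ ⊥_ (DisplaySlice D Y) := e.hom.2
    have h₀ := isInitialOfHom
      (hext.isInitial_dom hroot (initialIsInitial (C := DisplaySlice D Y))).some (domMap e₂)
    have hE := h.of_isPullback (DisplaySlice.isPullback a E) (DisplaySlice.isPullback b E)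
    have := hE.isIso_inl_of_isInitial h₀
    have h₁ : domMap e₁ = ((slicePullback D a).obj E).arr :=
      (Category.comp_id _).symm.trans (domMap_arr e₁)
    have : IsIso ((slicePullback D a).obj E).arr := by rw [← h₁]; exact inferInstanceAs (IsIso (domMap e₁))
    have : a = inv ((slicePullback D a).obj E).arr ≫ pullbackFst a E ≫ E.arr := by
      rw [(DisplaySlice.isPullback a E).w, IsIso.inv_hom_id_assoc]
    rw [this, D.cancel_left_of_respectsIso, D.cancel_left_of_respectsIso]
    exact E.display

end IsStronglyExtensive

end Descent

/-! ## Finite sum types from sum closure -/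

section FiniteSums

theorem preservesFiniteCoproducts_of_isCoprod {C C' : Type*} [Category* C] [Category* C']
    [HasFiniteCoproducts C] (G : C ⥤ C')
    (h₀ : ∀ {X : C}, IsInitial X → Nonempty (IsInitial (G.obj X)))
    (h₂ : ∀ {X Y Z : C} {a : X ⟶ Z} {b : Y ⟶ Z}, IsCoprod a b → IsCoprod (G.map a) (G.map b)) :
    PreservesFiniteCoproducts G := by
  have : PreservesColimitsOfShape (Discrete WalkingPair) G := ⟨fun {K} => by
    have h := IsCoprod.coprod (K.obj ⟨WalkingPair.left⟩) (K.obj ⟨WalkingPair.right⟩)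
    have : PreservesColimit (pair (K.obj ⟨WalkingPair.left⟩) (K.obj ⟨WalkingPair.right⟩)) G :=
      preservesColimit_of_preserves_colimit_cocone h.some
        ((isColimitMapCoconeBinaryCofanEquiv G _ _).symm (h₂ h).some)
    exact preservesColimit_of_iso_diagram G (diagramIsoPair K).symm⟩
  have : PreservesColimit (Functor.empty.{0} C) G :=
    preservesColimit_of_preserves_colimit_cocone initialIsInitial
      ((isColimitMapCoconeEmptyCoconeEquiv G _).symm (h₀ initialIsInitial).some)
  have : PreservesColimitsOfShape (Discrete.{0} PEmpty) G :=
    preservesColimitsOfShape_pempty_of_preservesInitial G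
  exact ⟨fun n => PreservesFiniteCoproducts.of_preserves_binary_and_initial G (Fin n)⟩

theorem IsCoprod.map {C C' : Type*} [Category* C] [Category* C'] (G : C ⥤ C')
    [PreservesFiniteCoproducts G] {X Y Z : C} {a : X ⟶ Z} {b : Y ⟶ Z} (h : IsCoprod a b) :
    IsCoprod (G.map a) (G.map b) :=
  ⟨mapIsColimitOfPreservesOfIsColimit G _ _ h.some⟩

variable {B : Type u} [Category.{v} B] {F : MorphismProperty B}

open DisplaySlice

section

variable [HasExtensiveSums B] [SumClosed F]

namespace DisplaySlice

variable {I : B}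

theorem exists_isCoprod (X Y : DisplaySlice F I) :
    ∃ (Z : DisplaySlice F I) (a : X ⟶ Z) (b : Y ⟶ Z), IsCoprod (domMap a) (domMap b) := by
  have h := IsCoprod.coprod X.dom Y.dom
  refine ⟨of (h.desc X.arr Y.arr) (SumClosed.of_inl_of_inr h _ ?_ ?_), homOf coprod.inl ?_,
    homOf coprod.inr ?_, h⟩
  · rw [h.inl_desc]; exact X.display
  · rw [h.inr_desc]; exact Y.display
  · exact h.inl_desc _ _
  · exact h.inr_desc _ _

/-- The coproduct of the domains in `B` already lives in `F/I`, and coproducts are unique up to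
isomorphism. -/
theorem isCoprod_domMap_of_sumClosed {X Y Z : DisplaySlice F I} {a : X ⟶ Z} {b : Y ⟶ Z}
    (h : IsCoprod a b) : IsCoprod (domMap a) (domMap b) := by
  obtain ⟨Z', a', b', h'⟩ := exists_isCoprod X Y
  let i := h.uniqueUpToIso (isCoprod_of_domMap h')
  have : IsIso (domMap i.hom) := inferInstance
  refine h'.of_iso (Iso.refl _) (Iso.refl _) (asIso (domMap i.hom)) ?_ ?_
  · exact (congrArg domMap (h.inl_desc a' b')).trans (Category.id_comp _).symm
  · exact (congrArg domMap (h.inr_desc a' b')).trans (Category.id_comp _).symm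

theorem isInitial_dom_of_sumClosed {X : DisplaySlice F I} (h : IsInitial X) :
    Nonempty (IsInitial X.dom) :=
  ⟨isInitialOfHom initialIsInitial (domMap (h.to (of (initial.to I)
    (SumClosed.of_isInitial initialIsInitial _))))⟩

instance hasFiniteCoproducts_of_sumClosed : HasFiniteCoproducts (DisplaySlice F I) := by
  have : HasInitial (DisplaySlice F I) :=
    (isInitialOfDom (X := of (initial.to I) (SumClosed.of_isInitial initialIsInitial _))
      initialIsInitial).hasInitial
  have : HasBinaryCoproducts (DisplaySlice F I) := by
    refine @hasBinaryCoproducts_of_hasColimit_pair _ _ fun {X Y} => ?_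
    obtain ⟨Z, a, b, h⟩ := exists_isCoprod X Y
    exact ⟨⟨⟨_, (isCoprod_of_domMap h).some⟩⟩⟩
  exact hasFiniteCoproducts_of_has_binary_and_initial

end DisplaySlice

/-- Sum-closed classes of display maps have finite sum types. -/
theorem HasFiniteSumTypes.of_sumClosed [IsDisplayClass F] : HasFiniteSumTypes F where
  hasFiniteCoproducts _ := inferInstance
  preserves {I J} h := by
    refine preservesFiniteCoproducts_of_isCoprod _ (fun hX => ?_) fun {X Y Z a b} hab => ?_
    · exact ⟨isInitialOfDom (isInitialOfHom (isInitial_dom_of_sumClosed hX).some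
        (pullbackFst h _))⟩
    · exact isCoprod_of_domMap ((isCoprod_domMap_of_sumClosed hab).of_isPullback
        (isPullback_domMap h a).flip (isPullback_domMap h b).flip)

/-- The inclusion of the slices of a sum-closed class preserves finite coproducts. -/
theorem preservesFiniteCoproducts_changeProp {D : MorphismProperty B} (hF : F ≤ D) (I : B) :
    PreservesFiniteCoproducts
      (MorphismProperty.Over.changeProp (P := F) (P' := D) (Q := ⊤) (Q' := ⊤) I hF le_rfl) := by
  refine preservesFiniteCoproducts_of_isCoprod _ (fun hX => ?_) fun {X Y Z a b} hab => ?_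
  · exact ⟨isInitialOfDom (isInitial_dom_of_sumClosed hX).some⟩
  · have h := isCoprod_domMap_of_sumClosed hab
    exact isCoprod_of_domMap h

omit [HasExtensiveSums B] in
theorem SumClosed.of_isCoprod [F.IsStableUnderComposition] {X Y Z X' Y' Z' : B} {a : X ⟶ Z}
    {b : Y ⟶ Z} {a' : X' ⟶ Z'} {b' : Y' ⟶ Z'} (h : IsCoprod a b) (h' : IsCoprod a' b')
    {f : X' ⟶ X} {g : Y' ⟶ Y} {k : Z' ⟶ Z} (hf : F f) (hg : F g) (w : a' ≫ k = f ≫ a)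
    (w' : b' ≫ k = g ≫ b) : F k := by
  refine SumClosed.of_inl_of_inr h' _ ?_ ?_
  · rw [w]; exact F.comp_mem _ _ hf (SumClosed.inl h)
  · rw [w']; exact F.comp_mem _ _ hg (SumClosed.inr h)

variable [IsDisplayClass F] [F.IsStableUnderComposition]

/-- Sum-closed classes of display maps in extensive categories are extensive. -/
theorem IsExtensive.of_sumClosed : IsExtensive F where
  hasFiniteSumTypes := .of_sumClosed
  isEquivalence {I X Y} c hc := by
    have h := isCoprod_domMap_of_sumClosed (IsCoprod.of_isColimit hc.some)
    let Φ := Functor.prod' (slicePullback F (domMap c.inl)) (slicePullback F (domMap c.inr))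
    change Φ.IsEquivalence
    -- Each `E` over `X + Y` is the sum of its two restrictions. Faithfulness and fullness are then
    -- uniqueness and existence of copairings.
    have hsum : ∀ E : DisplaySlice F c.pt.dom,
        IsCoprod (pullbackFst (domMap c.inl) E) (pullbackFst (domMap c.inr) E) := fun E =>
      h.of_isPullback (DisplaySlice.isPullback (domMap c.inl) E)
        (DisplaySlice.isPullback (domMap c.inr) E)
    have hfaithful : Φ.Faithful := ⟨fun {E E'} f g e => by
      apply DisplaySlice.hom_ext
      apply (hsum E).hom_ext
      · rw [← pullback_domMap_fst, ← pullback_domMap_fst]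
        exact congrArg (domMap · ≫ pullbackFst (domMap c.inl) E') (congrArg Prod.fst e)
      · rw [← pullback_domMap_fst, ← pullback_domMap_fst]
        exact congrArg (domMap · ≫ pullbackFst (domMap c.inr) E') (congrArg Prod.snd e)⟩
    have hfull : Φ.Full := ⟨fun {E E'} f => by
      let f₁ : (slicePullback F (domMap c.inl)).obj E ⟶ (slicePullback F (domMap c.inl)).obj E' :=
        f.1
      let f₂ : (slicePullback F (domMap c.inr)).obj E ⟶ (slicePullback F (domMap c.inr)).obj E' :=
        f.2
      have H := hsum E
      let k : E.dom ⟶ E'.dom := H.desc (domMap f₁ ≫ pullbackFst _ E') (domMap f₂ ≫ pullbackFst _ E')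
      have hk : k ≫ E'.arr = E.arr := by
        apply H.hom_ext
        · simp only [k, H.inl_desc_assoc, Category.assoc]
          rw [(DisplaySlice.isPullback _ E').w, (DisplaySlice.isPullback _ E).w, domMap_arr_assoc]
        · simp only [k, H.inr_desc_assoc, Category.assoc]
          rw [(DisplaySlice.isPullback _ E').w, (DisplaySlice.isPullback _ E).w, domMap_arr_assoc]
      have e₁ : (slicePullback F (domMap c.inl)).map (homOf k hk) = f₁ := by
        apply DisplaySlice.hom_ext
        apply (DisplaySlice.isPullback _ E').hom_ext
        · rw [pullback_domMap_fst, domMap_homOf]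
          exact H.inl_desc _ _
        · rw [domMap_arr, domMap_arr]
      have e₂ : (slicePullback F (domMap c.inr)).map (homOf k hk) = f₂ := by
        apply DisplaySlice.hom_ext
        apply (DisplaySlice.isPullback _ E').hom_ext
        · rw [pullback_domMap_fst, domMap_homOf]
          exact H.inr_desc _ _
        · rw [domMap_arr, domMap_arr]
      exact ⟨homOf k hk, Prod.ext e₁ e₂⟩⟩
    -- The preimage of `(P, Q)` is `P + Q` over `X + Y`; extensivity recovers `P` and `Q` as its
    -- restrictions.
    have hsurj : Φ.EssSurj := ⟨fun (P, Q) => by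
      have H := IsCoprod.coprod P.dom Q.dom
      let k := H.desc (P.arr ≫ domMap c.inl) (Q.arr ≫ domMap c.inr)
      have w₁ : coprod.inl ≫ k = P.arr ≫ domMap c.inl := H.inl_desc _ _
      have w₂ : coprod.inr ≫ k = Q.arr ≫ domMap c.inr := H.inr_desc _ _
      have hk : F k := SumClosed.of_isCoprod h H P.display Q.display w₁ w₂
      obtain ⟨p₁, p₂⟩ := h.isPullback H w₁ w₂
      let E : DisplaySlice F c.pt.dom := of k hk
      let i₁ := (DisplaySlice.isPullback (domMap c.inl) E).isoIsPullback _ _ p₁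
      let i₂ := (DisplaySlice.isPullback (domMap c.inr) E).isoIsPullback _ _ p₂
      let j₁ : (slicePullback F (domMap c.inl)).obj E ≅ P :=
        MorphismProperty.Over.isoMk i₁ (IsPullback.isoIsPullback_hom_snd _ _ _ _)
      let j₂ : (slicePullback F (domMap c.inr)).obj E ≅ Q :=
        MorphismProperty.Over.isoMk i₂ (IsPullback.isoIsPullback_hom_snd _ _ _ _)
      exact ⟨E, ⟨Iso.prod j₁ j₂⟩⟩⟩
    exact { }

/-- If every map into a terminal object is in the sum-closed class `F` of display maps, then `F` is
strongly extensive. -/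
theorem IsStronglyExtensive.of_sumClosed : IsStronglyExtensive F where
  isExtensive := .of_sumClosed
  slice I := by
    refine ⟨inferInstance, fun {A A' X Y} c c' a b f hc h₁ h₂ => ?_⟩
    have h := isCoprod_domMap_of_sumClosed (IsCoprod.of_isColimit hc.some)
    constructor
    · rintro ⟨h'⟩
      have h' := isCoprod_domMap_of_sumClosed (IsCoprod.of_isColimit h')
      have H := h.isPullback h' (congrArg domMap h₁) (congrArg domMap h₂)
      exact ⟨isPullback_of_domMap H.1, isPullback_of_domMap H.2⟩
    · rintro ⟨H₁, H₂⟩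
      -- Along a map in `F`, pullbacks in `F/I` agree with those in `B`: the pullback in `B` is
      -- displayed over `I` by composing with `U.arr`.
      have key : ∀ {U V W : DisplaySlice F I} {Q : DisplaySlice F I} {p : Q ⟶ U} {q : Q ⟶ V}
          {k : U ⟶ W} {l : V ⟶ W}, F (domMap l) → IsPullback p q k l →
          IsPullback (domMap p) (domMap q) (domMap k) (domMap l) := by
        intro U V W Q p q k l hl H
        have := MorphismProperty.HasPullbacks.hasPullback (domMap k) hl
        have : HasPullback (domMap k) (domMap l) := hasPullback_symmetry _ _
        have hp : F (pullback.fst (domMap k) (domMap l)) :=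
          MorphismProperty.of_isPullback (IsPullback.of_hasPullback (domMap k) (domMap l)).flip hl
        let R : DisplaySlice F I := of (pullback.fst (domMap k) (domMap l) ≫ U.arr)
          (F.comp_mem _ _ hp U.display)
        let r : R ⟶ U := homOf (pullback.fst (domMap k) (domMap l)) rfl
        let s : R ⟶ V := homOf (pullback.snd (domMap k) (domMap l)) (by
          rw [← domMap_arr l, ← pullback.condition_assoc, domMap_arr k]
          rfl)
        have hR₀ : IsPullback (domMap r) (domMap s) (domMap k) (domMap l) :=
          IsPullback.of_hasPullback _ _
        have hR : IsPullback r s k l := isPullback_of_domMap hR₀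
        have h₁ := H.isoIsPullback_hom_fst _ _ hR
        have h₂ := H.isoIsPullback_hom_snd _ _ hR
        refine hR₀.of_iso' (asIso (domMap (H.isoIsPullback _ _ hR).hom)) (Iso.refl _) (Iso.refl _)
          (Iso.refl _) ?_ ?_ ?_ ?_
        · exact (congrArg domMap h₁).trans (Category.comp_id _).symm
        · exact (congrArg domMap h₂).trans (Category.comp_id _).symm
        · exact (Category.id_comp _).trans (Category.comp_id _).symm
        · exact (Category.id_comp _).trans (Category.comp_id _).symm
      exact IsCoprod.nonempty_isColimit (isCoprod_of_domMap
        (h.of_isPullback (key (SumClosed.inl h) H₁) (key (SumClosed.inr h) H₂)))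

end

/-- A universe closed under finite sum types is sum-closed. -/
theorem IsUniverse.sumClosed {D : MorphismProperty B} [IsDisplayClass D] [HasTerminal B]
    [HasExtensiveSums B] (hroot : IsWellRooted D) (hext : IsStronglyExtensive D) {E U : B}
    {u : E ⟶ U} (hu : IsUniverse D u) [IsDisplayClass (smallMaps u)]
    (hsum : HasFiniteSumTypes (smallMaps u))
    (hpres : ∀ I : B, PreservesFiniteCoproducts (hu.inclusion I)) : SumClosed (smallMaps u) := by
  have h₀ : ∀ {O I : B}, IsInitial O → ∀ f : O ⟶ I, smallMaps u f := by
    intro O I hO f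
    have := hsum.hasFiniteCoproducts I
    have := hpres I
    have h : IsInitial (⊥_ (DisplaySlice (smallMaps u) I)).dom :=
      (hext.isInitial_dom hroot (IsInitial.isInitialObj (hu.inclusion I) _ initialIsInitial)).some
    have : f = (hO.uniqueUpToIso h).hom ≫ (⊥_ (DisplaySlice (smallMaps u) I)).arr :=
      hO.hom_ext _ _
    rw [this, (smallMaps u).cancel_left_of_respectsIso]
    exact DisplaySlice.display _
  refine ⟨h₀, fun {X Y Z I a b} h f h₁ h₂ => ?_, fun {X Y Z a b} h => ?_⟩
  · have := hsum.hasFiniteCoproducts I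
    have := hpres I
    have h'' := hext.isCoprod_domMap hroot
      ((IsCoprod.coprod (of (a ≫ f) h₁) (of (b ≫ f) h₂)).map (hu.inclusion I))
    have h' : IsCoprod (domMap (coprod.inl : of (a ≫ f) h₁ ⟶ of (a ≫ f) h₁ ⨿ of (b ≫ f) h₂))
      (domMap (coprod.inr : of (b ≫ f) h₂ ⟶ of (a ≫ f) h₁ ⨿ of (b ≫ f) h₂)) := h''
    have : f = (h.uniqueUpToIso h').hom ≫ (of (a ≫ f) h₁ ⨿ of (b ≫ f) h₂).arr := by
      apply h.hom_ext
      · exact ((h.inl_desc_assoc _ _ _).trans (domMap_arr _)).symm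
      · exact ((h.inr_desc_assoc _ _ _).trans (domMap_arr _)).symm
    rw [this, (smallMaps u).cancel_left_of_respectsIso]
    exact DisplaySlice.display _
  -- Classify the identity of `X` and the map `0 ⟶ Y` by `b₁` and `b₂`. The pullback of `u` along
  -- their copairing restricts to `X` over `X` and to `0` over `Y`, so it is `X + 0 ⟶ Z`, that is,
  -- `a`.
  · obtain ⟨e₁, b₁, p₁⟩ := (smallMaps u).id_mem X
    obtain ⟨e₂, b₂, p₂⟩ := h₀ initialIsInitial (initial.to Y)
    have : HasPullback u (h.desc b₁ b₂) := MorphismProperty.HasPullbacks.hasPullback _ hu.display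
    have H := IsPullback.of_hasPullback u (h.desc b₁ b₂)
    let l₁ := H.lift e₁ a (by rw [h.inl_desc, p₁.w, Category.id_comp])
    let l₂ := H.lift e₂ (initial.to Y ≫ b) (by rw [Category.assoc, h.inr_desc, p₂.w])
    have q₁ : IsPullback l₁ (𝟙 X) (pullback.snd u (h.desc b₁ b₂)) a :=
      IsPullback.of_right (by rw [H.lift_fst, h.inl_desc]; exact p₁)
        (by rw [H.lift_snd, Category.id_comp]) H
    have q₂ : IsPullback l₂ (initial.to Y) (pullback.snd u (h.desc b₁ b₂)) b :=
      IsPullback.of_right (by rw [H.lift_fst, h.inr_desc]; exact p₂) (by rw [H.lift_snd]) H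
    have := (h.of_isPullback q₁ q₂).isIso_inl_of_isInitial initialIsInitial
    have e : a = l₁ ≫ pullback.snd u (h.desc b₁ b₂) := (H.lift_snd _ _ _).symm
    rw [e, (smallMaps u).cancel_left_of_respectsIso]
    exact ⟨_, _, H⟩

end FiniteSums

/-! ## Elementary forms of `Π`-types and identity types -/

section Pi

variable {B : Type u} [Category.{v} B]

/-- `π` is the dependent product `Π_f (i^* g)`, with evaluation `ε` on the pullback `E` of `π`
along `f`: maps `W ⟶ R` over `A` correspond to maps `W ×_A Y ⟶ C` over `I`. -/
structure IsPi {Y A I C R E : B} (f : Y ⟶ A) (i : Y ⟶ I) (g : C ⟶ I) (π : R ⟶ A) (e₁ : E ⟶ R)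
    (e₂ : E ⟶ Y) (ε : E ⟶ C) : Prop where
  isPullback : IsPullback e₁ e₂ π f
  w : ε ≫ g = e₂ ≫ i
  exists_lift : ∀ {W P : B} (w : W ⟶ A) (p₁ : P ⟶ W) (p₂ : P ⟶ Y), IsPullback p₁ p₂ w f →
    ∀ s : P ⟶ C, s ≫ g = p₂ ≫ i →
    ∃ (r : W ⟶ R) (t : P ⟶ E), r ≫ π = w ∧ t ≫ e₁ = p₁ ≫ r ∧ t ≫ e₂ = p₂ ∧ t ≫ ε = s
  hom_ext : ∀ {W P : B} (w : W ⟶ A) (p₁ : P ⟶ W) (p₂ : P ⟶ Y), IsPullback p₁ p₂ w f →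
    ∀ (r r' : W ⟶ R) (t t' : P ⟶ E), r ≫ π = w → r' ≫ π = w → t ≫ e₁ = p₁ ≫ r →
    t' ≫ e₁ = p₁ ≫ r' → t ≫ e₂ = p₂ → t' ≫ e₂ = p₂ → t ≫ ε = t' ≫ ε → r = r'

/-- Test data over `A'` are test data over `A` with a chosen lift along `a`, and sections with
values in `C'` are sections with values in `C` because `C'` is a pullback. Hence the pullback of the
representing object represents again. -/
theorem IsPi.baseChange {Y A I C R E : B} {f : Y ⟶ A} {i : Y ⟶ I} {g : C ⟶ I} {π : R ⟶ A}
    {e₁ : E ⟶ R} {e₂ : E ⟶ Y} {ε : E ⟶ C} (h : IsPi f i g π e₁ e₂ ε) {Y' A' I' C' R' E' : B}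
    {f' : Y' ⟶ A'} {i' : Y' ⟶ I'} {g' : C' ⟶ I'} {π' : R' ⟶ A'} {e₁' : E' ⟶ R'} {e₂' : E' ⟶ Y'}
    {a : A' ⟶ A} {y : Y' ⟶ Y} {c : I' ⟶ I} {z : C' ⟶ C} {ρ : R' ⟶ R}
    (hf : IsPullback y f' f a) (hg : IsPullback z g' g c) (hi : i' ≫ c = y ≫ i)
    (hπ : IsPullback ρ π' π a) (hE : IsPullback e₁' e₂' π' f') :
    ∃ ε' : E' ⟶ C', IsPi f' i' g' π' e₁' e₂' ε' := by
  let η : E' ⟶ E := h.isPullback.lift (e₁' ≫ ρ) (e₂' ≫ y) (by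
    rw [Category.assoc, Category.assoc, hπ.w, hf.w, reassoc_of% hE.w])
  have η₁ : η ≫ e₁ = e₁' ≫ ρ := h.isPullback.lift_fst _ _ _
  have η₂ : η ≫ e₂ = e₂' ≫ y := h.isPullback.lift_snd _ _ _
  let ε' : E' ⟶ C' := hg.lift (η ≫ ε) (e₂' ≫ i') (by
    rw [Category.assoc, Category.assoc, h.w, hi, reassoc_of% η₂])
  have hε₁ : ε' ≫ z = η ≫ ε := hg.lift_fst _ _ _
  have hε₂ : ε' ≫ g' = e₂' ≫ i' := hg.lift_snd _ _ _
  refine ⟨ε', hE, hε₂, ?_, ?_⟩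
  · intro W P w p₁ p₂ hP s hs
    have hP' : IsPullback p₁ (p₂ ≫ y) (w ≫ a) f := (hP.flip.paste_horiz hf).flip
    obtain ⟨r, t, h₁, h₂, h₃, h₄⟩ := h.exists_lift _ _ _ hP' (s ≫ z) (by
      rw [Category.assoc, hg.w, reassoc_of% hs, hi, Category.assoc])
    have hr : hπ.lift r w h₁ ≫ π' = w := hπ.lift_snd _ _ _
    have hr' : hπ.lift r w h₁ ≫ ρ = r := hπ.lift_fst _ _ _
    have ht := hE.lift_fst (p₁ ≫ hπ.lift r w h₁) p₂ (by rw [Category.assoc, hr, hP.w])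
    have ht' := hE.lift_snd (p₁ ≫ hπ.lift r w h₁) p₂ (by rw [Category.assoc, hr, hP.w])
    refine ⟨hπ.lift r w h₁, hE.lift (p₁ ≫ hπ.lift r w h₁) p₂ (by rw [Category.assoc, hr, hP.w]),
      hr, ht, ht', ?_⟩
    apply hg.hom_ext
    · rw [Category.assoc, hε₁, ← h₄, ← Category.assoc]
      congr 1
      apply h.isPullback.hom_ext
      · rw [Category.assoc, η₁, reassoc_of% ht, hr', h₂]
      · rw [Category.assoc, η₂, reassoc_of% ht', h₃]
    · rw [Category.assoc, hε₂, reassoc_of% ht', hs]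
  · intro W P w p₁ p₂ hP r r' t t' h₁ h₁' h₂ h₂' h₃ h₃' h₄
    have hP' : IsPullback p₁ (p₂ ≫ y) (w ≫ a) f := (hP.flip.paste_horiz hf).flip
    apply hπ.hom_ext
    · refine h.hom_ext _ _ _ hP' _ _ (t ≫ η) (t' ≫ η) ?_ ?_ ?_ ?_ ?_ ?_ ?_
      · rw [Category.assoc, hπ.w, reassoc_of% h₁]
      · rw [Category.assoc, hπ.w, reassoc_of% h₁']
      · rw [Category.assoc, η₁, reassoc_of% h₂]
      · rw [Category.assoc, η₁, reassoc_of% h₂']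
      · rw [Category.assoc, η₂, reassoc_of% h₃]
      · rw [Category.assoc, η₂, reassoc_of% h₃']
      · rw [Category.assoc, Category.assoc, ← hε₁, reassoc_of% h₄]
    · rw [h₁, h₁']

/-- The couniversal arrow is applied to the base change of `g` along `i`; chosen pullbacks are then
exchanged for arbitrary ones by the comparison isomorphisms. -/
theorem HasPiTypes.exists_isPi {F : MorphismProperty B} [IsDisplayClass F] (h : HasPiTypes F)
    {Y A I C : B} {f : Y ⟶ A} (i : Y ⟶ I) {g : C ⟶ I} (hf : F f) (hg : F g) :
    ∃ (R E : B) (π : R ⟶ A) (e₁ : E ⟶ R) (e₂ : E ⟶ Y) (ε : E ⟶ C), F π ∧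
      IsPi f i g π e₁ e₂ ε := by
  have : HasPullback g i := MorphismProperty.HasPullbacks.hasPullback _ hg
  have : HasPullbacksAlong f := IsDisplayClass.hasPullbacksAlong hf
  have H := IsPullback.of_hasPullback g i
  obtain ⟨t, ht, ⟨hterm⟩⟩ := h f (pullback.snd g i) hf (F.pullback_snd _ _ hg)
  let ε₀ : pullback t.left.hom f ⟶ pullback g i := t.hom.left
  have hε₀ : ε₀ ≫ pullback.snd g i = pullback.snd t.left.hom f := Over.w t.hom
  have H₀ := IsPullback.of_hasPullback t.left.hom f
  refine ⟨t.left.left, pullback t.left.hom f, t.left.hom, pullback.fst _ _, pullback.snd _ _,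
    ε₀ ≫ pullback.fst g i, ht, H₀, ?_, ?_, ?_⟩
  · rw [Category.assoc, H.w, reassoc_of% hε₀]
  · intro W P w p₁ p₂ hP s hs
    have HW := IsPullback.of_hasPullback w f
    let k := hP.isoIsPullback _ _ HW
    have hk₁ : k.hom ≫ pullback.fst w f = p₁ := hP.isoIsPullback_hom_fst _ _ _
    have hk₂ : k.hom ≫ pullback.snd w f = p₂ := hP.isoIsPullback_hom_snd _ _ _
    have hk₂' : k.inv ≫ p₂ = pullback.snd w f := hP.isoIsPullback_inv_snd _ _ _
    let X : CostructuredArrow (Over.pullback f) (Over.mk (pullback.snd g i)) :=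
      CostructuredArrow.mk (Y := Over.mk w) (Over.homMk (k.inv ≫ H.lift s p₂ hs) (by
        simp only [Over.mk_hom, Category.assoc, H.lift_snd, hk₂']; rfl))
    let m := hterm.from X
    let r : W ⟶ t.left.left := m.left.left
    have hr : r ≫ t.left.hom = w := Over.w m.left
    have hm := congrArg CommaMorphism.left (CostructuredArrow.w m)
    let n : pullback w f ⟶ pullback t.left.hom f := pullback.lift (pullback.fst w f ≫ r)
      (pullback.snd w f) (by rw [Category.assoc, hr, pullback.condition])
    have hn : n ≫ ε₀ = k.inv ≫ H.lift s p₂ hs := hm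
    refine ⟨r, k.hom ≫ n, hr, ?_, ?_, ?_⟩
    · simp only [n, Category.assoc, pullback.lift_fst, reassoc_of% hk₁]
    · simp only [n, Category.assoc, pullback.lift_snd, hk₂]
    · rw [Category.assoc, reassoc_of% hn, Iso.hom_inv_id_assoc, H.lift_fst]
  · intro W P w p₁ p₂ hP r r' t₁ t₂ h₁ h₁' h₂ h₂' h₃ h₃' h₄
    have HW := IsPullback.of_hasPullback w f
    let k := hP.isoIsPullback _ _ HW
    have hk₁ : k.hom ≫ pullback.fst w f = p₁ := hP.isoIsPullback_hom_fst _ _ _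
    have hk₂ : k.hom ≫ pullback.snd w f = p₂ := hP.isoIsPullback_hom_snd _ _ _
    let n : ∀ x : W ⟶ t.left.left, x ≫ t.left.hom = w → (pullback w f ⟶ pullback t.left.hom f) :=
      fun x hx => pullback.lift (pullback.fst w f ≫ x)
        (pullback.snd w f) (by rw [Category.assoc, hx, pullback.condition])
    have hn : k.hom ≫ n r h₁ = t₁ := by
      apply pullback.hom_ext
      · simp only [n, Category.assoc, pullback.lift_fst, reassoc_of% hk₁, h₂]
      · simp only [n, Category.assoc, pullback.lift_snd, hk₂, h₃]
    have hn' : k.hom ≫ n r' h₁' = t₂ := by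
      apply pullback.hom_ext
      · simp only [n, Category.assoc, pullback.lift_fst, reassoc_of% hk₁, h₂']
      · simp only [n, Category.assoc, pullback.lift_snd, hk₂, h₃']
    have e : n r h₁ ≫ ε₀ = n r' h₁' ≫ ε₀ := by
      rw [← cancel_epi k.hom, ← Category.assoc, ← Category.assoc, hn, hn']
      apply H.hom_ext
      · simpa using h₄
      · rw [Category.assoc, Category.assoc, hε₀, h₃, h₃']
    let X : CostructuredArrow (Over.pullback f) (Over.mk (pullback.snd g i)) :=
      CostructuredArrow.mk (Y := Over.mk w) ((Over.pullback f).map (Over.homMk r h₁) ≫ t.hom)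
    let m : X ⟶ t := CostructuredArrow.homMk (Over.homMk r h₁) rfl
    let m' : X ⟶ t := CostructuredArrow.homMk (Over.homMk r' h₁') (Over.OverMorphism.ext e.symm)
    exact congrArg (fun q : X ⟶ t => q.left.left) (hterm.hom_ext m m')

theorem HasPiTypes.of_exists_isPi {F : MorphismProperty B} [IsDisplayClass F]
    (h : ∀ {Y A C : B} (f : Y ⟶ A) (g : C ⟶ Y), F f → F g →
      ∃ (R E : B) (π : R ⟶ A) (e₁ : E ⟶ R) (e₂ : E ⟶ Y) (ε : E ⟶ C), F π ∧
        IsPi f (𝟙 Y) g π e₁ e₂ ε) : HasPiTypes F := by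
  intro A Y C f g hf hg
  have : HasPullbacksAlong f := IsDisplayClass.hasPullbacksAlong hf
  obtain ⟨R, E, π, e₁, e₂, ε, hπ, H⟩ := h f g hf hg
  have hw : ε ≫ g = e₂ := H.w.trans (Category.comp_id _)
  have H₀ := IsPullback.of_hasPullback π f
  let k := H₀.isoIsPullback _ _ H.isPullback
  have hk₁ : k.hom ≫ e₁ = pullback.fst π f := H₀.isoIsPullback_hom_fst _ _ _
  have hk₂ : k.hom ≫ e₂ = pullback.snd π f := H₀.isoIsPullback_hom_snd _ _ _
  let t : CostructuredArrow (Over.pullback f) (Over.mk g) :=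
    CostructuredArrow.mk (Y := Over.mk π) (Over.homMk (k.hom ≫ ε) (by
      simp only [Over.mk_hom, Category.assoc, hw, hk₂]; rfl))
  have aux : ∀ X : CostructuredArrow (Over.pullback f) (Over.mk g),
      ∀ (r : X.left.left ⟶ R) (hr : r ≫ π = X.left.hom),
      (pullback.lift (pullback.fst X.left.hom f ≫ r) (pullback.snd X.left.hom f)
        (by rw [Category.assoc, hr, pullback.condition]) : _ ⟶ pullback π f) =
      ((Over.pullback f).map (Over.homMk r hr : X.left ⟶ Over.mk π)).left := fun _ _ _ => rfl
  refine ⟨t, hπ, ⟨IsTerminal.ofUniqueHom (fun X => ?_) fun X m => ?_⟩⟩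
  · have HX := IsPullback.of_hasPullback X.left.hom f
    have ex := H.exists_lift _ _ _ HX X.hom.left ((Over.w X.hom).trans (Category.comp_id _).symm)
    let r := ex.choose
    have hr : r ≫ π = X.left.hom := ex.choose_spec.choose_spec.1
    refine CostructuredArrow.homMk (Over.homMk r hr) (Over.OverMorphism.ext ?_)
    obtain ⟨h₁, h₂, h₃⟩ := ex.choose_spec.choose_spec.2
    refine Eq.trans ?_ h₃
    rw [Over.comp_left, ← aux]
    change _ ≫ k.hom ≫ ε = _
    rw [← Category.assoc]
    congr 1
    apply H.isPullback.hom_ext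
    · rw [Category.assoc, hk₁, pullback.lift_fst, h₁]
    · rw [Category.assoc, hk₂, pullback.lift_snd, h₂]
  · have HX := IsPullback.of_hasPullback X.left.hom f
    have ex := H.exists_lift _ _ _ HX X.hom.left ((Over.w X.hom).trans (Category.comp_id _).symm)
    obtain ⟨h₀, h₁, h₂, h₃⟩ := ex.choose_spec.choose_spec
    let r : X.left.left ⟶ R := m.left.left
    have hr : r ≫ π = X.left.hom := Over.w m.left
    have hm : (pullback.lift (pullback.fst X.left.hom f ≫ r) (pullback.snd X.left.hom f)
        (by rw [Category.assoc, hr, pullback.condition]) : _ ⟶ pullback π f) ≫ k.hom ≫ ε =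
        X.hom.left := congrArg CommaMorphism.left (CostructuredArrow.w m)
    refine CostructuredArrow.hom_ext _ _ (Over.OverMorphism.ext ?_)
    refine H.hom_ext _ _ _ HX r ex.choose (pullback.lift (pullback.fst X.left.hom f ≫ r)
      (pullback.snd X.left.hom f) (by rw [Category.assoc, hr, pullback.condition]) ≫ k.hom)
      ex.choose_spec.choose hr h₀ ?_ h₁ ?_ h₂ ?_
    · rw [Category.assoc, hk₁, pullback.lift_fst]
    · rw [Category.assoc, hk₂, pullback.lift_snd]
    · rw [Category.assoc, hm, h₃]

end Pi

section Identity

variable {B : Type u} [Category.{v} B]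

open DisplaySlice

/-- Maps between members of `F` over the same object factor as a map in the left class of `D`
followed by a map in `F`. -/
def HasLeftFactorizations (D F : MorphismProperty B) : Prop :=
  ∀ {X Y J : B} (f : X ⟶ Y) (g : Y ⟶ J), F g → F (f ≫ g) →
    ∃ (Z : B) (l : X ⟶ Z) (d : Z ⟶ Y), D.llp l ∧ F d ∧ l ≫ d = f

/-- The left class of `D` is stable under base change of maps between display maps. -/
def IsLeftClassStable (D : MorphismProperty B) : Prop :=
  ∀ {I J X Y X' Y' : B} {h : I ⟶ J} {m : X ⟶ Y} {y : Y ⟶ J}, D y → D (m ≫ y) → D.llp m →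
    ∀ {pX : X' ⟶ X} {x' : X' ⟶ I} {pY : Y' ⟶ Y} {y' : Y' ⟶ I} {m' : X' ⟶ Y'},
    IsPullback pX x' (m ≫ y) h → IsPullback pY y' y h → m' ≫ pY = pX ≫ m → m' ≫ y' = x' →
    D.llp m'

variable {D F : MorphismProperty B} [IsDisplayClass D]

/-- A lifting problem against `g` reduces to one against the base change of `g` to the codomain of
`m`, and by `Σ`-types this lies in `D/J`. Thus the left class does not depend on the slice. -/
theorem llp_sliceDisplay_iff [D.IsStableUnderComposition] {J : B} {X Y : DisplaySlice D J}
    (m : X ⟶ Y) : (sliceDisplay D J).llp m ↔ D.llp (domMap m) := by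
  constructor
  · intro h P Q g hg
    refine ⟨fun {a b} sq => ?_⟩
    have : HasPullback g b := MorphismProperty.HasPullbacks.hasPullback _ hg
    let R : DisplaySlice D J := of (pullback.snd g b ≫ Y.arr)
      (D.comp_mem _ _ (D.pullback_snd _ _ hg) Y.display)
    let r : R ⟶ Y := homOf (pullback.snd g b) rfl
    let k : X ⟶ R := homOf (pullback.lift a (domMap m) sq.w)
      ((pullback.lift_snd_assoc _ _ _ _).trans (domMap_arr m))
    have := h r (D.pullback_snd _ _ hg)
    have sq' : CommSq k m r (𝟙 Y) := ⟨DisplaySlice.hom_ext (by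
      refine (pullback.lift_snd _ _ sq.w).trans ?_
      simp)⟩
    have h₁ : domMap m ≫ domMap sq'.lift = pullback.lift a (domMap m) sq.w :=
      congrArg domMap sq'.fac_left
    have h₂ : domMap sq'.lift ≫ pullback.snd g b = 𝟙 Y.dom := congrArg domMap sq'.fac_right
    let l : Y.dom ⟶ pullback g b := domMap sq'.lift
    change l ≫ _ = _ at h₂
    change _ ≫ l = _ at h₁
    refine ⟨⟨⟨l ≫ pullback.fst g b, ?_, ?_⟩⟩⟩
    · rw [reassoc_of% h₁, pullback.lift_fst]
    · rw [Category.assoc, pullback.condition, reassoc_of% h₂]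
  · intro h P Q g hg
    refine ⟨fun {a b} sq => ?_⟩
    have := h (domMap g) hg
    have sq' : CommSq (domMap a) (domMap m) (domMap g) (domMap b) := ⟨congrArg domMap sq.w⟩
    refine ⟨⟨⟨homOf sq'.lift ?_, ?_, ?_⟩⟩⟩
    · rw [← domMap_arr g, reassoc_of% sq'.fac_right, domMap_arr]
    · exact DisplaySlice.hom_ext sq'.fac_left
    · exact DisplaySlice.hom_ext sq'.fac_right

theorem HasIdentityTypes.hasLeftFactorizations [D.IsStableUnderComposition]
    (h : HasIdentityTypes D) : HasLeftFactorizations D D := by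
  intro X Y J f g hg hfg
  have := h.factorizations J
  let m : of (f ≫ g) hfg ⟶ of g hg := homOf f rfl
  obtain ⟨d⟩ := MorphismProperty.HasFactorization.nonempty_mapFactorizationData
    (W₁ := (sliceDisplay D J).llp) (W₂ := sliceDisplay D J) m
  exact ⟨d.Z.dom, domMap d.i, domMap d.p, (llp_sliceDisplay_iff _).1 d.hi, d.hp,
    congrArg domMap d.fac⟩

/-- Stability under the chosen pullback functors becomes stability for arbitrary pullback squares by
uniqueness of pullbacks. -/
theorem HasIdentityTypes.isLeftClassStable [D.IsStableUnderComposition]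
    (h : HasIdentityTypes D) : IsLeftClassStable D := by
  intro I J X Y X' Y' h' m y hy hmy hm pX x' pY y' m' hX hY w w'
  let m₀ : of (m ≫ y) hmy ⟶ of y hy := homOf m rfl
  have H := (llp_sliceDisplay_iff _).1 (h.stableLeftClasses h' m₀
    ((llp_sliceDisplay_iff (D := D) m₀).2 hm))
  let i := (DisplaySlice.isPullback h' (of (m ≫ y) hmy)).isoIsPullback _ _ hX
  let j := (DisplaySlice.isPullback h' (of y hy)).isoIsPullback _ _ hY
  have i₁ : i.hom ≫ pX = pullbackFst h' (of (m ≫ y) hmy) := IsPullback.isoIsPullback_hom_fst ..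
  have i₂ : i.hom ≫ x' = ((slicePullback D h').obj (of (m ≫ y) hmy)).arr :=
    IsPullback.isoIsPullback_hom_snd ..
  have j₁ : j.hom ≫ pY = pullbackFst h' (of y hy) := IsPullback.isoIsPullback_hom_fst ..
  have j₂ : j.hom ≫ y' = ((slicePullback D h').obj (of y hy)).arr :=
    IsPullback.isoIsPullback_hom_snd ..
  refine (MorphismProperty.arrow_mk_iso_iff _ (Arrow.isoMk i j ?_)).1 H
  change i.hom ≫ m' = domMap ((slicePullback D h').map m₀) ≫ j.hom
  apply hY.hom_ext
  · rw [Category.assoc, Category.assoc, w, reassoc_of% i₁, j₁]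
    exact (pullback_domMap_fst h' m₀).symm
  · rw [Category.assoc, Category.assoc, w', i₂, j₂]
    exact (domMap_arr ((slicePullback D h').map m₀)).symm

theorem HasIdentityTypes.of_elementary [D.IsStableUnderComposition]
    (h₁ : HasLeftFactorizations D D) (h₂ : IsLeftClassStable D) : HasIdentityTypes D where
  stableLeftClasses {I J} h {X Y} m hm := by
    rw [llp_sliceDisplay_iff] at hm ⊢
    have hX : IsPullback (pullbackFst h X) ((slicePullback D h).obj X).arr (domMap m ≫ Y.arr) h := by
      rw [domMap_arr]
      exact DisplaySlice.isPullback h X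
    exact h₂ Y.display (by rw [domMap_arr]; exact X.display) hm hX (DisplaySlice.isPullback h Y)
      (pullback_domMap_fst h m) (domMap_arr _)
  factorizations I := ⟨fun {X Y} f => by
    obtain ⟨Z, l, d, hl, hd, w⟩ := h₁ (domMap f) Y.arr Y.display
      (by rw [domMap_arr]; exact X.display)
    exact ⟨{ Z := of (d ≫ Y.arr) (D.comp_mem _ _ hd Y.display)
             i := homOf l (by
               change l ≫ d ≫ Y.arr = X.arr
               rw [reassoc_of% w, domMap_arr])
             p := homOf d rfl
             fac := DisplaySlice.hom_ext w
             hi := (llp_sliceDisplay_iff _).2 hl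
             hp := hd }⟩⟩

theorem IsUniverse.hasIdentityTypes_iff [D.IsStableUnderComposition] {E U : B} {u : E ⟶ U}
    (hu : IsUniverse D u) [(smallMaps u).IsStableUnderComposition] :
    hu.HasIdentityTypes ↔ HasLeftFactorizations D (smallMaps u) := by
  constructor
  · intro h X Y J f g hg hfg
    have := h J
    let m : of (D := smallMaps u) (f ≫ g) hfg ⟶ of g hg := homOf f rfl
    obtain ⟨d⟩ := MorphismProperty.HasFactorization.nonempty_mapFactorizationData
      (W₁ := (sliceDisplay D J).llp.inverseImage (hu.inclusion J))
      (W₂ := sliceDisplay (smallMaps u) J) m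
    exact ⟨d.Z.dom, domMap d.i, domMap d.p, (llp_sliceDisplay_iff _).1 d.hi, d.hp,
      congrArg domMap d.fac⟩
  · intro h I
    refine ⟨fun {X Y} f => ?_⟩
    obtain ⟨Z, l, d, hl, hd, w⟩ := h (domMap f) Y.arr Y.display
      (by rw [domMap_arr]; exact X.display)
    exact ⟨{ Z := of (d ≫ Y.arr) ((smallMaps u).comp_mem _ _ hd Y.display)
             i := homOf l (by
               change l ≫ d ≫ Y.arr = X.arr
               rw [reassoc_of% w, domMap_arr])
             p := homOf d rfl
             fac := DisplaySlice.hom_ext w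
             hi := (llp_sliceDisplay_iff _).2 hl
             hp := hd }⟩

end Identity

/-! ## Maps of polynomial models as actions on generalized elements -/

namespace PolyModel

section Basic

variable {B : Type u} [Category.{v} B] {D : MorphismProperty B} [IsDisplayClass D]
  {X Y Z : PolyModel D}

/-- The map of bases underlying a map of `Poly`. -/
abbrev baseMap (f : X ⟶ Y) : X.base ⟶ Y.base := Hom.base f

@[simp]
theorem baseMap_id (X : PolyModel D) : baseMap (𝟙 X) = 𝟙 X.base := rfl

@[simp]
theorem baseMap_comp (f : X ⟶ Y) (g : Y ⟶ Z) : baseMap (f ≫ g) = baseMap f ≫ baseMap g := rfl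

/-- The family of maps underlying a map of `Poly`. -/
def fam (f : X ⟶ Y) : pullback Y.map (baseMap f) ⟶ X.total := Hom.fam f

@[simp]
theorem fam_map (f : X ⟶ Y) : fam f ≫ X.map = pullback.snd Y.map (baseMap f) := Hom.fam_map f

@[simp]
theorem fam_map_assoc (f : X ⟶ Y) {I : B} (k : X.base ⟶ I) :
    fam f ≫ X.map ≫ k = pullback.snd Y.map (baseMap f) ≫ k := by
  rw [← Category.assoc, fam_map]

theorem fam_comp (f : X ⟶ Y) (g : Y ⟶ Z) : fam (f ≫ g) =
    pullback.lift (f := Y.map) (g := baseMap f)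
      (pullback.lift (f := Z.map) (g := baseMap g) (pullback.fst Z.map (baseMap f ≫ baseMap g))
        (pullback.snd Z.map (baseMap f ≫ baseMap g) ≫ baseMap f)
        (by rw [pullback.condition, Category.assoc]) ≫ fam g)
      (pullback.snd Z.map (baseMap f ≫ baseMap g))
      (by rw [Category.assoc, fam_map, pullback.lift_snd]) ≫ fam f := rfl

/-- The action of a map `f : X ⟶ Y` of `Poly` on elements of `Y.total` over an element of
`X.base`. -/
noncomputable def app (f : X ⟶ Y) {T : B} (t : T ⟶ X.base) (y : T ⟶ Y.total)
    (w : y ≫ Y.map = t ≫ baseMap f) : T ⟶ X.total :=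
  pullback.lift y t w ≫ fam f

@[simp]
theorem app_map (f : X ⟶ Y) {T : B} (t : T ⟶ X.base) (y : T ⟶ Y.total)
    (w : y ≫ Y.map = t ≫ baseMap f) : app f t y w ≫ X.map = t := by
  rw [app, Category.assoc, fam_map, pullback.lift_snd]

@[simp]
theorem app_map_assoc (f : X ⟶ Y) {T : B} (t : T ⟶ X.base) (y : T ⟶ Y.total)
    (w : y ≫ Y.map = t ≫ baseMap f) {I : B} (k : X.base ⟶ I) :
    app f t y w ≫ X.map ≫ k = t ≫ k := by
  rw [← Category.assoc, app_map]

theorem comp_app (f : X ⟶ Y) {S T : B} (s : S ⟶ T) (t : T ⟶ X.base) (y : T ⟶ Y.total)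
    (w : y ≫ Y.map = t ≫ baseMap f) :
    s ≫ app f t y w = app f (s ≫ t) (s ≫ y) (by rw [Category.assoc, w, Category.assoc]) := by
  unfold app
  rw [← Category.assoc]
  congr 1
  apply pullback.hom_ext
  · simp only [Category.assoc, pullback.lift_fst]
  · simp only [Category.assoc, pullback.lift_snd]

theorem app_congr {f g : X ⟶ Y} (e : f = g) {T : B} {t t' : T ⟶ X.base} {y y' : T ⟶ Y.total}
    (ht : t = t') (hy : y = y') (w : y ≫ Y.map = t ≫ baseMap f) :
    app f t y w = app g t' y' (by rw [← hy, w, ht, e]) := by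
  subst e ht hy
  rfl

theorem app_comp (f : X ⟶ Y) (g : Y ⟶ Z) {T : B} (t : T ⟶ X.base) (z : T ⟶ Z.total)
    (w : z ≫ Z.map = t ≫ baseMap (f ≫ g)) :
    app (f ≫ g) t z w = app f t (app g (t ≫ baseMap f) z (by simpa using w)) (by simp) := by
  replace w : z ≫ Z.map = t ≫ baseMap f ≫ baseMap g := w
  change pullback.lift z t w ≫ fam (f ≫ g) = _
  rw [fam_comp, app, ← Category.assoc]
  congr 1
  apply pullback.hom_ext
  · rw [Category.assoc, pullback.lift_fst, pullback.lift_fst, app, ← Category.assoc]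
    congr 1
    apply pullback.hom_ext
    · simp only [Category.assoc, pullback.lift_fst]
    · simp only [Category.assoc, pullback.lift_snd, pullback.lift_snd_assoc]
  · simp only [Category.assoc, pullback.lift_snd]

/-- A Yoneda argument: a family is its own action on the generic element, given by the two
projections of `pullback Y.map (baseMap f)`. -/
theorem hom_ext {f g : X ⟶ Y} (h : baseMap f = baseMap g)
    (h' : ∀ {T : B} (t : T ⟶ X.base) (y : T ⟶ Y.total) (w : y ≫ Y.map = t ≫ baseMap f),
      app f t y w = app g t y (h ▸ w)) : f = g := by
  refine Hom.mk_congr (hφ := Hom.fam_map f) (hψ := Hom.fam_map g) h ?_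
  have e := h' (pullback.snd Y.map (baseMap f)) (pullback.fst Y.map (baseMap f))
    pullback.condition
  have e' : pullback.lift (pullback.fst Y.map (baseMap f)) (pullback.snd Y.map (baseMap f))
    pullback.condition = 𝟙 _ := by apply pullback.hom_ext <;> simp
  rw [app, e', Category.id_comp] at e
  exact e

/-- A map of `Poly` from a natural action on elements. -/
noncomputable abbrev homMk (h : X.base ⟶ Y.base)
    (φ : ∀ {T : B} (t : T ⟶ X.base) (y : T ⟶ Y.total), y ≫ Y.map = t ≫ h → (T ⟶ X.total))
    (hφ : ∀ {T : B} (t : T ⟶ X.base) (y : T ⟶ Y.total) (w : y ≫ Y.map = t ≫ h),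
      φ t y w ≫ X.map = t) : X ⟶ Y :=
  Hom.mk h (φ (pullback.snd Y.map h) (pullback.fst Y.map h) pullback.condition) (hφ _ _ _)

theorem app_homMk (h : X.base ⟶ Y.base)
    (φ : ∀ {T : B} (t : T ⟶ X.base) (y : T ⟶ Y.total), y ≫ Y.map = t ≫ h → (T ⟶ X.total))
    (hφ : ∀ {T : B} (t : T ⟶ X.base) (y : T ⟶ Y.total) (w : y ≫ Y.map = t ≫ h),
      φ t y w ≫ X.map = t)
    (hnat : ∀ {S T : B} (s : S ⟶ T) (t : T ⟶ X.base) (y : T ⟶ Y.total) (w : y ≫ Y.map = t ≫ h),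
      s ≫ φ t y w = φ (s ≫ t) (s ≫ y) (by rw [Category.assoc, w, Category.assoc]))
    {T : B} (t : T ⟶ X.base) (y : T ⟶ Y.total) (w : y ≫ Y.map = t ≫ h) :
    app (homMk h φ hφ) t y w = φ t y w := by
  refine (hnat _ _ _ _).trans ?_
  congr 1
  · exact pullback.lift_snd _ _ _
  · exact pullback.lift_fst _ _ _

end Basic

end PolyModel

/-! ## Pullbacks in the polynomial model -/

theorem _root_.CategoryTheory.IsPullback.congr {C : Type u} [Category.{v} C] {P X Y Z : C}
    {f f' : P ⟶ X} {g g' : P ⟶ Y} {h h' : X ⟶ Z} {k k' : Y ⟶ Z} (H : IsPullback f g h k)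
    (hf : f = f') (hg : g = g') (hh : h = h') (hk : k = k') : IsPullback f' g' h' k' := by
  subst hf hg hh hk
  exact H

/-- This is case distinction on generalized elements: any `t` into a coproduct splits its domain
into the part landing in `X` and the part landing in `Y`. The pullbacks exist because coproduct
inclusions are display maps. -/
theorem IsCoprod.exists_split {B : Type u} [Category.{v} B] (D : MorphismProperty B)
    [IsDisplayClass D] [HasExtensiveSums B] [SumClosed D] {X Y Z : B} {a : X ⟶ Z} {b : Y ⟶ Z}
    (h : IsCoprod a b) {T : B} (t : T ⟶ Z) :
    ∃ (T₁ T₂ : B) (i₁ : T₁ ⟶ T) (i₂ : T₂ ⟶ T) (t₁ : T₁ ⟶ X) (t₂ : T₂ ⟶ Y),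
      IsPullback i₁ t₁ t a ∧ IsPullback i₂ t₂ t b ∧ IsCoprod i₁ i₂ := by
  have := MorphismProperty.HasPullbacks.hasPullback t (SumClosed.inl (F := D) h)
  have := MorphismProperty.HasPullbacks.hasPullback t (SumClosed.inr (F := D) h)
  have := hasPullback_symmetry a t
  have := hasPullback_symmetry b t
  exact ⟨_, _, _, _, _, _, IsPullback.of_hasPullback t a, IsPullback.of_hasPullback t b,
    h.of_isPullback (IsPullback.of_hasPullback t a) (IsPullback.of_hasPullback t b)⟩

namespace PolyModel

variable {B : Type u} [Category.{v} B] {D : MorphismProperty B} [IsDisplayClass D]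

/-! ### The objects `(I, 1)` and `(I, 0)`: left and right adjoint to the projection to bases. -/

section Representable

/-- The object `(I, 1)` of `Poly`. -/
abbrev one (D : MorphismProperty B) [IsDisplayClass D] (I : B) : PolyModel D where
  base := I
  total := I
  map := 𝟙 I
  display := D.id_mem I

/-- The map out of `(I, 1)` given by a map of bases. -/
noncomputable abbrev fromOne {I : B} {Y : PolyModel D} (y : I ⟶ Y.base) : one D I ⟶ Y :=
  homMk (X := one D I) y (fun t _ _ => t) fun t _ _ => Category.comp_id t

/-- Only one map over `I` goes into the identity of `I`, so the family part is forced. With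
`fromOne` this makes `I ↦ (I, 1)` left adjoint to the projection. -/
theorem one_hom_ext {I : B} {Y : PolyModel D} {f g : one D I ⟶ Y} (h : baseMap f = baseMap g) :
    f = g := by
  refine hom_ext h fun t y w => ?_
  exact (Category.comp_id _).symm.trans
    (((app_map f t y w).trans (app_map g t y (h ▸ w)).symm).trans (Category.comp_id _))

/-- The projection to bases is a right adjoint; the universal property is tested on the objects `(W,
1)`. -/
theorem isPullback_baseMap {P X Y Z : PolyModel D} {f : P ⟶ X} {g : P ⟶ Y} {h : X ⟶ Z}
    {k : Y ⟶ Z} (H : IsPullback f g h k) :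
    IsPullback (baseMap f) (baseMap g) (baseMap h) (baseMap k) := by
  refine isPullback_of_exists_lift (congrArg baseMap H.w) (fun {W} p q w => ?_)
    fun {W} m m' h₁ h₂ => ?_
  · have w' : fromOne (D := D) p ≫ h = fromOne q ≫ k := one_hom_ext w
    exact ⟨baseMap (H.lift _ _ w'), congrArg baseMap (H.lift_fst _ _ w'),
      congrArg baseMap (H.lift_snd _ _ w')⟩
  · exact congrArg baseMap (H.hom_ext (k := fromOne m) (l := fromOne m') (one_hom_ext h₁)
      (one_hom_ext h₂))

end Representable

variable [HasExtensiveSums B] [SumClosed D]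

variable (D) in
/-- The object `(I, 0)` of `Poly`. -/
noncomputable abbrev zero (I : B) : PolyModel D where
  base := I
  total := ⊥_ B
  map := initial.to I
  display := SumClosed.of_isInitial initialIsInitial _

/-- The map into `(I, 0)` given by a map of bases. -/
noncomputable abbrev toZero {X : PolyModel D} {I : B} (x : X.base ⟶ I) : X ⟶ zero D I :=
  homMk (Y := zero D I) x (fun _ y _ => (isInitialOfHom initialIsInitial y).to _)
    fun _ y _ => (isInitialOfHom initialIsInitial y).hom_ext _ _

@[simp]
theorem baseMap_toZero {X : PolyModel D} {I : B} (x : X.base ⟶ I) :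
    baseMap (toZero x) = x := rfl

/-- The family part is a map out of a strict initial object. So maps into `(I, 0)` are maps of
bases, and `I ↦ (I, 0)` is right adjoint to the projection. -/
theorem zero_hom_ext {X : PolyModel D} {I : B} {f g : X ⟶ zero D I}
    (h : baseMap f = baseMap g) : f = g :=
  hom_ext h fun _ y _ => (isInitialOfHom initialIsInitial y).hom_ext _ _

@[simp]
theorem comp_toZero {X Y : PolyModel D} {I : B} (f : X ⟶ Y) (y : Y.base ⟶ I) :
    f ≫ toZero y = toZero (baseMap f ≫ y) := zero_hom_ext rfl

theorem isPullback_toZero {P X Y Z : B} {f : P ⟶ X} {g : P ⟶ Y} {h : X ⟶ Z} {k : Y ⟶ Z}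
    (H : IsPullback f g h k) :
    IsPullback (toZero f : zero D P ⟶ zero D X) (toZero g : zero D P ⟶ zero D Y)
      (toZero h : zero D X ⟶ zero D Z) (toZero k : zero D Y ⟶ zero D Z) := by
  refine isPullback_of_exists_lift (zero_hom_ext H.w) (fun {W} p q w => ?_)
    fun {W} m m' h₁ h₂ => zero_hom_ext (H.hom_ext (congrArg baseMap h₁) (congrArg baseMap h₂))
  exact ⟨toZero (H.lift (baseMap p) (baseMap q) (congrArg baseMap w)),
    zero_hom_ext (H.lift_fst _ _ _), zero_hom_ext (H.lift_snd _ _ _)⟩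

/-! ### Cartesian maps and reindexing. -/

section Cartesian

variable {X Y : PolyModel D}

/-- The cartesian map given by a pullback square. -/
noncomputable abbrev cartHom (h : X.base ⟶ Y.base) (e : X.total ⟶ Y.total)
    (H : IsPullback e X.map Y.map h) : X ⟶ Y :=
  homMk h (fun t y w => H.lift y t w) fun _ _ _ => H.lift_snd _ _ _

omit [HasExtensiveSums B] [SumClosed D] in
theorem app_cartHom (h : X.base ⟶ Y.base) (e : X.total ⟶ Y.total)
    (H : IsPullback e X.map Y.map h) {T : B} (t : T ⟶ X.base) (y : T ⟶ Y.total)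
    (w : y ≫ Y.map = t ≫ h) : app (cartHom h e H) t y w = H.lift y t w := by
  refine app_homMk h (fun t y w => H.lift y t w) (fun _ _ _ => H.lift_snd _ _ _)
    (fun s t y w => ?_) _ _ _
  apply H.hom_ext <;> simp

omit [HasExtensiveSums B] [SumClosed D] in
theorem app_cartHom_comp (h : X.base ⟶ Y.base) (e : X.total ⟶ Y.total)
    (H : IsPullback e X.map Y.map h) {T : B} (t : T ⟶ X.base) (x : T ⟶ X.total)
    (w : x ≫ X.map = t) :
    app (cartHom h e H) t (x ≫ e) (by rw [Category.assoc, H.w, reassoc_of% w]) = x := by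
  rw [app_cartHom]
  apply H.hom_ext <;> simp [w]

/-- A lift is determined by its base: since `X.total` is a pullback of `Y.total`, the lift must act
on `z` in `X.total` as `p` acts on `z ≫ e`. -/
theorem isPullback_cartHom (h : X.base ⟶ Y.base) (e : X.total ⟶ Y.total)
    (H : IsPullback e X.map Y.map h) {I J : B} {x : X.base ⟶ I} {y : Y.base ⟶ J} {k : I ⟶ J}
    (hb : IsPullback h x y k) :
    IsPullback (cartHom h e H) (toZero x) (toZero y) (toZero k : zero D I ⟶ zero D J) := by
  refine isPullback_of_exists_lift (zero_hom_ext hb.w) (fun {W} p q w => ?_)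
    fun {W} m m' h₁ h₂ => ?_
  · have hw : baseMap p ≫ y = baseMap q ≫ k := congrArg baseMap w
    let l := hb.lift (baseMap p) (baseMap q) hw
    have hl : l ≫ h = baseMap p := hb.lift_fst _ _ _
    have aux : ∀ {T : B} (t : T ⟶ W.base) (z : T ⟶ X.total), z ≫ X.map = t ≫ l →
        (z ≫ e) ≫ Y.map = t ≫ baseMap p := fun t z w => by
      rw [Category.assoc, H.w, reassoc_of% w, hl]
    let m : W ⟶ X := homMk l (fun t z w => app p t (z ≫ e) (aux t z w)) fun t z w => app_map _ _ _ _
    have hm : ∀ {T : B} (t : T ⟶ W.base) (z : T ⟶ X.total) (w : z ≫ X.map = t ≫ l),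
        app m t z w = app p t (z ≫ e) (aux t z w) := fun t z w =>
      app_homMk _ _ _ (fun s t y w => by
        rw [comp_app]; exact app_congr rfl rfl (Category.assoc _ _ _).symm _) _ _ _
    refine ⟨m, hom_ext hl fun t y w => ?_, zero_hom_ext (hb.lift_snd _ _ _)⟩
    rw [app_comp, hm]
    refine app_congr rfl rfl ?_ _
    rw [app_cartHom]
    exact H.lift_fst _ _ _
  · have hb' : baseMap m = baseMap m' :=
      hb.hom_ext (congrArg baseMap h₁) (congrArg baseMap h₂)
    refine hom_ext hb' fun t z w => ?_
    have key : ∀ (n : W ⟶ X) (w : z ≫ X.map = t ≫ baseMap n),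
        app n t z w = app (n ≫ cartHom h e H) t (z ≫ e)
          (by rw [Category.assoc, H.w, reassoc_of% w, baseMap_comp]) := by
      intro n w
      rw [app_comp]
      exact app_congr rfl rfl (app_cartHom_comp _ _ _ _ _ w).symm _
    rw [key m, key m']
    exact app_congr h₁ rfl rfl _

/-- The reindexing of an object of `Poly` along a map into its base. -/
noncomputable abbrev reind (X : PolyModel D) {J : B} (h : J ⟶ X.base) : PolyModel D where
  base := J
  total := pullback X.map h
  map := pullback.snd X.map h
  display := D.pullback_snd _ _ X.display

/-- The cartesian map from the reindexing of an object. -/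
noncomputable abbrev reindHom (X : PolyModel D) {J : B} (h : J ⟶ X.base) : reind X h ⟶ X :=
  cartHom (X := reind X h) h (pullback.fst X.map h) (IsPullback.of_hasPullback X.map h)

omit [HasExtensiveSums B] [SumClosed D] in
@[simp]
theorem baseMap_reindHom (X : PolyModel D) {J : B} (h : J ⟶ X.base) :
    baseMap (reindHom X h) = h := rfl

theorem isPullback_reindHom (X : PolyModel D) {J : B} (h : J ⟶ X.base) {I K : B} {x : J ⟶ I}
    {y : X.base ⟶ K} {k : I ⟶ K} (hb : IsPullback h x y k) :
    IsPullback (reindHom X h) (toZero (X := reind X h) x) (toZero y)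
      (toZero k : zero D I ⟶ zero D K) :=
  isPullback_cartHom (X := reind X h) _ _ _ hb

end Cartesian

/-! ### Vertical maps and binary products in the fibres. -/

section Vertical

variable {Y : PolyModel D}

/-- The vertical map given by a map of total objects. -/
noncomputable abbrev vert {A : B} (a : A ⟶ Y.total) (m : A ⟶ Y.base) (hm : D m) (w : a ≫ Y.map = m) :
    Y ⟶ { base := Y.base, total := A, map := m, display := hm } :=
  homMk (Y := { base := Y.base, total := A, map := m, display := hm }) (𝟙 Y.base)
    (fun t z _ => z ≫ a) fun t z w' => by
      rw [Category.assoc, w]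
      exact w'.trans (Category.comp_id t)

omit [HasExtensiveSums B] [SumClosed D] in
@[simp]
theorem baseMap_vert {A : B} (a : A ⟶ Y.total) (m : A ⟶ Y.base) (hm : D m) (w : a ≫ Y.map = m) :
    baseMap (vert a m hm w) = 𝟙 Y.base := rfl

omit [HasExtensiveSums B] [SumClosed D] in
theorem app_vert {A : B} (a : A ⟶ Y.total) (m : A ⟶ Y.base) (hm : D m) (w : a ≫ Y.map = m)
    {T : B} (t : T ⟶ Y.base) (z : T ⟶ A) (h : z ≫ m = t ≫ 𝟙 Y.base) :
    app (vert a m hm w) t z h = z ≫ a :=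
  app_homMk (Y := { base := Y.base, total := A, map := m, display := hm }) (𝟙 Y.base)
    (fun t z _ => z ≫ a) (fun t z w' => by
      rw [Category.assoc, w]
      exact w'.trans (Category.comp_id t)) (fun _ _ _ _ => (Category.assoc _ _ _).symm) _ _ _

/-- Products in `(D/I)ᵒᵖ` are coproducts in `D/I`. They retain their universal property against
objects over other bases because coproducts are stable under pullback. -/
theorem isPullback_vert {A A' : B} {a : A ⟶ Y.total} {a' : A' ⟶ Y.total} {m : A ⟶ Y.base}
    {m' : A' ⟶ Y.base} {hm : D m} {hm' : D m'} (w : a ≫ Y.map = m) (w' : a' ≫ Y.map = m')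
    (h : IsCoprod a a') :
    IsPullback (vert a m hm w) (vert a' m' hm' w')
      (toZero (X := { base := Y.base, total := A, map := m, display := hm }) (𝟙 Y.base))
      (toZero (X := { base := Y.base, total := A', map := m', display := hm' }) (𝟙 Y.base)) := by
  refine isPullback_of_exists_lift (zero_hom_ext rfl) (fun {W} p q e => ?_)
    fun {W} n n' h₁ h₂ => ?_
  · have hpq : baseMap p = baseMap q := by
      have := congrArg baseMap e
      exact (Category.comp_id _).symm.trans (this.trans (Category.comp_id _))
    let h₀ : W.base ⟶ Y.base := (baseMap p :)
    -- Split the generic element of `Y.total` over `W.base`, and let the lift act as `p` on one part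
    -- and as `q` on the other.
    obtain ⟨T₁, T₂, i₁, i₂, t₁, t₂, H₁, H₂, H⟩ := h.exists_split D (pullback.fst Y.map h₀)
    have c₁ : t₁ ≫ m = (i₁ ≫ pullback.snd Y.map h₀) ≫ h₀ := by
      rw [Category.assoc, ← pullback.condition, reassoc_of% H₁.w, w]
    have c₂ : t₂ ≫ m' = (i₂ ≫ pullback.snd Y.map h₀) ≫ baseMap q := by
      refine Eq.trans ?_ (congrArg ((i₂ ≫ pullback.snd Y.map h₀) ≫ ·) hpq)
      change _ = _ ≫ h₀
      rw [Category.assoc, ← pullback.condition, reassoc_of% H₂.w, w']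
    let φ : pullback Y.map h₀ ⟶ W.total := H.desc
      (app p (i₁ ≫ pullback.snd Y.map h₀) t₁ c₁) (app q (i₂ ≫ pullback.snd Y.map h₀) t₂ c₂)
    have hφ : φ ≫ W.map = pullback.snd Y.map h₀ := by
      apply H.hom_ext
      · rw [H.inl_desc_assoc, app_map]
      · rw [H.inr_desc_assoc, app_map]
    let n : W ⟶ Y := Hom.mk h₀ φ hφ
    have hn : ∀ {T : B} (t : T ⟶ W.base) (y : T ⟶ Y.total) (w : y ≫ Y.map = t ≫ h₀),
      app n t y w = pullback.lift y t w ≫ φ := fun _ _ _ => rfl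
    have b₁ : baseMap (n ≫ vert a m hm w) = baseMap p := Category.comp_id h₀
    have b₂ : baseMap (n ≫ vert a' m' hm' w') = baseMap q := (Category.comp_id h₀).trans hpq
    refine ⟨n, hom_ext b₁ fun {T} t z e => ?_, hom_ext b₂ fun {T} t z e => ?_⟩
    · have e' : z ≫ m = t ≫ h₀ := e.trans (by simp; rfl)
      have e'' : (z ≫ a) ≫ Y.map = t ≫ h₀ := by rw [Category.assoc, w, e']
      have l : pullback.lift (z ≫ a) t e'' ≫ pullback.fst Y.map h₀ = z ≫ a :=
        pullback.lift_fst _ _ _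
      have l₁ := H₁.lift_fst _ _ l
      have l₂ := H₁.lift_snd _ _ l
      calc _ = app n t (z ≫ a) e'' := by
            rw [app_comp]
            refine app_congr rfl rfl ?_ _
            rw [app_vert]
        _ = H₁.lift _ _ l ≫ i₁ ≫ φ := by rw [hn, reassoc_of% l₁]
        _ = _ := by
            rw [H.inl_desc, comp_app]
            refine app_congr rfl ?_ l₂ _
            rw [reassoc_of% l₁, pullback.lift_snd]
    · have e' : z ≫ m' = t ≫ h₀ := e.trans (by simp; rfl)
      have e'' : (z ≫ a') ≫ Y.map = t ≫ h₀ := by rw [Category.assoc, w', e']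
      have l : pullback.lift (z ≫ a') t e'' ≫ pullback.fst Y.map h₀ = z ≫ a' :=
        pullback.lift_fst _ _ _
      have l₁ := H₂.lift_fst _ _ l
      have l₂ := H₂.lift_snd _ _ l
      calc _ = app n t (z ≫ a') e'' := by
            rw [app_comp]
            refine app_congr rfl rfl ?_ _
            rw [app_vert]
        _ = H₂.lift _ _ l ≫ i₂ ≫ φ := by rw [hn, reassoc_of% l₁]
        _ = _ := by
            rw [H.inr_desc, comp_app]
            refine app_congr rfl ?_ l₂ _
            rw [reassoc_of% l₁, pullback.lift_snd]
  · have hb : baseMap n = baseMap n' := by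
      have := congrArg baseMap h₁
      exact (Category.comp_id _).symm.trans (this.trans (Category.comp_id _))
    refine hom_ext hb fun {T} t y e => ?_
    obtain ⟨T₁, T₂, i₁, i₂, t₁, t₂, H₁, H₂, H⟩ := h.exists_split D y
    have key : ∀ {A : B} (a : A ⟶ Y.total) (m : A ⟶ Y.base) (hm : D m) (w : a ≫ Y.map = m)
        (_ : n ≫ vert a m hm w = n' ≫ vert a m hm w) {S : B} (i : S ⟶ T) (s : S ⟶ A)
        (_ : i ≫ y = s ≫ a), i ≫ app n t y e = i ≫ app n' t y (hb ▸ e) := by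
      intro A a m hm w hv S i s hs
      have aux : ∀ (k : W ⟶ Y) (e : y ≫ Y.map = t ≫ baseMap k), i ≫ app k t y e =
          app (k ≫ vert a m hm w) (i ≫ t) s (by
            rw [baseMap_comp, baseMap_vert, Category.comp_id, Category.assoc, ← e,
              reassoc_of% hs, w]) := by
        intro k e
        rw [comp_app, app_comp]
        refine app_congr rfl rfl ?_ _
        rw [app_vert, hs]
      rw [aux n, aux n']
      exact app_congr hv rfl rfl _
    exact H.hom_ext (key _ _ _ _ h₁ i₁ t₁ H₁.w) (key _ _ _ _ h₂ i₂ t₂ H₂.w)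

end Vertical

/-- Pullbacks over `(K, 0)` are computed by pullbacks of bases and sums of families. -/
theorem exists_isPullback_of_base {X Y : PolyModel D} {J K : B} {x : X.base ⟶ K} {y : Y.base ⟶ K}
    {p₀ : J ⟶ X.base} {q₀ : J ⟶ Y.base} (hJ : IsPullback p₀ q₀ x y) :
    ∃ (T : B) (m : T ⟶ J) (hm : D m)
      (p : ({ base := J, total := T, map := m, display := hm } : PolyModel D) ⟶ X)
      (q : ({ base := J, total := T, map := m, display := hm } : PolyModel D) ⟶ Y),
      baseMap p = p₀ ∧ baseMap q = q₀ ∧ IsPullback p q (toZero x) (toZero y) ∧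
      ∀ (F : MorphismProperty B) [IsDisplayClass F] [SumClosed F],
        F X.map → F Y.map → F m := by
  let X' := reind X p₀
  let Y' := reind Y q₀
  have h := IsCoprod.coprod X'.total Y'.total
  have w₁ := h.inl_desc (W := J) X'.map Y'.map
  have w₂ := h.inr_desc (W := J) X'.map Y'.map
  have hF : ∀ (F : MorphismProperty B) [IsDisplayClass F] [SumClosed F],
      F X.map → F Y.map → F (h.desc (W := J) X'.map Y'.map) := fun F _ _ hX hY =>
    SumClosed.of_inl_of_inr h _ (by rw [w₁]; exact F.pullback_snd _ _ hX)
      (by rw [w₂]; exact F.pullback_snd _ _ hY)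
  let P : PolyModel D := ⟨J, X'.total ⨿ Y'.total, h.desc X'.map Y'.map, hF D X.display Y.display⟩
  have H₀ : IsPullback (vert (Y := P) coprod.inl X'.map X'.display w₁)
      (vert (Y := P) coprod.inr Y'.map Y'.display w₂) (toZero (X := X') (𝟙 J))
      (toZero (X := Y') (𝟙 J)) := isPullback_vert _ _ h
  have H₁ := isPullback_reindHom (D := D) X p₀
    (IsPullback.of_vert_isIso ⟨by simp⟩ : IsPullback p₀ (𝟙 _) (𝟙 _) p₀)
  have H₂ := isPullback_reindHom (D := D) Y q₀ hJ.flip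
  -- Both objects are reindexed to the common base `J`, multiplied there, and the resulting squares
  -- are pasted.
  have H := ((H₀.paste_horiz H₁).congr rfl rfl rfl
    (zero_hom_ext (Category.id_comp p₀))).paste_vert H₂.flip
  exact ⟨_, _, P.display, _, _, Category.id_comp p₀, Category.id_comp q₀,
    H.congr rfl rfl (zero_hom_ext (Category.id_comp x)) rfl, fun F _ _ hX hY => hF F hX hY⟩

theorem exists_isPullback {X Y : PolyModel D} {K : B} (x : X.base ⟶ K) (y : Y.base ⟶ K)
    [HasPullback x y] :
    ∃ (P : PolyModel D) (p : P ⟶ X) (q : P ⟶ Y), IsPullback p q (toZero x) (toZero y) ∧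
      ∀ (F : MorphismProperty B) [IsDisplayClass F] [SumClosed F],
        F X.map → F Y.map → F P.map := by
  obtain ⟨T, m, hm, p, q, -, -, H, hF⟩ :=
    exists_isPullback_of_base (D := D) (IsPullback.of_hasPullback x y)
  exact ⟨_, p, q, H, hF⟩

end PolyModel

/-! ## Display maps of the polynomial model as pullbacks of basic maps -/

namespace PolyModel

variable {B : Type u} [Category.{v} B] {D : MorphismProperty B} [IsDisplayClass D]
  [HasExtensiveSums B] [SumClosed D]

/-- The pullbacks of the maps `C ⟶ (K, 0)` over a map in `F`, where `C` is a family of objects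
of `F`. -/
def glued (F : MorphismProperty B) : MorphismProperty (PolyModel D) := fun A X f =>
  ∃ (C : PolyModel D) (K : B) (j : C.base ⟶ K) (q : A ⟶ C) (x : X.base ⟶ K),
    F C.map ∧ F j ∧ IsPullback q f (toZero j) (toZero x)

theorem glued_mono {F F' : MorphismProperty B} (h : F ≤ F') :
    glued (D := D) F ≤ glued F' := by
  rintro A X f ⟨C, K, j, q, x, hC, hj, H⟩
  exact ⟨C, K, j, q, x, h _ hC, h _ hj, H⟩

instance isIso_toZero (I : B) : IsIso (toZero (𝟙 I) : zero D I ⟶ zero D I) := by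
  have : (toZero (𝟙 I) : zero D I ⟶ zero D I) = 𝟙 _ := zero_hom_ext rfl
  rw [this]
  infer_instance

theorem glued_toZero {F : MorphismProperty B} {C : PolyModel D} {K : B} {j : C.base ⟶ K}
    (hC : F C.map) (hj : F j) : glued F (toZero j) :=
  ⟨C, K, j, 𝟙 C, 𝟙 K, hC, hj, IsPullback.of_horiz_isIso ⟨zero_hom_ext (by simp)⟩⟩

variable {F : MorphismProperty B} [IsDisplayClass F]

theorem glued_baseMap {A X : PolyModel D} {f : A ⟶ X} (h : glued F f) : F (baseMap f) := by
  obtain ⟨C, K, j, q, x, hC, hj, H⟩ := h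
  exact F.of_isPullback (isPullback_baseMap H) hj

/-- Normal form: reindexing `C` along `baseMap q` moves the family onto `A.base`. Then `A` carries
the sum of a family `T` in `F` and the reindexed family of `X`. -/
theorem exists_isPullback_of_glued {A X : PolyModel D} {f : A ⟶ X} (h : glued F f) :
    ∃ (T : B) (m : T ⟶ A.base) (hm : D m)
      (q : A ⟶ { base := A.base, total := T, map := m, display := hm }), F m ∧
      baseMap q = 𝟙 A.base ∧ IsPullback q f
        (toZero (X := { base := A.base, total := T, map := m, display := hm }) (baseMap f :))
        (toZero (𝟙 X.base)) := by
  obtain ⟨C, K, j, q, x, hC, hj, H⟩ := h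
  have hb := isPullback_baseMap H
  have H' := isPullback_reindHom C (baseMap q) hb
  have w : q ≫ toZero j = (f ≫ toZero (𝟙 X.base)) ≫ (toZero x : zero D X.base ⟶ zero D K) := by
    rw [H.w]
    exact zero_hom_ext (by simp)
  let l := H'.lift q (f ≫ toZero (𝟙 X.base)) w
  have h₁ : l ≫ reindHom C (baseMap q) = q := H'.lift_fst _ _ _
  have h₂ : l ≫ toZero (baseMap f :) = f ≫ toZero (𝟙 X.base) := H'.lift_snd _ _ _
  refine ⟨_, _, (reind C (baseMap q)).display, l, F.pullback_snd _ _ hC, ?_, ?_⟩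
  · apply hb.hom_ext
    · exact (congrArg baseMap h₁).trans (Category.id_comp _).symm
    · exact (congrArg baseMap h₂).trans ((Category.comp_id _).trans (Category.id_comp _).symm)
  · exact IsPullback.of_right (H.congr h₁.symm rfl rfl
      (zero_hom_ext (Category.id_comp x).symm)) h₂ H'

instance [SumClosed F] : IsDisplayClass (glued (D := D) F) where
  id_mem X := ⟨zero D X.base, X.base, 𝟙 _, toZero (𝟙 _), 𝟙 _,
    SumClosed.of_isInitial initialIsInitial _, F.id_mem _,
      IsPullback.of_vert_isIso ⟨zero_hom_ext rfl⟩⟩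
  hasPullback {A Y X} f h hf := by
    obtain ⟨C, K, j, q, x, hC, hj, H⟩ := hf
    have := MorphismProperty.HasPullbacks.hasPullback (baseMap h ≫ x) hj
    obtain ⟨P, p, r, H', -⟩ := PolyModel.exists_isPullback (X := C) (Y := Y) j (baseMap h ≫ x)
    have w : p ≫ toZero j = (r ≫ h) ≫ toZero x := by
      rw [H'.w]
      exact zero_hom_ext (by simp)
    have h₁ := H.lift_fst p (r ≫ h) w
    exact IsPullback.hasPullback (IsPullback.of_right (H'.congr h₁.symm rfl rfl
      (comp_toZero h x).symm) (H.lift_snd p (r ≫ h) w) H)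
  of_isPullback {A' Y X A} g f g' h sq hg := by
    obtain ⟨C, K, j, q, x, hC, hj, H⟩ := hg
    exact ⟨C, K, j, _, _, hC, hj, (sq.paste_horiz H).congr rfl rfl rfl (comp_toZero _ _)⟩

/-- In normal form `A` adds a family `T` to `X`, and `X` adds `T'` to `Y`. So `A` adds to `Y` the
sum `P` of `T` and the reindexed `T'`. -/
theorem isStableUnderComposition_glued [SumClosed F] [F.IsStableUnderComposition] :
    (glued (D := D) F).IsStableUnderComposition where
  comp_mem {A X Y} f g hf hg := by
    obtain ⟨T, m, hm, q, hT, hq, H⟩ := exists_isPullback_of_glued hf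
    obtain ⟨T', m', hm', q', hT', hq', H'⟩ := exists_isPullback_of_glued hg
    have hfb := glued_baseMap hf
    have := MorphismProperty.HasPullbacks.hasPullback (𝟙 X.base) hfb
    obtain ⟨P, p, r, K, hP⟩ := PolyModel.exists_isPullback (X := ⟨_, _, m, hm⟩)
      (Y := ⟨_, _, m', hm'⟩) (baseMap f :) (𝟙 X.base)
    let C : PolyModel D := ⟨_, _, m, hm⟩
    let C' : PolyModel D := ⟨_, _, m', hm'⟩
    have w : q ≫ toZero (X := C) (baseMap f :) = (f ≫ q') ≫ toZero (X := C') (𝟙 X.base) := by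
      rw [H.w]
      refine zero_hom_ext ?_
      change baseMap f ≫ 𝟙 _ = (baseMap f ≫ baseMap q') ≫ 𝟙 _
      rw [hq']
      exact (Category.comp_id (baseMap f ≫ 𝟙 X.base)).symm
    let l := K.lift q (f ≫ q') w
    have h₁ : l ≫ p = q := K.lift_fst _ _ _
    have h₂ : l ≫ r = f ≫ q' := K.lift_snd _ _ _
    have K' : IsPullback l f r q' := IsPullback.of_right (H.congr h₁.symm rfl rfl
      (zero_hom_ext ((Category.comp_id _).trans hq').symm)) h₂ K
    exact ⟨P, Y.base, baseMap r ≫ (baseMap g :), l, 𝟙 _, hP F hT hT',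
      F.comp_mem _ _ (F.of_isPullback (isPullback_baseMap K) hfb) (glued_baseMap hg),
      (K'.paste_vert H').congr rfl rfl (comp_toZero r (baseMap g :)) rfl⟩

omit [IsDisplayClass F] in
-- The terminal object is `(1, 0)`, over which each object serves as its own family `C`.
theorem isWellRooted_glued [SumClosed F] (h : IsWellRooted F) (hDF : D ≤ F) :
    IsWellRooted (glued (D := D) F) := by
  have := h.hasTerminal
  have hz : ∀ {I : B}, IsTerminal I → Nonempty (IsTerminal (zero D I)) := fun {I} hI =>
    ⟨IsTerminal.ofUniqueHom (fun X => toZero (hI.from X.base)) fun X m =>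
      zero_hom_ext (hI.hom_ext _ _)⟩
  refine ⟨(hz terminalIsTerminal).some.hasTerminal, fun {X T} hT f => ?_⟩
  have hb : IsTerminal T.base := IsTerminal.ofUniqueHom (fun I => baseMap (hT.from (one D I)))
    fun I m => congrArg baseMap (hT.hom_ext (fromOne m) _)
  have : IsIso (toZero (𝟙 T.base) : T ⟶ zero D T.base) :=
    isIso_of_isTerminal hT (hz hb).some _
  exact ⟨X, T.base, baseMap f, 𝟙 X, 𝟙 _, hDF _ X.display, h.toTerminal hb _,
    IsPullback.of_horiz_isIso ⟨zero_hom_ext (by simp)⟩⟩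

end PolyModel

/-! ## Coproducts in the polynomial model -/

namespace PolyModel

variable {B : Type u} [Category.{v} B] {D : MorphismProperty B} [IsDisplayClass D]
  [HasExtensiveSums B] [SumClosed D]

/-- The cartesian maps of `Poly`. -/
def IsCart {X Y : PolyModel D} (f : X ⟶ Y) : Prop :=
  IsPullback f (toZero (𝟙 X.base)) (toZero (𝟙 Y.base)) (toZero (baseMap f :))

theorem IsCart.isPullback_toZero {X Y : PolyModel D} {f : X ⟶ Y} (h : IsCart f) {I J : B}
    {x : X.base ⟶ I} {y : Y.base ⟶ J} {k : I ⟶ J} (hb : IsPullback (baseMap f) x y k) :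
    IsPullback f (toZero x) (toZero y) (toZero k : zero D I ⟶ zero D J) :=
  (h.paste_vert (PolyModel.isPullback_toZero hb)).congr rfl (zero_hom_ext (Category.id_comp _))
    (zero_hom_ext (Category.id_comp _)) rfl

theorem isCart_of_isPullback_toZero {X Y : PolyModel D} {f : X ⟶ Y} {I J : B}
    {x : X.base ⟶ I} {y : Y.base ⟶ J} {k : I ⟶ J}
    (h : IsPullback f (toZero x) (toZero y) (toZero k : zero D I ⟶ zero D J)) : IsCart f :=
  IsPullback.of_bot (h.congr rfl (zero_hom_ext (Category.id_comp x).symm)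
    (zero_hom_ext (Category.id_comp y).symm) rfl) (zero_hom_ext (by simp))
    (PolyModel.isPullback_toZero (isPullback_baseMap h))

theorem isCart_cartHom {X Y : PolyModel D} (h : X.base ⟶ Y.base) (e : X.total ⟶ Y.total)
    (H : IsPullback e X.map Y.map h) : IsCart (cartHom h e H) :=
  isPullback_cartHom h e H (IsPullback.of_vert_isIso ⟨by simp⟩)

theorem isCart_of_isIso {X Y : PolyModel D} (f : X ⟶ Y) [IsIso f] : IsCart f := by
  have : IsIso (toZero (baseMap f :) : zero D X.base ⟶ zero D Y.base) :=
    ⟨toZero (baseMap (inv f) :), zero_hom_ext (show baseMap (f ≫ inv f) = 𝟙 X.base by simp),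
      zero_hom_ext (show baseMap (inv f ≫ f) = 𝟙 Y.base by simp)⟩
  exact IsPullback.of_horiz_isIso ⟨zero_hom_ext (by simp)⟩

theorem IsCart.comp {X Y Z : PolyModel D} {f : X ⟶ Y} {g : Y ⟶ Z} (hf : IsCart f)
    (hg : IsCart g) : IsCart (f ≫ g) :=
  (hf.paste_horiz hg).congr rfl rfl rfl (zero_hom_ext rfl)

/-- Cartesian maps are stable under pullback. -/
theorem IsCart.of_isPullback {P X Y Z : PolyModel D} {f : P ⟶ X} {g : P ⟶ Y} {h : X ⟶ Z}
    {k : Y ⟶ Z} (H : IsPullback f g h k) (hk : IsCart k) : IsCart f := by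
  refine isCart_of_isPullback_toZero (I := Y.base) (x := baseMap g) (k := (baseMap k :))
    (y := baseMap h) ?_
  exact (H.paste_vert hk).congr rfl (zero_hom_ext (by simp)) (zero_hom_ext (by simp)) rfl

/-- Commutative squares with two opposite cartesian sides are pullbacks if their bases are. -/
theorem IsCart.isPullback {P X Y Z : PolyModel D} {f : P ⟶ X} {g : P ⟶ Y} {h : X ⟶ Z}
    {k : Y ⟶ Z} (hf : IsCart f) (hk : IsCart k) (w : f ≫ h = g ≫ k)
    (hb : IsPullback (baseMap f) (baseMap g) (baseMap h) (baseMap k)) : IsPullback f g h k :=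
  IsPullback.of_bot ((hf.isPullback_toZero hb).congr rfl (zero_hom_ext (by simp))
    (zero_hom_ext (by simp)) rfl) w hk

/-- The factorization of a cartesian map through the reindexing of its codomain. -/
theorem IsCart.exists_isIso {X Y : PolyModel D} {f : X ⟶ Y} (hf : IsCart f) :
    ∃ k : X ⟶ reind Y (baseMap f), IsIso k ∧ k ≫ reindHom Y (baseMap f) = f := by
  have H : IsPullback (reindHom Y (baseMap f)) (toZero (𝟙 X.base)) (toZero (𝟙 Y.base))
    (toZero (baseMap f :) : zero D X.base ⟶ zero D Y.base) := isCart_cartHom _ _ _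
  exact ⟨(hf.isoIsPullback _ _ H).hom, inferInstance, hf.isoIsPullback_hom_fst _ _ H⟩

/-- The family of a map `Z ⟶ W` lives on a pullback over `Z.base`. Extensivity splits that pullback
into the parts over `I` and `J`, where `f` and `g` prescribe the family. -/
theorem isCoprod_reindHom (Z : PolyModel D) {I J : B} {i : I ⟶ Z.base} {j : J ⟶ Z.base}
    (h : IsCoprod i j) : IsCoprod (reindHom Z i) (reindHom Z j) := by
  refine IsCoprod.of_unique (fun {W} f g => ?_) fun {W} f g h₁ h₂ => ?_
  · let k : Z.base ⟶ W.base := h.desc (baseMap f) (baseMap g)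
    have hi : i ≫ k = baseMap f := h.inl_desc _ _
    have hj : j ≫ k = baseMap g := h.inr_desc _ _
    obtain ⟨T₁, T₂, i₁, i₂, t₁, t₂, H₁, H₂, H⟩ := h.exists_split D (pullback.snd W.map k)
    let φ : pullback W.map k ⟶ Z.total := H.desc
      (app f t₁ (i₁ ≫ pullback.fst W.map k)
        (by rw [Category.assoc, pullback.condition, reassoc_of% H₁.w, hi]) ≫ pullback.fst Z.map i)
      (app g t₂ (i₂ ≫ pullback.fst W.map k)
        (by rw [Category.assoc, pullback.condition, reassoc_of% H₂.w, hj]) ≫ pullback.fst Z.map j)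
    have hφ : φ ≫ Z.map = pullback.snd W.map k := by
      apply H.hom_ext
      · rw [H.inl_desc_assoc]
        refine (Category.assoc _ _ _).trans ?_
        rw [pullback.condition (f := Z.map)]
        exact (app_map_assoc f _ _ _ i).trans H₁.w.symm
      · rw [H.inr_desc_assoc]
        refine (Category.assoc _ _ _).trans ?_
        rw [pullback.condition (f := Z.map)]
        exact (app_map_assoc g _ _ _ j).trans H₂.w.symm
    let n : Z ⟶ W := Hom.mk k φ hφ
    have key : ∀ {I : B} {i : I ⟶ Z.base} (f : reind Z i ⟶ W) (hi : i ≫ k = baseMap f) {T₁ : B}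
        {i₁ : T₁ ⟶ pullback W.map k} {t₁ : T₁ ⟶ I} (H₁ : IsPullback i₁ t₁ (pullback.snd W.map k) i)
        (e₁ : (i₁ ≫ pullback.fst W.map k) ≫ W.map = t₁ ≫ baseMap f),
        i₁ ≫ φ = app f t₁ (i₁ ≫ pullback.fst W.map k) e₁ ≫ pullback.fst Z.map i →
        reindHom Z i ≫ n = f := by
      intro I i f hi T₁ i₁ t₁ H₁ e₁ hf
      refine hom_ext hi fun {T} t w e => ?_
      have e' : w ≫ W.map = (t ≫ i) ≫ k := by rw [Category.assoc]; exact e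
      have l : pullback.lift w (t ≫ i) e' ≫ pullback.snd W.map k = t ≫ i := pullback.lift_snd _ _ _
      have l₁ := H₁.lift_fst _ _ l
      have l₂ := H₁.lift_snd _ _ l
      rw [app_comp, app_cartHom]
      refine (IsPullback.of_hasPullback Z.map i).hom_ext ?_ ?_
      · refine (IsPullback.lift_fst _ _ _ _).trans ?_
        change pullback.lift w (t ≫ i) e' ≫ φ = _
        conv_lhs => rw [← l₁, Category.assoc, hf, ← Category.assoc, comp_app]
        refine congrArg (· ≫ _) (app_congr rfl l₂ ?_ _)
        rw [reassoc_of% l₁, pullback.lift_fst]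
      · exact (IsPullback.lift_snd _ _ _ _).trans (app_map f t w _).symm
    exact ⟨n, key f hi H₁ _ (H.inl_desc _ _), key g hj H₂ _ (H.inr_desc _ _)⟩
  · have hb : baseMap f = baseMap g := h.hom_ext (congrArg baseMap h₁) (congrArg baseMap h₂)
    refine hom_ext hb fun {T} t w e => ?_
    obtain ⟨T₁, T₂, i₁, i₂, t₁, t₂, H₁, H₂, H⟩ := h.exists_split D t
    have key : ∀ {I : B} (i : I ⟶ Z.base) (_ : reindHom Z i ≫ f = reindHom Z i ≫ g) {S : B}
        (r : S ⟶ T) (s : S ⟶ I) (_ : r ≫ t = s ≫ i), r ≫ app f t w e = r ≫ app g t w (hb ▸ e) := by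
      intro I i hi S r s hr
      have aux : ∀ (k : Z ⟶ W) (e : w ≫ W.map = t ≫ baseMap k), r ≫ app k t w e =
          app (reindHom Z i ≫ k) s (r ≫ w) (by
            rw [baseMap_comp, baseMap_reindHom, Category.assoc, e, reassoc_of% hr]) ≫
            pullback.fst Z.map i := by
        intro k e
        rw [comp_app, app_comp, app_cartHom]
        refine Eq.trans ?_ (IsPullback.lift_fst _ _ _ _).symm
        exact app_congr rfl hr rfl _
      rw [aux f, aux g]
      exact congrArg (· ≫ _) (app_congr hi rfl rfl _)
    exact H.hom_ext (key _ h₁ i₁ t₁ H₁.w) (key _ h₂ i₂ t₂ H₂.w)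

theorem isCoprod_of_isCart {X Y Z : PolyModel D} {a : X ⟶ Z} {b : Y ⟶ Z} (ha : IsCart a)
    (hb : IsCart b) (h : IsCoprod (baseMap a) (baseMap b)) : IsCoprod a b := by
  obtain ⟨i, _, hi⟩ := ha.exists_isIso
  obtain ⟨j, _, hj⟩ := hb.exists_isIso
  refine (isCoprod_reindHom Z h).of_iso (asIso i) (asIso j) (Iso.refl _) ?_ ?_
  · exact (Category.comp_id a).trans hi.symm
  · exact (Category.comp_id b).trans hj.symm

/-- The projection to bases is also a left adjoint; the universal property is tested on the objects
`(W, 0)`. -/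
theorem isCoprod_baseMap {X Y Z : PolyModel D} {a : X ⟶ Z} {b : Y ⟶ Z} (h : IsCoprod a b) :
    IsCoprod (baseMap a) (baseMap b) :=
  IsCoprod.of_unique
    (fun f g => ⟨baseMap (h.desc (toZero f) (toZero g)), congrArg baseMap (h.inl_desc _ _),
      congrArg baseMap (h.inr_desc _ _)⟩)
    fun f g h₁ h₂ => congrArg baseMap
      (h.hom_ext (f := toZero f) (g := toZero g) (zero_hom_ext h₁) (zero_hom_ext h₂))

/-- Add bases and families separately. Extensivity of `B` makes the two squares pullbacks, so the
inclusions are cartesian. -/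
theorem exists_isCoprod [D.IsStableUnderComposition] {X Y : PolyModel D} {I : B}
    {i : X.base ⟶ I} {j : Y.base ⟶ I} (h : IsCoprod i j) :
    ∃ (T : B) (m : T ⟶ I) (hm : D m)
      (a : X ⟶ { base := I, total := T, map := m, display := hm })
      (b : Y ⟶ { base := I, total := T, map := m, display := hm }), baseMap a = i ∧ baseMap b = j ∧
      IsCoprod a b ∧ IsCart a ∧ IsCart b ∧ ∀ (F : MorphismProperty B) [SumClosed F]
        [F.IsStableUnderComposition], F X.map → F Y.map → F m := by
  have h' := IsCoprod.coprod X.total Y.total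
  have w₁ := h'.inl_desc (X.map ≫ i) (Y.map ≫ j)
  have w₂ := h'.inr_desc (X.map ≫ i) (Y.map ≫ j)
  have hF : ∀ (F : MorphismProperty B) [SumClosed F] [F.IsStableUnderComposition],
      F X.map → F Y.map → F (h'.desc (X.map ≫ i) (Y.map ≫ j)) := fun F _ _ hX hY =>
    SumClosed.of_isCoprod h h' hX hY w₁ w₂
  have H := h.isPullback h' w₁ w₂
  let Z : PolyModel D := ⟨I, _, _, hF D X.display Y.display⟩
  have ha := isCart_cartHom (X := X) (Y := Z) i _ H.1
  have hb := isCart_cartHom (X := Y) (Y := Z) j _ H.2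
  exact ⟨_, _, hF D X.display Y.display, _, _, rfl, rfl, isCoprod_of_isCart ha hb h, ha, hb, hF⟩

variable [D.IsStableUnderComposition]

theorem isCart_inl {X Y Z : PolyModel D} {a : X ⟶ Z} {b : Y ⟶ Z} (h : IsCoprod a b) :
    IsCart a := by
  obtain ⟨T, m, hm, a', b', -, -, h', ha', -, -⟩ := exists_isCoprod (isCoprod_baseMap h)
  have e : a' ≫ (h'.uniqueUpToIso h).hom = a := h'.inl_desc _ _
  rw [← e]
  exact ha'.comp (isCart_of_isIso _)

theorem isCart_inr {X Y Z : PolyModel D} {a : X ⟶ Z} {b : Y ⟶ Z} (h : IsCoprod a b) :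
    IsCart b := isCart_inl h.symm

/-- An object of `Poly` with initial base is initial. -/
noncomputable def isInitialOfBase {X : PolyModel D} (h : IsInitial X.base) : IsInitial X :=
  IsInitial.ofUniqueHom
    (fun Y => homMk (h.to Y.base) (fun t _ _ => (isInitialOfHom h t).to _)
      fun t _ _ => (isInitialOfHom h t).hom_ext _ _)
    fun _ _ => hom_ext (h.hom_ext _ _) fun t _ _ => (isInitialOfHom h t).hom_ext _ _

/-- Coproduct inclusions are cartesian, and both coproducts and pullbacks along cartesian maps are
detected on bases. So both implications reduce to extensivity of `B`. -/
instance : HasExtensiveSums (PolyModel D) where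
  isExtensiveCategory := {
    hasFiniteCoproducts := by
      have : HasInitial (PolyModel D) := (isInitialOfBase (X := zero D (⊥_ B))
        initialIsInitial).hasInitial
      have : HasBinaryCoproducts (PolyModel D) := by
        refine @hasBinaryCoproducts_of_hasColimit_pair _ _ fun {X Y} => ?_
        obtain ⟨T, m, hm, a, b, -, -, h, -⟩ := exists_isCoprod (X := X) (Y := Y)
          (IsCoprod.coprod X.base Y.base)
        exact ⟨⟨_, h.some⟩⟩
      exact hasFiniteCoproducts_of_has_binary_and_initial
    coproduct_iff_pullbacks := by
      intro A A' X Y c c' a b f hc hX hY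
      have hc' := IsCoprod.of_isColimit hc.some
      refine ⟨fun ⟨h⟩ => ?_, fun ⟨h₁, h₂⟩ => ?_⟩
      · have h' := IsCoprod.of_isColimit h
        have H := (isCoprod_baseMap hc').isPullback (isCoprod_baseMap h') (f := baseMap a)
          (g := baseMap b) (k := baseMap f) (congrArg baseMap hX) (congrArg baseMap hY)
        exact ⟨(isCart_inl h').isPullback (isCart_inl hc') hX H.1,
          (isCart_inr h').isPullback (isCart_inr hc') hY H.2⟩
      · exact (isCoprod_of_isCart (IsCart.of_isPullback h₁ (isCart_inl hc'))
          (IsCart.of_isPullback h₂ (isCart_inr hc')) ((isCoprod_baseMap hc').of_isPullback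
            (isPullback_baseMap h₁) (isPullback_baseMap h₂))).nonempty_isColimit }

noncomputable def isInitialBase {X : PolyModel D} (h : IsInitial X) : IsInitial X.base :=
  isInitialOfHom initialIsInitial (baseMap (h.to (zero D (⊥_ B))))

instance sumClosed_glued (F : MorphismProperty B) [IsDisplayClass F] [SumClosed F]
    [F.IsStableUnderComposition] : SumClosed (glued (D := D) F) where
  of_isInitial {O X} hO f := by
    have hb := isInitialBase hO
    refine ⟨O, X.base, baseMap f, 𝟙 O, 𝟙 _, SumClosed.of_isInitial (isInitialOfHom hb O.map) _,
      SumClosed.of_isInitial hb _, ?_⟩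
    have := isPullback_of_isInitial hO hO f (toZero (𝟙 X.base)) (toZero (baseMap f))
    exact this.congr (hO.hom_ext _ _) rfl rfl rfl
  inl {X Y Z a b} h := ⟨zero D X.base, Z.base, (baseMap a :), _, _,
    SumClosed.of_isInitial initialIsInitial _, SumClosed.inl (isCoprod_baseMap h),
    (isCart_inl h).flip⟩
  of_inl_of_inr {X Y Z W a b} h f ha hb := by
    obtain ⟨T, m, hm, q, hT, hq, H⟩ := exists_isPullback_of_glued ha
    obtain ⟨T', m', hm', q', hT', hq', H'⟩ := exists_isPullback_of_glued hb
    have hba := isCoprod_baseMap h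
    have hf : F (baseMap f) := SumClosed.of_inl_of_inr hba _ (glued_baseMap ha) (glued_baseMap hb)
    -- The families in the normal forms of the two restrictions add up to a family `S` on `Z.base`.
    -- Its pullback with `W` is again a coproduct of `X` and `Y`, hence isomorphic to `Z`.
    obtain ⟨S, n, hn, c, c', hc, hc', K, -, -, hS⟩ := exists_isCoprod (X := ⟨_, _, m, hm⟩)
      (Y := ⟨_, _, m', hm'⟩) hba
    have := MorphismProperty.HasPullbacks.hasPullback (𝟙 W.base) hf
    obtain ⟨P, p, r, L, -⟩ := PolyModel.exists_isPullback (X := ⟨_, _, n, hn⟩) (Y := W)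
      (baseMap f :) (𝟙 W.base)
    let bf : Z.base ⟶ W.base := (baseMap f :)
    have e : ∀ {V : PolyModel D} (v : V ⟶ Z) {R : B} {l : R ⟶ V.base} (hl : D l)
        (s : V ⟶ { base := V.base, total := R, map := l, display := hl })
        (d : ({ base := V.base, total := R, map := l, display := hl } : PolyModel D) ⟶
          { base := Z.base, total := S, map := n, display := hn }),
        baseMap s = 𝟙 V.base → baseMap d = baseMap v → (s ≫ d) ≫
          toZero (X := { base := Z.base, total := S, map := n, display := hn }) (baseMap f :) =
          (v ≫ f) ≫ toZero (𝟙 W.base) := by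
      intro V v R l hl s d hs hd
      refine zero_hom_ext ?_
      change (baseMap s ≫ baseMap d) ≫ bf = (baseMap v ≫ baseMap f) ≫ 𝟙 W.base
      rw [hs, hd]
      exact (congrArg (· ≫ bf) (Category.id_comp (baseMap v))).trans
        (Category.comp_id (baseMap v ≫ baseMap f)).symm
    have hZ := K.of_isPullback_over
      (H.congr rfl rfl (zero_hom_ext (congrArg (· ≫ bf) hc.symm)) rfl)
      (H'.congr rfl rfl (zero_hom_ext (congrArg (· ≫ bf) hc'.symm)) rfl) L
      (a' := L.lift (q ≫ c) (a ≫ f) (e a hm q c hq hc))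
      (b' := L.lift (q' ≫ c') (b ≫ f) (e b hm' q' c' hq' hc'))
      (L.lift_fst _ _ _) (L.lift_snd _ _ _) (L.lift_fst _ _ _) (L.lift_snd _ _ _)
    let k := h.uniqueUpToIso hZ
    have hk : k.hom ≫ r = f := by
      apply h.hom_ext
      · exact (h.inl_desc_assoc _ _ r).trans (L.lift_snd _ _ _)
      · exact (h.inr_desc_assoc _ _ r).trans (L.lift_snd _ _ _)
    have M : IsPullback k.hom f r (𝟙 W) := IsPullback.of_horiz_isIso ⟨by rw [hk, Category.comp_id]⟩
    exact ⟨{ base := Z.base, total := S, map := n, display := hn }, W.base, (baseMap f :), k.hom ≫ p, 𝟙 _, hS F hT hT', hf,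
      (M.paste_horiz L).congr rfl rfl rfl (Category.id_comp _)⟩

end PolyModel

/-! ## The glued class of the polynomial model -/

namespace PolyModel

variable {B : Type u} [Category.{v} B] {D : MorphismProperty B} [IsDisplayClass D]

theorem baseMap_eq_of_isHomLift {X Y : PolyModel D} {f : X ⟶ Y} {h : X.base ⟶ Y.base}
    (H : (proj D).IsHomLift h f) : baseMap f = h :=
  (@IsHomLift.eq_of_isHomLift _ _ _ _ (proj D) _ _ h f H).symm

theorem isHomLift_baseMap {X Y : PolyModel D} {f : X ⟶ Y} {h : X.base ⟶ Y.base}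
    (H : baseMap f = h) : (proj D).IsHomLift h f := by
  subst H
  exact Functor.IsHomLift.map (p := proj D) f

variable [HasExtensiveSums B] [SumClosed D]

/-- Since maps into `(I, 0)` are maps of bases, the square in `IsCart` spells out the universal
property of a cartesian map. The next lemma uses this in the other direction. -/
theorem IsCart.isStronglyCartesian {X Y : PolyModel D} {f : X ⟶ Y} (hf : IsCart f) :
    (proj D).IsStronglyCartesian ((proj D).map f) f where
  universal_property' {W} g k hk := by
    have hb : baseMap k = g ≫ baseMap f := baseMap_eq_of_isHomLift hk
    have w : k ≫ toZero (𝟙 Y.base) = toZero (X := W) (I := X.base) g ≫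
        (toZero (baseMap f :) : zero D X.base ⟶ zero D Y.base) :=
      zero_hom_ext ((Category.comp_id _).trans hb)
    have h₁ := hf.lift_fst k (toZero g) w
    have h₂ := hf.lift_snd k (toZero g) w
    refine ⟨hf.lift k (toZero g) w, ⟨isHomLift_baseMap ?_, h₁⟩, fun m ⟨hm, hm'⟩ => ?_⟩
    · exact (Category.comp_id _).symm.trans (congrArg baseMap h₂)
    · refine hf.hom_ext (hm'.trans h₁.symm) (zero_hom_ext ?_)
      refine Eq.trans ?_ (congrArg baseMap h₂).symm
      exact (Category.comp_id _).trans (baseMap_eq_of_isHomLift hm)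

theorem isCart_of_isStronglyCartesian {X Y : PolyModel D} (f : X ⟶ Y)
    [(proj D).IsStronglyCartesian ((proj D).map f) f] : IsCart f := by
  refine isPullback_of_exists_lift (zero_hom_ext (by simp)) (fun {W} p q w => ?_)
    fun {W} m m' h₁ h₂ => ?_
  · have hb : baseMap p = baseMap q ≫ (baseMap f :) :=
      (Category.comp_id _).symm.trans
        (show baseMap (p ≫ toZero (𝟙 Y.base)) = baseMap (q ≫ toZero (baseMap f :)) by rw [w])
    obtain ⟨l, ⟨hl, hl'⟩, -⟩ := @Functor.IsStronglyCartesian.universal_property' _ _ _ _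
      (proj D) _ _ _ _ ((proj D).map f) f _ _ (baseMap q :) p (isHomLift_baseMap hb)
    exact ⟨l, hl', zero_hom_ext ((Category.comp_id _).trans (baseMap_eq_of_isHomLift hl))⟩
  · have hb : baseMap m = baseMap m' :=
      (Category.comp_id _).symm.trans ((congrArg baseMap h₂).trans (Category.comp_id _))
    exact @Functor.IsStronglyCartesian.ext _ _ _ _ (proj D) _ _ _ _ ((proj D).map f) f _ _ _
      (baseMap m') m m' (isHomLift_baseMap hb) (isHomLift_baseMap rfl) h₁

omit [HasExtensiveSums B] [SumClosed D] in
open Functor.Fiber in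
theorem base_fiberInclusion {I : B} (X : (proj D).Fiber I) :
    PolyModel.base (fiberInclusion.obj X) = I := X.2

omit [HasExtensiveSums B] [SumClosed D] in
open Functor.Fiber in
theorem baseMap_fiberInclusion {I : B} {X Y : (proj D).Fiber I} (f : X ⟶ Y) :
    baseMap (fiberInclusion.map f) ≫ eqToHom (base_fiberInclusion Y) =
      eqToHom (base_fiberInclusion X) := by
  refine (congrArg (· ≫ eqToHom (base_fiberInclusion Y))
    (IsHomLift.fac' (proj D) (𝟙 I) (fiberInclusion.map f))).trans ?_
  have : ∀ {P Q : B} (p : P = I) (q : Q = I),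
    (eqToHom p ≫ 𝟙 I ≫ eqToHom q.symm) ≫ eqToHom q = eqToHom p := fun p q => by simp
  exact this _ _

omit [HasExtensiveSums B] [SumClosed D] in
theorem isHomLift_of_baseMap {I : B} {X Y : PolyModel D} {f : X ⟶ Y} (hX : X.base = I)
    (hY : Y.base = I) (h : baseMap f ≫ eqToHom hY = eqToHom hX) :
    (proj D).IsHomLift (𝟙 I) f := by
  refine IsHomLift.of_fac' (p := proj D) _ _ hX hY ?_
  have : ∀ {P Q : B} (k : P ⟶ Q) (p : P = I) (q : Q = I), k ≫ eqToHom q = eqToHom p →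
      k = eqToHom p ≫ 𝟙 I ≫ eqToHom q.symm := by
    intro P Q k p q h
    subst q
    simpa using h
  exact this _ _ _ h

open Functor.Fiber in
theorem isLimit_binaryFan_of_isPullback {I : B} {X V W : (proj D).Fiber I} (v : X ⟶ V)
    (w : X ⟶ W)
    (H : IsPullback (fiberInclusion.map v) (fiberInclusion.map w)
      (toZero (eqToHom (base_fiberInclusion V))) (toZero (eqToHom (base_fiberInclusion W)))) :
    Nonempty (IsLimit (BinaryFan.mk v w)) := by
  have hw : ∀ {T : (proj D).Fiber I} (f : T ⟶ V) (g : T ⟶ W), fiberInclusion.map f ≫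
      toZero (eqToHom (base_fiberInclusion V)) =
        fiberInclusion.map g ≫ toZero (eqToHom (base_fiberInclusion W)) := fun f g =>
    zero_hom_ext ((baseMap_fiberInclusion f).trans (baseMap_fiberInclusion g).symm)
  have hl : ∀ {T : (proj D).Fiber I} (f : T ⟶ V) (g : T ⟶ W),
      (proj D).IsHomLift (𝟙 I) (H.lift _ _ (hw f g)) := fun {T} f g => by
    refine isHomLift_of_baseMap (base_fiberInclusion T) (base_fiberInclusion X) ?_
    refine (congrArg _ (baseMap_fiberInclusion v)).symm.trans
      (((Category.assoc _ _ _).symm.trans (congrArg (· ≫ _) ?_)).trans (baseMap_fiberInclusion f))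
    exact congrArg baseMap (H.lift_fst _ _ (hw f g))
  refine ⟨BinaryFan.isLimitMk (fun s => ⟨H.lift _ _ (hw s.fst s.snd), hl s.fst s.snd⟩)
    (fun s => ?_) (fun s => ?_) fun s m h₁ h₂ => ?_⟩
  · exact Functor.Fiber.hom_ext (H.lift_fst _ _ (hw s.fst s.snd))
  · exact Functor.Fiber.hom_ext (H.lift_snd _ _ (hw s.fst s.snd))
  · refine Functor.Fiber.hom_ext (H.hom_ext ?_ ?_)
    · exact (congrArg fiberInclusion.map h₁).trans (H.lift_fst _ _ (hw s.fst s.snd)).symm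
    · exact (congrArg fiberInclusion.map h₂).trans (H.lift_snd _ _ (hw s.fst s.snd)).symm

-- The sum of the families is a product in the fibre that is already known to be such a pullback,
-- and products are unique.
open Functor.Fiber in
theorem isPullback_of_isLimit_binaryFan {I : B} {X V W : (proj D).Fiber I} (v : X ⟶ V)
    (w : X ⟶ W) (h : IsLimit (BinaryFan.mk v w)) :
    IsPullback (fiberInclusion.map v) (fiberInclusion.map w)
      (toZero (eqToHom (base_fiberInclusion V))) (toZero (eqToHom (base_fiberInclusion W))) := by
  obtain ⟨⟨J, T, m, hm⟩, hV⟩ := V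
  obtain ⟨⟨J', T', m', hm'⟩, hW⟩ := W
  change J = I at hV
  change J' = I at hW
  subst hW
  subst hV
  have h' := IsCoprod.coprod T T'
  have w₁ := h'.inl_desc m m'
  have w₂ := h'.inr_desc m m'
  let P : PolyModel D := ⟨J, T ⨿ T', h'.desc m m', SumClosed.of_inl_of_inr h' _ (by rwa [w₁])
    (by rwa [w₂])⟩
  have H := isPullback_vert (Y := P) (hm := hm) (hm' := hm') w₁ w₂ h'
  let P' : (proj D).Fiber J := ⟨P, rfl⟩
  let p : P' ⟶ ⟨⟨J, T, m, hm⟩, rfl⟩ := ⟨vert (Y := P) _ m hm w₁, isHomLift_baseMap rfl⟩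
  let q : P' ⟶ ⟨⟨J, T', m', hm'⟩, rfl⟩ := ⟨vert (Y := P) _ m' hm' w₂, isHomLift_baseMap rfl⟩
  obtain ⟨hP⟩ := isLimit_binaryFan_of_isPullback p q H
  let e := h.conePointUniqueUpToIso hP
  have e₁ : e.hom ≫ p = v := h.conePointUniqueUpToIso_hom_comp hP ⟨WalkingPair.left⟩
  have e₂ : e.hom ≫ q = w := h.conePointUniqueUpToIso_hom_comp hP ⟨WalkingPair.right⟩
  have M : IsPullback (fiberInclusion.map e.hom) (fiberInclusion.map w) (fiberInclusion.map q)
      (𝟙 _) := IsPullback.of_horiz_isIso ⟨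
    ((fiberInclusion.map_comp _ _).symm.trans (congrArg fiberInclusion.map e₂)).trans
      (Category.comp_id _).symm⟩
  exact (M.paste_horiz H).congr
    ((fiberInclusion.map_comp _ _).symm.trans (congrArg fiberInclusion.map e₁)) rfl rfl (Category.id_comp _)

/-- A product projection in a fibre is a pullback of its complementary factor over `(I, 0)`, and a
cartesian map is a pullback of a map `(I, 0) ⟶ (J, 0)`; their composite is again glued. Conversely,
factor `f` through the reindexing of `Y`; the normal form exhibits the first factor as a product
projection. -/
theorem displayMaps_eq_glued [D.IsStableUnderComposition] : displayMaps D = glued D := by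
  ext X Y f
  constructor
  · rintro ⟨Z, v, c, rfl, ⟨W, g, ⟨h⟩⟩, hc, hD⟩
    have := isStableUnderComposition_glued (D := D) (F := D)
    refine (glued D).comp_mem _ _ ?_ ?_
    · have hi : D (eqToHom (base_fiberInclusion W)) := by
        have : ∀ {I J : B} (e : I = J), D (eqToHom e) := by
          rintro I J rfl
          exact D.id_mem _
        exact this _
      exact ⟨_, _, _, _, _, W.1.display, hi, (isPullback_of_isLimit_binaryFan _ _ h).flip⟩
    · exact ⟨_, _, _, _, _, (zero D _).display, hD, (isCart_of_isStronglyCartesian c).flip⟩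
  · intro hf
    obtain ⟨T, m, hm, q, hT, hq, H⟩ := exists_isPullback_of_glued hf
    have hc : IsCart (reindHom Y (baseMap f :)) := isCart_cartHom _ _ _
    let v : X ⟶ reind Y (baseMap f :) := hc.lift f (toZero (𝟙 X.base))
      (zero_hom_ext ((Category.comp_id (baseMap f)).trans (Category.id_comp (baseMap f)).symm))
    have h₁ : v ≫ reindHom Y (baseMap f :) = f := hc.lift_fst _ _ _
    have h₂ : v ≫ toZero (X := reind Y (baseMap f :)) (𝟙 X.base) = toZero (𝟙 X.base) :=
      hc.lift_snd _ _ _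
    have hv : baseMap v = 𝟙 X.base := (Category.comp_id (baseMap v)).symm.trans (congrArg baseMap h₂)
    refine ⟨⟨reind Y (baseMap f :), rfl⟩, ⟨v, isHomLift_baseMap hv⟩, reindHom Y (baseMap f :), h₁,
      ⟨⟨⟨X.base, T, m, hm⟩, rfl⟩, ⟨q, isHomLift_baseMap hq⟩, isLimit_binaryFan_of_isPullback _ _ ?_⟩,
      hc.isStronglyCartesian, glued_baseMap hf⟩
    exact IsPullback.of_right (h₂₂ := (toZero (baseMap f :) : zero D X.base ⟶ zero D Y.base))
      (H.flip.congr h₁.symm rfl rfl (zero_hom_ext (Category.id_comp (baseMap f)).symm)) (h₂.trans (zero_hom_ext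
        ((Category.comp_id (baseMap q)).trans hq).symm)) hc

end PolyModel

/-! ## Pi-types of the polynomial model -/

namespace PolyModel

variable {B : Type u} [Category.{v} B] {D : MorphismProperty B} [IsDisplayClass D]
  [HasExtensiveSums B] [SumClosed D]

/-- In a pullback over `(K, 0)` the families are sums. -/
theorem isCoprod_app (hroot : IsWellRooted D) {P X Y : PolyModel D} {K : B} {p : P ⟶ X} {q : P ⟶ Y}
    {x : X.base ⟶ K} {y : Y.base ⟶ K} (H : IsPullback p q (toZero x) (toZero y)) :
    IsCoprod (fam p) (fam q) := by
  have := hroot.hasTerminal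
  have hext : ∀ {L : B} {d : L ⟶ P.base} {hd : D d}
      {n n' : ({ base := P.base, total := L, map := d, display := hd } : PolyModel D) ⟶ P},
      n ≫ p = n' ≫ p → n ≫ q = n' ≫ q → n = n' := fun h₁ h₂ => H.hom_ext h₁ h₂
  have hid : ∀ {X : PolyModel D} (p : P ⟶ X), pullback.lift (pullback.fst X.map (baseMap p))
      (pullback.snd X.map (baseMap p)) pullback.condition = 𝟙 _ := fun p => by
    apply pullback.hom_ext <;> simp
  have hfam : ∀ {X : PolyModel D} (p : P ⟶ X), fam p = app p (pullback.snd X.map (baseMap p))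
      (pullback.fst X.map (baseMap p)) pullback.condition := by
    intro X p
    rw [app, hid, Category.id_comp]
  -- With `L = P.base × V`, maps from `(P.base, L)` to `X` over `baseMap p` are maps from the
  -- reindexed family of `X` to `V`. Testing the pullback `P` on these objects therefore yields the
  -- coproduct property of `P.total`.
  have hprod : ∀ V : B, ∃ (L : B) (d : L ⟶ P.base) (e : L ⟶ V), D d ∧
      IsPullback d e (terminal.from _) (terminal.from _) := by
    intro V
    have := MorphismProperty.HasPullbacks.hasPullback (terminal.from P.base)
      (hroot.toTerminal terminalIsTerminal (terminal.from V))
    have h := IsPullback.of_hasPullback (terminal.from V) (terminal.from P.base)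
    exact ⟨_, _, _, D.pullback_snd _ _ (hroot.toTerminal terminalIsTerminal _), h.flip⟩
  refine IsCoprod.of_unique (fun {V} f g => ?_) fun {V} f g h₁ h₂ => ?_
  · obtain ⟨L, d, e, hd, hL⟩ := hprod V
    let M : PolyModel D := ⟨P.base, L, d, hd⟩
    let n : ∀ {X : PolyModel D} (p : P ⟶ X) (f : pullback X.map (baseMap p) ⟶ V), M ⟶ X :=
      fun p f => Hom.mk (X := M) (baseMap p :) (hL.lift (pullback.snd _ _) f
        (terminal.hom_ext _ _)) (hL.lift_fst _ _ _)
    have w : n p f ≫ toZero x = n q g ≫ toZero y :=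
      zero_hom_ext (show baseMap (p ≫ toZero x) = baseMap (q ≫ toZero y) by rw [H.w])
    let l : M ⟶ P := H.lift _ _ w
    have h₁ : l ≫ p = n p f := H.lift_fst _ _ w
    have h₂ : l ≫ q = n q g := H.lift_snd _ _ w
    have hl : baseMap l = 𝟙 P.base := (isPullback_baseMap H).hom_ext
      ((congrArg baseMap h₁).trans (Category.id_comp (baseMap p)).symm)
      ((congrArg baseMap h₂).trans (Category.id_comp (baseMap q)).symm)
    have w' : 𝟙 P.total ≫ P.map = P.map ≫ (baseMap l :) := by
      rw [hl]
      exact (Category.id_comp P.map).trans (Category.comp_id P.map).symm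
    have key : ∀ {X : PolyModel D} (p : P ⟶ X) (f : pullback X.map (baseMap p) ⟶ V),
        l ≫ p = n p f → fam p ≫ app l P.map (𝟙 _) w' ≫ e = f := by
      intro X p f h
      let s := pullback.snd X.map (baseMap p)
      have hs : s = s ≫ (baseMap l :) := by rw [hl]; exact (Category.comp_id s).symm
      have h₁ : fam p ≫ app l P.map (𝟙 _) w' =
          app (n p f) s (pullback.fst X.map (baseMap p)) pullback.condition := by
        rw [comp_app]
        refine Eq.trans ?_ (app_congr h rfl rfl (by
          rw [pullback.condition]
          exact ((congrArg (· ≫ baseMap p) hs).trans (Category.assoc _ _ _))))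
        rw [app_comp]
        have h₃ : fam p ≫ 𝟙 P.total = app p (s ≫ (baseMap l :)) (pullback.fst X.map (baseMap p))
            (by rw [← hs]; exact pullback.condition) :=
          (Category.comp_id (fam p)).trans ((hfam p).trans (app_congr rfl hs rfl _))
        exact app_congr (rfl : l = l) (show fam p ≫ P.map = s from fam_map p) h₃ _
      rw [reassoc_of% h₁]
      have h₂ : app (n p f) s (pullback.fst X.map (baseMap p)) pullback.condition ≫ e =
        pullback.lift (pullback.fst X.map (baseMap p)) s pullback.condition ≫ f :=
          (Category.assoc _ _ _).trans (congrArg _ (hL.lift_snd _ _ _))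
      rw [h₂, hid, Category.id_comp]
    exact ⟨app l P.map (𝟙 _) w' ≫ e, key p f h₁, key q g h₂⟩
  · obtain ⟨L, d, e, hd, hL⟩ := hprod V
    let M : PolyModel D := ⟨P.base, L, d, hd⟩
    let n : (P.total ⟶ V) → (M ⟶ P) := fun f => Hom.mk (X := M) (𝟙 P.base)
      (hL.lift (pullback.snd _ _) (pullback.fst _ _ ≫ f) (terminal.hom_ext _ _)) (hL.lift_fst _ _ _)
    have hn : ∀ (f : P.total ⟶ V) {T : B} (t : T ⟶ P.base) (z : T ⟶ P.total)
        (w : z ≫ P.map = t ≫ 𝟙 P.base), app (n f) t z w ≫ e = z ≫ f := by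
      intro f T t z w
      refine (Category.assoc _ _ _).trans ((congrArg _ (hL.lift_snd _ _ _)).trans ?_)
      exact pullback.lift_fst_assoc _ _ _ _
    have key : ∀ {X : PolyModel D} (p : P ⟶ X), fam p ≫ f = fam p ≫ g → n f ≫ p = n g ≫ p := by
      intro X p h
      refine hom_ext rfl fun t z w => ?_
      rw [app_comp, app_comp]
      refine hL.hom_ext ?_ ?_
      · exact (app_map _ _ _ _).trans (app_map _ _ _ _).symm
      · refine (hn _ _ _ _).trans (Eq.trans ?_ (hn _ _ _ _).symm)
        exact (Category.assoc _ _ _).trans ((congrArg _ h).trans (Category.assoc _ _ _).symm)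
    have h := hext (key p h₁) (key q h₂)
    have w' : 𝟙 P.total ≫ P.map = P.map ≫ 𝟙 P.base := by simp
    have := congrArg (· ≫ e) (app_congr h (rfl : P.map = P.map) (rfl : 𝟙 P.total = 𝟙 P.total) w')
    have := ((hn f _ _ w').symm.trans this).trans (hn g _ _ w')
    rwa [Category.id_comp, Category.id_comp] at this

/-- Maps that classify the two summands of the families in a pullback over `(K, 0)`. -/
theorem exists_classifier (hroot : IsWellRooted D) {P X Y : PolyModel D} {K : B} {p : P ⟶ X}
    {q : P ⟶ Y} {x : X.base ⟶ K} {y : Y.base ⟶ K} (H : IsPullback p q (toZero x) (toZero y))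
    {O : B} {a : Y.base ⟶ O} {b : Y.total ⟶ O} (hO : IsCoprod a b) {o : O ⟶ Y.base}
    (ha : a ≫ o = 𝟙 _) (hb : b ≫ o = Y.map) :
    ∃ χ : P.total ⟶ O, χ ≫ o = P.map ≫ baseMap q ∧
      (∀ {T : B} (t : T ⟶ P.base) (z : T ⟶ X.total) (w : z ≫ X.map = t ≫ baseMap p),
        app p t z w ≫ χ = t ≫ baseMap q ≫ a) ∧
      (∀ {T : B} (t : T ⟶ P.base) (z : T ⟶ Y.total) (w : z ≫ Y.map = t ≫ baseMap q),
        app q t z w ≫ χ = z ≫ b) ∧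
      (∀ {T : B} (τ : T ⟶ P.total) (i : T ⟶ Y.base), τ ≫ χ = i ≫ a →
        ∃ (z : T ⟶ X.total) (w : z ≫ X.map = (τ ≫ P.map) ≫ baseMap p),
          app p (τ ≫ P.map) z w = τ) ∧
      (∀ {T : B} (τ : T ⟶ P.total) (z : T ⟶ Y.total), τ ≫ χ = z ≫ b →
        ∃ w : z ≫ Y.map = (τ ≫ P.map) ≫ baseMap q, app q (τ ≫ P.map) z w = τ) ∧
      ∀ {T : B} (t : T ⟶ P.base) (z z' : T ⟶ X.total) (w : z ≫ X.map = t ≫ baseMap p)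
        (w' : z' ≫ X.map = t ≫ baseMap p), app p t z w = app p t z' w' → z = z' := by
  have hA := isCoprod_app hroot H
  have hX := hA.inl_desc (pullback.snd X.map (baseMap p) ≫ baseMap q ≫ a)
    (pullback.fst Y.map (baseMap q) ≫ b)
  have hY := hA.inr_desc (pullback.snd X.map (baseMap p) ≫ baseMap q ≫ a)
    (pullback.fst Y.map (baseMap q) ≫ b)
  -- By extensivity the map of coproducts `χ` pulls the summands of `O` back to those of `P.total`,
  -- so an element of `P.total` lies in the summand that `χ` indicates.
  obtain ⟨H₁, H₂⟩ := hO.isPullback hA (f := pullback.snd X.map (baseMap p) ≫ baseMap q)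
    (by rw [hX, Category.assoc]) hY
  have hmono := hA.mono_inl
  refine ⟨hA.desc (pullback.snd X.map (baseMap p) ≫ baseMap q ≫ a)
    (pullback.fst Y.map (baseMap q) ≫ b), ?_, fun t z w => ?_, fun t z w => ?_, fun τ i h => ?_,
    fun τ z h => ?_, fun t z z' w w' h => ?_⟩
  · apply hA.hom_ext
    · rw [reassoc_of% hX, ha, fam_map_assoc, Category.comp_id]
    · rw [reassoc_of% hY, hb, fam_map_assoc, pullback.condition]
  · rw [app, Category.assoc, hX, pullback.lift_snd_assoc]
  · rw [app, Category.assoc, hY, pullback.lift_fst_assoc]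
  · obtain ⟨l, l₁, l₂⟩ : ∃ l, l ≫ fam p = τ ∧ l ≫ pullback.snd X.map (baseMap p) ≫ baseMap q = i :=
      ⟨_, H₁.lift_fst τ i h, H₁.lift_snd τ i h⟩
    subst l₁
    refine ⟨l ≫ pullback.fst _ _, ?_, ?_⟩
    · rw [Category.assoc, Category.assoc, Category.assoc, fam_map_assoc, pullback.condition]
    · rw [app]
      congr 1
      apply pullback.hom_ext
      · rw [pullback.lift_fst]
      · rw [pullback.lift_snd, Category.assoc, fam_map]
  · obtain ⟨l, l₁, l₂⟩ : ∃ l, l ≫ fam q = τ ∧ l ≫ pullback.fst Y.map (baseMap q) = z :=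
      ⟨_, H₂.lift_fst τ z h, H₂.lift_snd τ z h⟩
    subst l₁
    refine ⟨?_, ?_⟩
    · rw [Category.assoc, Category.assoc, fam_map_assoc, ← pullback.condition, reassoc_of% l₂]
    rw [app]
    congr 1
    apply pullback.hom_ext
    · rw [pullback.lift_fst, l₂]
    · rw [pullback.lift_snd, Category.assoc, fam_map]
  · have e := congrArg (· ≫ pullback.fst _ _) ((cancel_mono (fam p)).1 h)
    exact (pullback.lift_fst _ _ _).symm.trans (e.trans (pullback.lift_fst _ _ _))

end PolyModel

/-! ### The universal property of dependent products over `(J, 0)`. -/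

namespace PolyModel

variable {B : Type u} [Category.{v} B] {D : MorphismProperty B} [IsDisplayClass D]
  [HasExtensiveSums B] [SumClosed D]

/-- A criterion for a map of `Poly` to be the evaluation map of a dependent product of families. -/
theorem isPi_toZero (hroot : IsWellRooted D) {Y C : PolyModel D} {J : B} {j : Y.base ⟶ J}
    {k : C.base ⟶ Y.base} {O : B} {o : O ⟶ Y.base} {a : Y.base ⟶ O} {b : Y.total ⟶ O}
    (hO : IsCoprod a b) (ha : a ≫ o = 𝟙 _) (hb : b ≫ o = Y.map)
    {S ES : B} {σ : S ⟶ C.base} {s₁ : ES ⟶ S} {s₂ : ES ⟶ C.total} {sε : ES ⟶ O}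
    (hS : IsPi C.map (C.map ≫ k) o σ s₁ s₂ sε) {R E : PolyModel D} {ρ : R.base ⟶ J} {e₁ : E ⟶ R}
    {e₂ : E ⟶ Y} (hE : IsPullback e₁ e₂ (toZero ρ) (toZero j)) {rε : E.base ⟶ S}
    (hR : IsPi j (𝟙 _) (σ ≫ k) ρ (baseMap e₁) (baseMap e₂) rε)
    {Q N : B} {qn : Q ⟶ C.total} {qr : Q ⟶ E.base} (hQ : IsPullback qn qr C.map (rε ≫ σ))
    {θ : Q ⟶ ES} (hθ₁ : θ ≫ s₁ = qr ≫ rε) (hθ₂ : θ ≫ s₂ = qn) {ev : Q ⟶ O}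
    (hev : θ ≫ sε = ev) {ν : R.total ⟶ Q}
    {νi : R.total ⟶ Y.base} {ν' : N ⟶ Q} {νp : N ⟶ Y.total} (hν : IsPullback ν νi ev a)
    (hν' : IsPullback ν' νp ev b) (hνν' : IsCoprod ν ν')
    (hRm : ν ≫ qr ≫ baseMap e₁ = R.map) {ε : E ⟶ C} (hε : baseMap ε = rε ≫ σ)
    (hε₁ : ∀ {T : B} (z : T ⟶ R.total) (w : (z ≫ ν ≫ qn) ≫ C.map = (z ≫ ν ≫ qr) ≫ baseMap ε)
      (w' : z ≫ R.map = (z ≫ ν ≫ qr) ≫ baseMap e₁),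
      app ε (z ≫ ν ≫ qr) (z ≫ ν ≫ qn) w = app e₁ (z ≫ ν ≫ qr) z w')
    (hε₂ : ∀ {T : B} (z : T ⟶ N) (w : (z ≫ ν' ≫ qn) ≫ C.map = (z ≫ ν' ≫ qr) ≫ baseMap ε)
      (w' : (z ≫ νp) ≫ Y.map = (z ≫ ν' ≫ qr) ≫ baseMap e₂),
      app ε (z ≫ ν' ≫ qr) (z ≫ ν' ≫ qn) w = app e₂ (z ≫ ν' ≫ qr) (z ≫ νp) w') :
    IsPi (toZero j) (toZero (𝟙 Y.base)) (toZero k) (toZero ρ) e₁ e₂ ε := by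
  -- Fibrewise, `O` is `1 + Y_y`; `S` consists of `c` with a function `C_c ⟶ 1 + Y_y`; `R.base`
  -- consists of sections of `S` over `Y_j`. `Q` consists of triples `(r, y, n)` with `n` in the
  -- family of `r(y)`, and `ev` is the value at `n`. `R.total` and `N` are the parts of `Q` with
  -- value in `1` and in `Y_y`.
  have hrk : rε ≫ σ ≫ k = baseMap e₂ := hR.w.trans (Category.comp_id _)
  have hεo : ev ≫ o = qr ≫ baseMap e₂ := by
    rw [← hev, Category.assoc, hS.w, reassoc_of% hθ₂, reassoc_of% hQ.w, hrk]
  have hνi : νi = ν ≫ qr ≫ baseMap e₂ := by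
    rw [← hεo, reassoc_of% hν.w, ha, Category.comp_id]
  have hνp : νp ≫ Y.map = ν' ≫ qr ≫ baseMap e₂ := by
    rw [← hεo, reassoc_of% hν'.w, hb]
  -- Where `ev` is in `1`, the composite `t ≫ ε` acts through `r`; where it is in `Y_y`, it acts
  -- through `p₂` (`key₂`).
  have key₁ : ∀ {W P : PolyModel D} {p₁ : P ⟶ W} {r : W ⟶ R} {t : P ⟶ E}, t ≫ e₁ = p₁ ≫ r →
      ∀ {T : B} (t₀ : T ⟶ P.base) (z : T ⟶ R.total) (_ : z ≫ ν ≫ qr = t₀ ≫ baseMap t)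
      (w : (z ≫ ν ≫ qn) ≫ C.map = t₀ ≫ baseMap (t ≫ ε))
      (w' : z ≫ R.map = (t₀ ≫ baseMap p₁) ≫ baseMap r),
      app (t ≫ ε) t₀ (z ≫ ν ≫ qn) w = app p₁ t₀ (app r (t₀ ≫ baseMap p₁) z w') (app_map _ _ _ _) := by
    intro W P p₁ r t h T t₀ z hz w w'
    have w₁ : (z ≫ ν ≫ qn) ≫ C.map = (z ≫ ν ≫ qr) ≫ baseMap ε := by
      rw [hz, w, baseMap_comp, Category.assoc]
    have w₂ : z ≫ R.map = (z ≫ ν ≫ qr) ≫ baseMap e₁ := by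
      rw [← hRm, Category.assoc, Category.assoc]
    have w₃ : z ≫ R.map = t₀ ≫ baseMap (t ≫ e₁) := by rw [h, w', baseMap_comp, Category.assoc]
    rw [app_comp]
    refine (app_congr rfl rfl ((app_congr rfl hz.symm rfl _).trans ((hε₁ z w₁ w₂).trans
      (app_congr rfl hz rfl _))) _).trans ((app_comp t e₁ t₀ z w₃).symm.trans ?_)
    exact (app_congr h rfl rfl _).trans (app_comp _ _ _ _ _)
  have key₂ : ∀ {P : PolyModel D} {t : P ⟶ E} {p₂ : P ⟶ Y}, t ≫ e₂ = p₂ →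
      ∀ {T : B} (t₀ : T ⟶ P.base) (z : T ⟶ N) (_ : z ≫ ν' ≫ qr = t₀ ≫ baseMap t)
      (w : (z ≫ ν' ≫ qn) ≫ C.map = t₀ ≫ baseMap (t ≫ ε))
      (w' : (z ≫ νp) ≫ Y.map = t₀ ≫ baseMap p₂),
      app (t ≫ ε) t₀ (z ≫ ν' ≫ qn) w = app p₂ t₀ (z ≫ νp) w' := by
    intro P t p₂ h T t₀ z hz w w'
    subst h
    have w₁ : (z ≫ ν' ≫ qn) ≫ C.map = (z ≫ ν' ≫ qr) ≫ baseMap ε := by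
      rw [hz, w, baseMap_comp, Category.assoc]
    have w₂ : (z ≫ νp) ≫ Y.map = (z ≫ ν' ≫ qr) ≫ baseMap e₂ := by
      rw [hz, w', baseMap_comp, Category.assoc]
    rw [app_comp]
    exact (app_congr rfl rfl ((app_congr rfl hz.symm rfl _).trans ((hε₂ z w₁ w₂).trans
      (app_congr rfl hz rfl _))) _).trans (app_comp t e₂ t₀ (z ≫ νp) w').symm
  refine ⟨hE, zero_hom_ext ?_, ?_, ?_⟩
  · change baseMap ε ≫ k = baseMap e₂ ≫ 𝟙 _
    rw [hε, Category.assoc, hrk, Category.comp_id]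
  · intro W P w p₁ p₂ hP s hs
    have hP' : IsPullback p₁ p₂ (toZero (baseMap w :)) (toZero j) :=
      hP.congr rfl rfl (zero_hom_ext rfl) rfl
    obtain ⟨χ, c₀, -, -, c₃, c₄, -⟩ := exists_classifier hroot hP' hO ha hb
    have hPb : IsPullback (baseMap p₁) (baseMap p₂) (baseMap w) j := isPullback_baseMap hP'
    have hbs : baseMap s ≫ k = baseMap p₂ := (congrArg baseMap hs).trans (Category.comp_id _)
    -- The base of `s` chooses `c`, and its family followed by `χ` is the function `C_c ⟶ 1 + Y_y`.
    -- Transposing twice gives the base of `r`.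
    obtain ⟨s', tS, a₁, a₂, a₃, a₄⟩ := hS.exists_lift (baseMap s) _ _
      (IsPullback.of_hasPullback C.map (baseMap s)).flip (fam s ≫ χ) (by
        rw [Category.assoc, c₀, fam_map_assoc, ← hbs, pullback.condition_assoc])
    obtain ⟨r₀, tR, b₁, b₂, b₃, b₄⟩ := hR.exists_lift _ _ _ hPb s' (by
      rw [reassoc_of% a₁, hbs, Category.comp_id])
    have hχ : ∀ {T : B} (t₀ : T ⟶ P.base) (l : T ⟶ Q) (_ : l ≫ qr = t₀ ≫ tR)
        (w : (l ≫ qn) ≫ C.map = t₀ ≫ baseMap s), app s t₀ (l ≫ qn) w ≫ χ = l ≫ ev := by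
      intro T t₀ l hl w
      have e : pullback.lift (l ≫ qn) t₀ w ≫ tS = l ≫ θ := by
        apply hS.isPullback.hom_ext
        · rw [Category.assoc, a₂, pullback.lift_snd_assoc, Category.assoc, hθ₁, reassoc_of% hl, b₄]
        · rw [Category.assoc, a₃, pullback.lift_fst, Category.assoc, hθ₂]
      rw [app, Category.assoc, ← a₄, reassoc_of% e, hev]
    let U := pullback R.map r₀
    let zU : U ⟶ R.total := pullback.fst R.map r₀
    let xU : U ⟶ W.base := pullback.snd R.map r₀
    have hU : zU ≫ R.map = xU ≫ r₀ := pullback.condition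
    have hR₁ := hR.isPullback.w
    have wU : xU ≫ baseMap w = (zU ≫ ν ≫ qr ≫ baseMap e₂) ≫ j := by
      rw [← b₁, ← reassoc_of% hU, ← hRm]
      simp only [Category.assoc, hR₁]
    let tU := hPb.lift xU _ wU
    have tU₁ : tU ≫ baseMap p₁ = xU := hPb.lift_fst _ _ wU
    have tU₂ : tU ≫ baseMap p₂ = zU ≫ ν ≫ qr ≫ baseMap e₂ := hPb.lift_snd _ _ wU
    have tU₃ : (zU ≫ ν) ≫ qr = tU ≫ tR := by
      apply hR.isPullback.hom_ext
      · simp only [Category.assoc, b₂, reassoc_of% tU₁, hRm, hU]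
      · simp only [Category.assoc, b₃, tU₂]
    have wU' : ((zU ≫ ν) ≫ qn) ≫ C.map = tU ≫ baseMap s := by
      rw [Category.assoc, hQ.w, ← Category.assoc, tU₃, Category.assoc, reassoc_of% b₄, a₁]
    -- On `R.total` the value is in `1`, so `s` lands in the `W`-summand; the element found there is
    -- the family of `r`.
    obtain ⟨φ, wφ, hφ⟩ := c₃ (app s tU _ wU') (zU ≫ νi) (by
      rw [hχ _ _ tU₃, Category.assoc, hν.w, Category.assoc])
    have hφ' : φ ≫ W.map = xU := by rw [wφ, app_map, tU₁]
    let r : W ⟶ R := Hom.mk r₀ φ hφ'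
    have hr : ∀ {T : B} (t₀ : T ⟶ P.base) (z : T ⟶ R.total) (_ : z ≫ ν ≫ qr = t₀ ≫ tR)
        (w : (z ≫ ν ≫ qn) ≫ C.map = t₀ ≫ baseMap s)
        (w' : z ≫ R.map = (t₀ ≫ baseMap p₁) ≫ baseMap r),
        app p₁ t₀ (app r (t₀ ≫ baseMap p₁) z w') (app_map _ _ _ _) =
          app s t₀ (z ≫ ν ≫ qn) w := by
      intro T t₀ z hz w w'
      let l : T ⟶ U := pullback.lift z (t₀ ≫ baseMap p₁) w'
      have l₁ : l ≫ zU = z := pullback.lift_fst _ _ _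
      have l₂ : l ≫ xU = t₀ ≫ baseMap p₁ := pullback.lift_snd _ _ _
      have l₃ : l ≫ tU = t₀ := by
        apply hPb.hom_ext
        · rw [Category.assoc, tU₁, l₂]
        · rw [Category.assoc, tU₂, reassoc_of% l₁, ← b₃, reassoc_of% hz]
      have e := congrArg (l ≫ ·) hφ
      simp only [comp_app] at e
      refine Eq.trans ?_ (e.trans (app_congr rfl l₃ (by simp only [Category.assoc, reassoc_of% l₁]) _))
      refine app_congr rfl ?_ rfl _
      rw [app_map, l₃]
    have w' : (p₁ ≫ r) ≫ toZero ρ = p₂ ≫ toZero j := zero_hom_ext (by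
      change (baseMap p₁ ≫ r₀) ≫ ρ = baseMap p₂ ≫ j
      rw [Category.assoc, b₁, hPb.w])
    let t := hE.lift _ _ w'
    have t₁ : t ≫ e₁ = p₁ ≫ r := hE.lift_fst _ _ w'
    have t₂ : t ≫ e₂ = p₂ := hE.lift_snd _ _ w'
    have ht : baseMap t = tR := by
      apply hR.isPullback.hom_ext
      · exact (congrArg baseMap t₁).trans b₂.symm
      · exact (congrArg baseMap t₂).trans b₃.symm
    have hts : baseMap (t ≫ ε) = baseMap s := by
      rw [baseMap_comp, ht, hε, reassoc_of% b₄, a₁]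
    refine ⟨r, t, zero_hom_ext b₁, t₁, t₂, hom_ext hts fun {T} t₀ y wy => ?_⟩
    have wy' : y ≫ C.map = (t₀ ≫ baseMap t) ≫ rε ≫ σ := by
      rw [wy, baseMap_comp, hε, Category.assoc]
    let l := hQ.lift y _ wy'
    have l₁ : l ≫ qn = y := hQ.lift_fst _ _ wy'
    have l₂ : l ≫ qr = t₀ ≫ baseMap t := hQ.lift_snd _ _ wy'
    obtain ⟨T₁, T₂, i₁, i₂, z₁, z₂, H₁, H₂, H⟩ := hνν'.exists_split D l
    have wt : baseMap t ≫ baseMap e₁ = baseMap p₁ ≫ baseMap r := congrArg baseMap t₁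
    refine H.hom_ext ?_ ?_
    · have f₁ : i₁ ≫ y = z₁ ≫ ν ≫ qn := by rw [← l₁, reassoc_of% H₁.w]
      have f₂ : z₁ ≫ ν ≫ qr = (i₁ ≫ t₀) ≫ baseMap t := by
        rw [← reassoc_of% H₁.w, l₂, Category.assoc]
      have f₃ : (z₁ ≫ ν ≫ qn) ≫ C.map = (i₁ ≫ t₀) ≫ baseMap (t ≫ ε) := by
        rw [← f₁, Category.assoc, wy, Category.assoc]
      have f₄ : z₁ ≫ R.map = ((i₁ ≫ t₀) ≫ baseMap p₁) ≫ baseMap r := by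
        simp only [Category.assoc, ← wt, ← hRm, reassoc_of% f₂]
      rw [comp_app, comp_app]
      exact (app_congr rfl rfl f₁ _).trans ((key₁ t₁ _ z₁ f₂ f₃ f₄).trans
        ((hr _ z₁ (by rw [f₂, ht]) (by rw [f₃, hts]) f₄).trans (app_congr rfl rfl f₁.symm _)))
    · have f₁ : i₂ ≫ y = z₂ ≫ ν' ≫ qn := by rw [← l₁, reassoc_of% H₂.w]
      have f₂ : z₂ ≫ ν' ≫ qr = (i₂ ≫ t₀) ≫ baseMap t := by
        rw [← reassoc_of% H₂.w, l₂, Category.assoc]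
      have f₃ : (z₂ ≫ ν' ≫ qn) ≫ C.map = (i₂ ≫ t₀) ≫ baseMap (t ≫ ε) := by
        rw [← f₁, Category.assoc, wy, Category.assoc]
      have f₄ : ((z₂ ≫ ν') ≫ qn) ≫ C.map = (i₂ ≫ t₀) ≫ baseMap s := by
        rw [← hts, ← f₃, Category.assoc z₂]
      obtain ⟨f₅, f₆⟩ := c₄ (app s (i₂ ≫ t₀) ((z₂ ≫ ν') ≫ qn) f₄) (z₂ ≫ νp) (by
        rw [hχ _ _ (by rw [Category.assoc, f₂, ht]), Category.assoc, hν'.w, Category.assoc])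
      rw [comp_app, comp_app]
      refine (app_congr rfl rfl f₁ _).trans ((key₂ t₂ _ z₂ f₂ f₃ (by rw [f₅, app_map])).trans ?_)
      refine (app_congr rfl (app_map _ _ _ _).symm rfl _).trans (f₆.trans ?_)
      exact app_congr rfl rfl ((Category.assoc _ _ _).trans f₁.symm) _
  · intro W P w p₁ p₂ hP r r' t t' hr hr' h₁ h₁' h₂ h₂' h₃
    have hP' : IsPullback p₁ p₂ (toZero (baseMap w :)) (toZero j) :=
      hP.congr rfl rfl (zero_hom_ext rfl) rfl
    obtain ⟨χ, -, c₁, c₂, -, -, c₅⟩ := exists_classifier hroot hP' hO ha hb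
    have hPb : IsPullback (baseMap p₁) (baseMap p₂) (baseMap w) j := isPullback_baseMap hP'
    -- The classifier recovers `ev` from `t ≫ ε`, so this composite determines the base of `r`.
    have key₃ : ∀ {r : W ⟶ R} {t : P ⟶ E}, t ≫ e₁ = p₁ ≫ r → t ≫ e₂ = p₂ →
        ∀ {T : B} (t₀ : T ⟶ P.base) (l : T ⟶ Q) (_ : l ≫ qr = t₀ ≫ baseMap t)
        (w : (l ≫ qn) ≫ C.map = t₀ ≫ baseMap (t ≫ ε)),
        app (t ≫ ε) t₀ (l ≫ qn) w ≫ χ = l ≫ ev := by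
      intro r t h₁ h₂ T t₀ l hl w
      have hb₁ : baseMap t ≫ baseMap e₁ = baseMap p₁ ≫ baseMap r := congrArg baseMap h₁
      have hb₂ : baseMap t ≫ baseMap e₂ = baseMap p₂ := congrArg baseMap h₂
      obtain ⟨T₁, T₂, i₁, i₂, z₁, z₂, H₁, H₂, H⟩ := hνν'.exists_split D l
      refine H.hom_ext ?_ ?_
      · have f₁ : i₁ ≫ l ≫ qn = z₁ ≫ ν ≫ qn := by rw [reassoc_of% H₁.w]
        have f₂ : z₁ ≫ ν ≫ qr = (i₁ ≫ t₀) ≫ baseMap t := by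
          rw [← reassoc_of% H₁.w, hl, Category.assoc]
        have f₃ : (z₁ ≫ ν ≫ qn) ≫ C.map = (i₁ ≫ t₀) ≫ baseMap (t ≫ ε) := by
          rw [← f₁, Category.assoc, w, Category.assoc]
        have f₄ : z₁ ≫ R.map = ((i₁ ≫ t₀) ≫ baseMap p₁) ≫ baseMap r := by
          simp only [Category.assoc, ← hb₁, ← hRm, reassoc_of% f₂]
        rw [← Category.assoc, comp_app]
        refine (congrArg (· ≫ χ) ((app_congr rfl rfl f₁ _).trans
          (key₁ h₁ _ z₁ f₂ f₃ f₄))).trans ((c₁ _ _ _).trans ?_)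
        rw [reassoc_of% H₁.w, hν.w, hνi, ← hb₂]
        simp only [Category.assoc]
        simp only [Category.assoc] at f₂
        rw [reassoc_of% f₂]
      · have f₁ : i₂ ≫ l ≫ qn = z₂ ≫ ν' ≫ qn := by rw [reassoc_of% H₂.w]
        have f₂ : z₂ ≫ ν' ≫ qr = (i₂ ≫ t₀) ≫ baseMap t := by
          rw [← reassoc_of% H₂.w, hl, Category.assoc]
        have f₃ : (z₂ ≫ ν' ≫ qn) ≫ C.map = (i₂ ≫ t₀) ≫ baseMap (t ≫ ε) := by
          rw [← f₁, Category.assoc, w, Category.assoc]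
        have f₄ : (z₂ ≫ νp) ≫ Y.map = (i₂ ≫ t₀) ≫ baseMap p₂ := by
          simp only [Category.assoc, hνp, reassoc_of% f₂, hb₂]
        rw [← Category.assoc, comp_app]
        refine (congrArg (· ≫ χ) ((app_congr rfl rfl f₁ _).trans
          (key₂ h₂ _ z₂ f₂ f₃ f₄))).trans ((c₂ _ _ _).trans ?_)
        rw [reassoc_of% H₂.w, hν'.w, Category.assoc]
    have hb₁ : baseMap t ≫ baseMap e₁ = baseMap p₁ ≫ baseMap r := congrArg baseMap h₁
    have hb₂ : baseMap t ≫ baseMap e₂ = baseMap p₂ := congrArg baseMap h₂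
    have hb₁' : baseMap t' ≫ baseMap e₁ = baseMap p₁ ≫ baseMap r' := congrArg baseMap h₁'
    have hb₂' : baseMap t' ≫ baseMap e₂ = baseMap p₂ := congrArg baseMap h₂'
    have hbr : baseMap r ≫ ρ = baseMap w := congrArg baseMap hr
    have hbr' : baseMap r' ≫ ρ = baseMap w := congrArg baseMap hr'
    have hbs : ∀ t : P ⟶ E, (baseMap t ≫ rε) ≫ σ = baseMap (t ≫ ε) := fun t => by
      rw [baseMap_comp, hε, Category.assoc]
    have hrr : baseMap r = baseMap r' := by
      refine hR.hom_ext _ _ _ hPb _ _ (baseMap t) (baseMap t') hbr hbr' hb₁ hb₁' hb₂ hb₂' ?_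
      have hl : ∀ t : P ⟶ E, t ≫ ε = t' ≫ ε → ∃ l : pullback C.map (baseMap (t' ≫ ε)) ⟶ Q,
          l ≫ qn = pullback.fst C.map (baseMap (t' ≫ ε)) ∧
          l ≫ qr = pullback.snd C.map (baseMap (t' ≫ ε)) ≫ baseMap t := by
        intro t h
        have e : pullback.fst C.map (baseMap (t' ≫ ε)) ≫ C.map =
            (pullback.snd C.map (baseMap (t' ≫ ε)) ≫ baseMap t) ≫ rε ≫ σ := by
          rw [pullback.condition, Category.assoc, ← Category.assoc (baseMap t), hbs, h]
        exact ⟨_, hQ.lift_fst _ _ e, hQ.lift_snd _ _ e⟩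
      obtain ⟨l, l₁, l₂⟩ := hl t h₃
      obtain ⟨l', l₁', l₂'⟩ := hl t' rfl
      refine hS.hom_ext (baseMap (t' ≫ ε)) _ _ (IsPullback.of_hasPullback C.map _).flip _ _ (l ≫ θ)
        (l' ≫ θ) ((hbs t).trans (congrArg baseMap h₃)) (hbs t') ?_ ?_ ?_ ?_ ?_
      · rw [Category.assoc, hθ₁, reassoc_of% l₂]
      · rw [Category.assoc, hθ₁, reassoc_of% l₂']
      · rw [Category.assoc, hθ₂, l₁]
      · rw [Category.assoc, hθ₂, l₁']
      · rw [Category.assoc, Category.assoc, hev]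
        have w' : (l' ≫ qn) ≫ C.map = pullback.snd C.map (baseMap (t' ≫ ε)) ≫ baseMap (t' ≫ ε) := by
          rw [l₁', pullback.condition]
        rw [← key₃ h₁' h₂' _ l' l₂' w', ← key₃ h₁ h₂ _ l l₂ (by
          rw [l₁, h₃, pullback.condition])]
        exact congrArg (· ≫ χ) (app_congr h₃ rfl (l₁.trans l₁'.symm) _)
    have htt : baseMap t = baseMap t' := hR.isPullback.hom_ext (by rw [hb₁, hb₁', hrr])
      (by rw [hb₂, hb₂'])
    refine hom_ext hrr fun {T} x z wz => ?_
    have wx : x ≫ baseMap w = (z ≫ ν ≫ qr ≫ baseMap e₂) ≫ j := by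
      rw [← hbr, ← reassoc_of% wz, ← hRm]
      simp only [Category.assoc, hR.isPullback.w]
    let t₀ := hPb.lift x _ wx
    have t₁ : t₀ ≫ baseMap p₁ = x := hPb.lift_fst _ _ wx
    have t₂ : t₀ ≫ baseMap p₂ = z ≫ ν ≫ qr ≫ baseMap e₂ := hPb.lift_snd _ _ wx
    have t₃ : z ≫ ν ≫ qr = t₀ ≫ baseMap t := by
      apply hR.isPullback.hom_ext
      · simp only [Category.assoc, hb₁, reassoc_of% t₁, hRm, wz]
      · simp only [Category.assoc, hb₂, t₂]
    have w₁ : (z ≫ ν ≫ qn) ≫ C.map = t₀ ≫ baseMap (t ≫ ε) := by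
      rw [← hbs, Category.assoc (baseMap t), ← reassoc_of% t₃, Category.assoc, Category.assoc, hQ.w]
    have k₁ := key₁ h₁ t₀ z t₃ w₁ (by rw [t₁, wz])
    have k₂ := key₁ h₁' t₀ z (by rw [t₃, htt]) (h₃ ▸ w₁) (by rw [t₁, wz, hrr])
    -- Both families agree after inclusion into the `W`-summand, which is a monomorphism.
    have k₃ := c₅ _ _ _ _ _ (k₁.symm.trans ((app_congr h₃ rfl rfl _).trans k₂))
    exact (app_congr rfl t₁.symm rfl _).trans (k₃.trans (app_congr rfl t₁ rfl _))

end PolyModel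

/-! ### Construction of dependent products. -/

namespace PolyModel

variable {B : Type u} [Category.{v} B] {D : MorphismProperty B} [IsDisplayClass D]
  [HasExtensiveSums B] [SumClosed D] {F : MorphismProperty B} [IsDisplayClass F] [SumClosed F]
  [F.IsStableUnderComposition]

theorem exists_isPi_toZero (hroot : IsWellRooted D) (hFD : F ≤ D) (hpi : HasPiTypes F)
    {Y C : PolyModel D} {J : B} {j : Y.base ⟶ J} {k : C.base ⟶ Y.base} (hY : F Y.map)
    (hC : F C.map) (hj : F j) (hk : F k) :
    ∃ (R E : PolyModel D) (π : R ⟶ zero D J) (e₁ : E ⟶ R) (e₂ : E ⟶ Y) (ε : E ⟶ C), glued F π ∧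
      IsPi (toZero j) (toZero (𝟙 Y.base)) (toZero k) π e₁ e₂ ε := by
  have hO := IsCoprod.coprod Y.base Y.total
  have ha := hO.inl_desc (𝟙 _) Y.map
  have hb := hO.inr_desc (𝟙 _) Y.map
  have ho : F (hO.desc (𝟙 _) Y.map) := SumClosed.of_inl_of_inr hO _ (by rw [ha]; exact F.id_mem _)
    (by rwa [hb])
  -- `S` is `Π_n (1 + Y_y)` over `c` in `C.base`; composing with `k` forms the sum over `c`, and the
  -- product along `j` then gives the base `R₀`.
  obtain ⟨S, ES, σ, s₁, s₂, sε, hσ, hS⟩ := hpi.exists_isPi (C.map ≫ k) hC ho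
  obtain ⟨R₀, Q₀, ρ, r₁, r₂, rε, hρ, hR⟩ := hpi.exists_isPi (𝟙 _) hj (F.comp_mem _ _ hσ hk)
  have hQ := IsPullback.of_hasPullback C.map (rε ≫ σ)
  have hθ : (pullback.snd C.map (rε ≫ σ) ≫ rε) ≫ σ = pullback.fst C.map (rε ≫ σ) ≫ C.map := by
    rw [pullback.condition, Category.assoc]
  have hθ₁ := hS.isPullback.lift_fst _ _ hθ
  have hθ₂ := hS.isPullback.lift_snd _ _ hθ
  obtain ⟨N, N', ν, ν', νi, νp, hν, hν', hνν'⟩ := hO.exists_split D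
    (hS.isPullback.lift _ _ hθ ≫ sε)
  have hRm : F (ν ≫ pullback.snd C.map (rε ≫ σ) ≫ r₁) :=
    F.comp_mem _ _ (SumClosed.inl hνν') (F.comp_mem _ _ (F.pullback_snd _ _ hC)
      (F.of_isPullback hR.isPullback.flip hj))
  let R : PolyModel D := ⟨R₀, N, _, hFD _ hRm⟩
  obtain ⟨T, m, hm, e₁, e₂, he₁, he₂, H, -⟩ := exists_isPullback_of_base (D := D) (X := R) (Y := Y)
    hR.isPullback
  let E : PolyModel D := ⟨Q₀, T, m, hm⟩
  let qn := pullback.fst C.map (rε ≫ σ)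
  let qr := pullback.snd C.map (rε ≫ σ)
  have hεo : (hS.isPullback.lift _ _ hθ ≫ sε) ≫ hO.desc (𝟙 _) Y.map = qr ≫ r₂ := by
    rw [Category.assoc, hS.w, reassoc_of% hθ₂, pullback.condition_assoc]
    have := hR.w
    rw [Category.comp_id] at this
    rw [← this, Category.assoc]
  have w₁ : 𝟙 N ≫ R.map = (ν ≫ qr) ≫ baseMap e₁ := by
    rw [he₁]
    exact (Category.id_comp _).trans (Category.assoc _ _ _).symm
  have w₂ : νp ≫ Y.map = (ν' ≫ qr) ≫ baseMap e₂ := by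
    rw [he₂, Category.assoc, ← hεo, ← Category.assoc ν', hν'.w, Category.assoc, hb]
  -- The evaluation sends `n` into the `R`-summand of the family of `E` when its value is in `1`,
  -- and otherwise to its value in the `Y`-summand.
  let φ : pullback C.map (rε ≫ σ) ⟶ T := hνν'.desc (app e₁ (ν ≫ qr) (𝟙 N) w₁)
    (app e₂ (ν' ≫ qr) νp w₂)
  have hφ : φ ≫ m = qr := hνν'.hom_ext
    ((hνν'.inl_desc_assoc _ _ _).trans (app_map e₁ _ _ _))
    ((hνν'.inr_desc_assoc _ _ _).trans (app_map e₂ _ _ _))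
  let ε : E ⟶ C := Hom.mk (X := E) (rε ≫ σ) φ hφ
  have hl : ∀ {L V : B} (v : L ⟶ pullback C.map (rε ≫ σ)) (z : V ⟶ L)
      (w : (z ≫ v ≫ qn) ≫ C.map = (z ≫ v ≫ qr) ≫ baseMap ε),
      app ε (z ≫ v ≫ qr) (z ≫ v ≫ qn) w = z ≫ v ≫ φ := by
    intro L V v z w
    change pullback.lift (z ≫ v ≫ qn) (z ≫ v ≫ qr) w ≫ φ = _
    rw [← Category.assoc z v φ]
    congr 1
    apply pullback.hom_ext
    · rw [pullback.lift_fst, Category.assoc]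
    · rw [pullback.lift_snd, Category.assoc]
  refine ⟨R, E, toZero ρ, e₁, e₂, ε, glued_toZero hRm hρ, ?_⟩
  refine isPi_toZero hroot hO ha hb hS H (by rw [he₁, he₂]; exact hR) hQ hθ₁ hθ₂ rfl hν hν' hνν'
    (by rw [he₁]) rfl (fun z w w' => ?_) (fun z w w' => ?_)
  · refine (hl ν z w).trans ((congrArg (z ≫ ·) (hνν'.inl_desc _ _)).trans ?_)
    rw [comp_app]
    exact app_congr rfl rfl (Category.comp_id z) _
  · refine (hl ν' z w).trans ((congrArg (z ≫ ·) (hνν'.inr_desc _ _)).trans ?_)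
    rw [comp_app]

/-- In normal form `f` and `g` are pullbacks of maps into `(A.base, 0)` and `(Y.base, 0)`, so the
product is a base change of the one constructed there. -/
theorem hasPiTypes_glued (hroot : IsWellRooted D) (hFD : F ≤ D) (hpi : HasPiTypes F) :
    HasPiTypes (glued (D := D) F) := by
  refine HasPiTypes.of_exists_isPi fun {Y A C} f g hf hg => ?_
  obtain ⟨T, m, hm, q, hT, hq, H⟩ := exists_isPullback_of_glued hf
  obtain ⟨T', m', hm', q', hT', hq', H'⟩ := exists_isPullback_of_glued hg
  obtain ⟨R, E, π, e₁, e₂, ε, hπ, hPi⟩ := exists_isPi_toZero hroot hFD hpi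
    (Y := ⟨Y.base, T, m, hm⟩) (C := ⟨C.base, T', m', hm'⟩) (j := (baseMap f :))
    (k := (baseMap g :)) hT hT' (glued_baseMap hf) (glued_baseMap hg)
  have := MorphismProperty.HasPullbacks.hasPullback (toZero (𝟙 A.base)) hπ
  have hR := IsPullback.of_hasPullback π (toZero (𝟙 A.base))
  have hR' := (glued F).of_isPullback hR hπ
  have := MorphismProperty.HasPullbacks.hasPullback f hR'
  have w : 𝟙 Y ≫ toZero (𝟙 Y.base) = q ≫ toZero (𝟙 Y.base) := zero_hom_ext
    ((Category.id_comp (𝟙 Y.base)).trans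
      ((congrArg (· ≫ 𝟙 Y.base) hq).trans (Category.id_comp _)).symm)
  obtain ⟨ε', h⟩ := hPi.baseChange H H' w hR
    (IsPullback.of_hasPullback (pullback.snd π (toZero (𝟙 A.base))) f)
  exact ⟨_, _, _, _, _, ε', hR', h⟩

end PolyModel

/-! ## Identity types in the polynomial model -/

namespace PolyModel

variable {B : Type u} [Category.{v} B] {D : MorphismProperty B} [IsDisplayClass D]
  [HasExtensiveSums B] [SumClosed D]

theorem IsCart.exists_lift {W Z V : PolyModel D} {c : W ⟶ Z} (hc : IsCart c) (f : V ⟶ Z)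
    (g : V.base ⟶ W.base) (w : g ≫ baseMap c = baseMap f) :
    ∃ l : V ⟶ W, l ≫ c = f ∧ baseMap l = g := by
  have e : f ≫ toZero (𝟙 Z.base) = toZero g ≫ toZero (baseMap c :) :=
    zero_hom_ext ((Category.comp_id _).trans w.symm)
  refine ⟨IsPullback.lift hc f (toZero g) e, IsPullback.lift_fst hc _ _ _, ?_⟩
  exact (Category.comp_id _).symm.trans (congrArg baseMap (IsPullback.lift_snd hc f (toZero g) e))

theorem IsCart.hom_ext {W Z V : PolyModel D} {c : W ⟶ Z} (hc : IsCart c) {l l' : V ⟶ W}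
    (h : l ≫ c = l' ≫ c) (hb : baseMap l = baseMap l') : l = l' :=
  IsPullback.hom_ext hc h (zero_hom_ext ((Category.comp_id _).trans
    (hb.trans (Category.comp_id _).symm)))

theorem isCart_reindHom (Z : PolyModel D) {J : B} (h : J ⟶ Z.base) : IsCart (reindHom Z h) :=
  isCart_cartHom _ _ _

omit [HasExtensiveSums B] [SumClosed D] in
theorem reind_map_mem {F : MorphismProperty B} [IsDisplayClass F] (Z : PolyModel D) {J : B}
    (h : J ⟶ Z.base) (hZ : F Z.map) : F (reind Z h).map := F.pullback_snd _ _ hZ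

/-- The vertical part of `n` has a retraction over `J`. -/
def IsSplitOver {X Z J : PolyModel D} (n : X ⟶ Z) (z : Z ⟶ J) : Prop :=
  ∃ (v : X ⟶ reind Z (baseMap n)) (s : reind Z (baseMap n) ⟶ X),
    v ≫ reindHom Z (baseMap n) = n ∧ baseMap v = 𝟙 X.base ∧ v ≫ s = 𝟙 X ∧
    s ≫ n ≫ z = reindHom Z (baseMap n) ≫ z

/-- After lifting the base, the family of the diagonal is a section of `Π_{d₀^* G} Z` over `Z.base`.
Over `X.base` it is prescribed through the retraction `s`; it extends along `baseMap n` because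
dependent products of display maps are display maps. -/
theorem hasLiftingProperty_toZero (hpi : HasPiTypes D) {X Z : PolyModel D} {n : X ⟶ Z}
    (hn : D.llp (baseMap n)) {v : X ⟶ reind Z (baseMap n)} {s : reind Z (baseMap n) ⟶ X}
    (hv : v ≫ reindHom Z (baseMap n) = n) (hvb : baseMap v = 𝟙 X.base) (hvs : v ≫ s = 𝟙 X)
    {G : PolyModel D} {L : B} {k : G.base ⟶ L} (hk : D k) :
    HasLiftingProperty n (toZero k : G ⟶ zero D L) := by
  refine ⟨fun {a b} sq => ?_⟩
  have hsb : baseMap s = 𝟙 X.base := by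
    have := congrArg baseMap hvs
    rw [baseMap_comp, hvb] at this
    exact (Category.id_comp _).symm.trans this
  have := hn k hk
  have sq₀ : CommSq (baseMap a) (baseMap n) k (baseMap b) := ⟨congrArg baseMap sq.w⟩
  let d₀ : Z.base ⟶ G.base := sq₀.lift
  have hd₀ : baseMap n ≫ d₀ = baseMap a := sq₀.fac_left
  have hd₀' : d₀ ≫ k = baseMap b := sq₀.fac_right
  obtain ⟨R, E, π, e₁, e₂, ε, hπ, hPi⟩ := hpi.exists_isPi (pullback.snd G.map d₀)
    (D.pullback_snd G.map d₀ G.display) Z.display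
  let p₂ : pullback G.map (baseMap a) ⟶ pullback G.map d₀ :=
    pullback.lift (pullback.fst _ _) (pullback.snd _ _ ≫ baseMap n)
      (by rw [pullback.condition, Category.assoc, hd₀])
  have hp₁ : p₂ ≫ pullback.fst _ _ = pullback.fst _ _ := pullback.lift_fst _ _ _
  have hp₂ : p₂ ≫ pullback.snd _ _ = pullback.snd _ _ ≫ baseMap n := pullback.lift_snd _ _ _
  have hP : IsPullback (pullback.snd G.map (baseMap a)) p₂ (baseMap n)
      (pullback.snd G.map d₀) := by
    exact (IsPullback.of_right ((IsPullback.of_hasPullback G.map (baseMap a)).congr hp₁.symm rfl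
      rfl hd₀.symm) hp₂ (IsPullback.of_hasPullback G.map d₀)).flip
  have wa : ∀ {T : B} (t : T ⟶ X.base) (y : T ⟶ G.total), y ≫ G.map = t ≫ baseMap a →
      y ≫ G.map = t ≫ (baseMap (s ≫ a) :) := fun t y w => by
    rw [w, baseMap_comp, hsb]
    exact congrArg (t ≫ ·) (Category.id_comp _).symm
  -- The prescribed values: `a` sends elements of `G.total` to `X.total`, and `s` carries these on
  -- to `Z.total`. Applying `n` returns the value of `a` because `v ≫ s = 𝟙 X`.
  let σ : pullback G.map (baseMap a) ⟶ Z.total :=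
    app (s ≫ a) (pullback.snd G.map (baseMap a)) (pullback.fst G.map (baseMap a))
      (wa _ _ pullback.condition) ≫ pullback.fst Z.map (baseMap n)
  have hσ : σ ≫ Z.map = p₂ ≫ pullback.snd _ _ := by
    rw [Category.assoc, pullback.condition, hp₂]
    exact (Category.assoc _ _ _).symm.trans (congrArg (· ≫ baseMap n) (app_map (s ≫ a) _ _ _))
  obtain ⟨r, t, hr, ht₁, ht₂, ht⟩ := hPi.exists_lift _ _ _ hP σ hσ
  have := hn π hπ
  have sq₁ : CommSq r (baseMap n) π (𝟙 Z.base) := ⟨by rw [hr, Category.comp_id]⟩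
  let ρ : Z.base ⟶ R := sq₁.lift
  have hρ : baseMap n ≫ ρ = r := sq₁.fac_left
  have hρ' : ρ ≫ π = 𝟙 _ := sq₁.fac_right
  have wη : (pullback.snd G.map d₀ ≫ ρ) ≫ π = 𝟙 _ ≫ pullback.snd G.map d₀ := by
    rw [Category.assoc, hρ', Category.comp_id, Category.id_comp]
  let η := hPi.isPullback.lift _ _ wη
  have hη₁ : η ≫ e₁ = _ := hPi.isPullback.lift_fst _ _ wη
  have hη₂ : η ≫ e₂ = _ := hPi.isPullback.lift_snd _ _ wη
  have hη : p₂ ≫ η = t := by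
    apply hPi.isPullback.hom_ext
    · rw [Category.assoc, hη₁, ht₁, reassoc_of% hp₂, hρ]
    · rw [Category.assoc, hη₂, ht₂, Category.comp_id]
  have hφ : (η ≫ ε) ≫ Z.map = pullback.snd G.map d₀ := by
    rw [Category.assoc, hPi.w, reassoc_of% hη₂]
  let d : Z ⟶ G := Hom.mk d₀ (η ≫ ε) hφ
  refine ⟨⟨⟨d, ?_, zero_hom_ext hd₀'⟩⟩⟩
  refine PolyModel.hom_ext hd₀ fun {T} t y w => ?_
  have w' : y ≫ G.map = t ≫ baseMap a := w.trans (congrArg (t ≫ ·) hd₀)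
  have w'' : y ≫ G.map = (t ≫ baseMap n) ≫ d₀ := w.trans (Category.assoc _ _ _).symm
  have h₁ : app d (t ≫ baseMap n) y w'' =
      app (s ≫ a) t y (wa t y w') ≫ pullback.fst Z.map (baseMap n) := by
    change pullback.lift y (t ≫ baseMap n) w'' ≫ η ≫ ε = _
    have : pullback.lift y (t ≫ baseMap n) w'' = pullback.lift y t w' ≫ p₂ := by
      apply pullback.hom_ext
      · rw [pullback.lift_fst, Category.assoc, hp₁, pullback.lift_fst]
      · rw [pullback.lift_snd, Category.assoc, hp₂, pullback.lift_snd_assoc]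
    rw [this, Category.assoc, reassoc_of% hη, ht]
    refine (Category.assoc _ _ _).symm.trans (congrArg (· ≫ pullback.fst Z.map (baseMap n)) ?_)
    rw [comp_app]
    exact app_congr rfl (pullback.lift_snd _ _ _) (pullback.lift_fst _ _ _) _
  let x := app (s ≫ a) t y (wa t y w')
  have hx : x ≫ pullback.snd Z.map (baseMap n) = t := app_map _ _ _ _
  have wx : (x ≫ pullback.fst Z.map (baseMap n)) ≫ Z.map = t ≫ baseMap n := by
    rw [Category.assoc, pullback.condition, reassoc_of% hx]
  have h₂ : app n t (x ≫ pullback.fst Z.map (baseMap n)) wx = app a t y w' := by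
    have e : app (reindHom Z (baseMap n)) t (x ≫ pullback.fst Z.map (baseMap n)) wx = x :=
      app_cartHom_comp (X := reind Z (baseMap n)) _ _ _ _ _ hx
    refine (app_congr hv.symm rfl rfl _).trans ((app_comp v _ _ _ _).trans ?_)
    refine (app_congr (t' := t) (y' := x) rfl rfl
      ((app_congr rfl (by rw [hvb]; exact Category.comp_id t) rfl _).trans e) _).trans ?_
    refine Eq.trans ?_ (app_congr (f := v ≫ s ≫ a) (by rw [reassoc_of% hvs]) rfl rfl ?_)
    · rw [app_comp v]
      exact app_congr rfl rfl
        (app_congr rfl (by rw [hvb]; exact (Category.comp_id t).symm) rfl _) _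
    · rw [reassoc_of% hvs]
      exact w'
  rw [app_comp]
  exact (app_congr rfl rfl h₁ _).trans h₂

theorem glued_llp_of_split (hpi : HasPiTypes D) {X Z J : PolyModel D} {n : X ⟶ Z} {z : Z ⟶ J}
    (hn : D.llp (baseMap n)) (h : IsSplitOver n z) : (glued D).llp n := by
  obtain ⟨v, s, hv, hvb, hvs, -⟩ := h
  rintro P Q g ⟨C, K, j, q, x, -, hj, H⟩
  have := hasLiftingProperty_toZero hpi hn hv hvb hvs (G := C) hj
  refine ⟨fun {a b} sq => ?_⟩
  have sq' : CommSq (a ≫ q) n (toZero j) (b ≫ toZero x) :=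
    ⟨by rw [Category.assoc, H.w, reassoc_of% sq.w]⟩
  refine ⟨⟨⟨H.lift sq'.lift b sq'.fac_right, H.hom_ext ?_ ?_, H.lift_snd _ _ _⟩⟩⟩
  · rw [Category.assoc, H.lift_fst, sq'.fac_left]
  · rw [Category.assoc, H.lift_snd, sq.w]

/-- By adjunction, lifting the base of `n` against `g` is lifting `n` against `(P, 0) ⟶ (Q, 0)`. -/
theorem llp_baseMap_of_llp {X Z : PolyModel D} {n : X ⟶ Z} (hn : (glued D).llp n) :
    D.llp (baseMap n) := by
  intro P Q g hg
  have := hn (toZero g : zero D P ⟶ zero D Q) (glued_toZero (zero D P).display hg)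
  refine ⟨fun {a b} sq => ?_⟩
  have sq' : CommSq (toZero a : X ⟶ zero D P) n (toZero g : zero D P ⟶ zero D Q) (toZero b) :=
    ⟨zero_hom_ext sq.w⟩
  exact ⟨⟨⟨baseMap sq'.lift, congrArg baseMap sq'.fac_left, congrArg baseMap sq'.fac_right⟩⟩⟩

/-- Factor the base as `l₀ ≫ d₀`, with a retraction `r` of `l₀` over `J.base`. If `X` adds a family
`T` to `J`, take `Z` to add `r^* T` to `Y`. Over `X.base` this is `T` added to `Y`, and it retracts
to `X` through `Y ⟶ J`. -/
theorem exists_factorization_glued {F : MorphismProperty B} [IsDisplayClass F] [SumClosed F]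
    (hFD : F ≤ D) (hF : HasLeftFactorizations D F) {X Y J : PolyModel D} (m : X ⟶ Y) (y : Y ⟶ J)
    (hy : glued F y) (hmy : glued F (m ≫ y)) :
    ∃ (Z : PolyModel D) (l : X ⟶ Z) (d : Z ⟶ Y), D.llp (baseMap l) ∧ IsSplitOver l (d ≫ y) ∧
      glued F d ∧ l ≫ d = m := by
  have hb : F (baseMap m ≫ baseMap y) := glued_baseMap hmy
  obtain ⟨Z₀, l₀, d₀, hl₀, hd₀, w₀⟩ := hF (baseMap m) (baseMap y) (glued_baseMap hy) hb
  -- The retraction comes from lifting `l₀` against the display map `X.base ⟶ J.base`.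
  have := hl₀ _ (hFD _ hb)
  have sq : CommSq (𝟙 X.base) l₀ (baseMap m ≫ baseMap y) (d₀ ≫ baseMap y) :=
    ⟨by rw [Category.id_comp, reassoc_of% w₀]⟩
  let r : Z₀ ⟶ X.base := sq.lift
  have hr : l₀ ≫ r = 𝟙 _ := sq.fac_left
  have hr' : r ≫ baseMap m ≫ baseMap y = d₀ ≫ baseMap y := sq.fac_right
  obtain ⟨T, t, ht, q, hFt, hq, H⟩ := exists_isPullback_of_glued hmy
  let X' : PolyModel D := ⟨X.base, T, t, ht⟩
  obtain ⟨T', t', ht', p, d, hp, hd, H', -⟩ := exists_isPullback_of_base (D := D)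
    (X := reind X' r) (Y := Y) (K := Y.base) (x := d₀) (y := 𝟙 _) (p₀ := 𝟙 Z₀) (q₀ := d₀)
    (IsPullback.of_horiz_isIso ⟨by simp⟩).flip.flip
  let Z : PolyModel D := ⟨Z₀, T', t', ht'⟩
  have hdF : glued F d := ⟨_, _, d₀, p, _, reind_map_mem X' r hFt, hd₀, H'⟩
  obtain ⟨c, hc, hcb⟩ := (isCart_reindHom X' r).exists_lift q l₀ (hr.trans hq.symm)
  have wl : c ≫ toZero d₀ = m ≫ toZero (𝟙 Y.base) := zero_hom_ext
    ((congrArg (· ≫ d₀) hcb).trans (w₀.trans (Category.comp_id _).symm))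
  let l : X ⟶ Z := H'.lift c m wl
  have hlp : l ≫ p = c := H'.lift_fst _ _ wl
  have hld : l ≫ d = m := H'.lift_snd _ _ wl
  have hlb : baseMap l = l₀ :=
    ((Category.comp_id _).symm.trans (congrArg (baseMap l ≫ ·) hp.symm)).trans
      ((congrArg baseMap hlp).trans hcb)
  refine ⟨Z, l, d, by rwa [hlb], ?_, hdF, hld⟩
  obtain ⟨v, hv, hvb⟩ := (isCart_reindHom Z (baseMap l)).exists_lift l (𝟙 X.base)
    (Category.id_comp _)
  have ws : (reindHom Z (baseMap l) ≫ p ≫ reindHom X' r) ≫ toZero (baseMap (m ≫ y) :) =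
      (reindHom Z (baseMap l) ≫ d ≫ y) ≫ toZero (𝟙 J.base) := by
    refine zero_hom_ext ?_
    change (baseMap l ≫ baseMap p ≫ r) ≫ baseMap m ≫ baseMap y =
      (baseMap l ≫ baseMap d ≫ baseMap y) ≫ 𝟙 _
    rw [hp, hd, hlb, Category.comp_id]
    exact (Category.assoc _ _ _).trans (congrArg (l₀ ≫ ·) (((Category.assoc _ _ _).trans
      (Category.id_comp _)).trans hr'))
  let s := H.lift _ _ ws
  have hs₁ : s ≫ q = _ := H.lift_fst _ _ ws
  have hs₂ : s ≫ m ≫ y = _ := H.lift_snd _ _ ws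
  refine ⟨v, s, hv, hvb, H.hom_ext ?_ ?_, ?_⟩
  · rw [Category.assoc, hs₁, reassoc_of% hv, reassoc_of% hlp, hc]
    exact (Category.id_comp q).symm
  · rw [Category.assoc, hs₂, reassoc_of% hv, reassoc_of% hld, Category.id_comp]
  · rw [reassoc_of% hld, hs₂]

/-- The retract argument: factor `m` as a split map `l` followed by a display map `d`. Lifting gives
a section of `d` under `X`, which carries the retraction for `l` to one for `m`. -/
theorem isSplitOver_of_llp (hD : HasLeftFactorizations D D) {X Y J : PolyModel D} (m : X ⟶ Y)
    (y : Y ⟶ J) (hy : glued D y) (hmy : glued D (m ≫ y)) (hm : (glued D).llp m) :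
    IsSplitOver m y := by
  obtain ⟨Z, l, d, -, ⟨v, s, hv, hvb, hvs, hs⟩, hd, w⟩ := exists_factorization_glued le_rfl hD m y hy hmy
  have := hm d hd
  have sq : CommSq l m d (𝟙 Y) := ⟨by rw [w, Category.comp_id]⟩
  have he : m ≫ sq.lift = l := sq.fac_left
  have he' : sq.lift ≫ d = 𝟙 Y := sq.fac_right
  obtain ⟨v', hv', hvb'⟩ := (isCart_reindHom Y (baseMap m)).exists_lift m (𝟙 X.base)
    (Category.id_comp _)
  obtain ⟨k, hk, hkb⟩ := (isCart_reindHom Z (baseMap l)).exists_lift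
    (reindHom Y (baseMap m) ≫ sq.lift) (𝟙 X.base)
    ((Category.id_comp _).trans (congrArg baseMap he).symm)
  refine ⟨v', k ≫ s, hv', hvb', ?_, ?_⟩
  · have : v' ≫ k = v := by
      refine (isCart_reindHom Z (baseMap l)).hom_ext ?_ ?_
      · rw [Category.assoc, hk, reassoc_of% hv', he, hv]
      · rw [baseMap_comp, hvb', hkb, hvb]
        exact Category.id_comp _
    rw [reassoc_of% this, hvs]
  · have : s ≫ m ≫ y = reindHom Z (baseMap l) ≫ d ≫ y := by rw [← hs, reassoc_of% w]
    rw [Category.assoc, this, reassoc_of% hk, reassoc_of% he']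

/-- Both halves of the description of left maps survive base change: the base by stability in `B`,
and the retraction because it is a map over `J`. -/
theorem isLeftClassStable_glued (hpi : HasPiTypes D) (hD : HasLeftFactorizations D D)
    (hs : IsLeftClassStable D) : IsLeftClassStable (glued (D := D) D) := by
  intro I J X Y X' Y' h m y hy hmy hm pX x' pY y' m' hX hY w w'
  have hb : D.llp (baseMap m') := hs (glued_baseMap hy) (glued_baseMap hmy)
    (llp_baseMap_of_llp hm) (isPullback_baseMap hX) (isPullback_baseMap hY)
    (congrArg baseMap w) (congrArg baseMap w')
  obtain ⟨v, s, hv, hvb, hvs, hs⟩ := isSplitOver_of_llp hD m y hy hmy hm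
  obtain ⟨v', hv', hvb'⟩ := (isCart_reindHom Y' (baseMap m')).exists_lift m' (𝟙 X'.base)
    (Category.id_comp _)
  obtain ⟨t, ht, htb⟩ := (isCart_reindHom Y (baseMap m)).exists_lift
    (reindHom Y' (baseMap m') ≫ pY) (baseMap pX :) (congrArg baseMap w).symm
  have ws : (t ≫ s) ≫ m ≫ y = (reindHom Y' (baseMap m') ≫ y') ≫ h := by
    rw [Category.assoc, hs, reassoc_of% ht, hY.w, Category.assoc]
  refine glued_llp_of_split (J := I) (z := y') hpi hb
    ⟨v', hX.lift _ _ ws, hv', hvb', hX.hom_ext ?_ ?_, ?_⟩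
  · have : v' ≫ t = pX ≫ v := by
      refine (isCart_reindHom Y (baseMap m)).hom_ext ?_ ?_
      · rw [Category.assoc, ht, reassoc_of% hv', w, Category.assoc, hv]
      · rw [baseMap_comp, hvb', htb, baseMap_comp, hvb]
        exact (Category.id_comp _).trans (Category.comp_id _).symm
    rw [Category.assoc, hX.lift_fst, reassoc_of% this, hvs, Category.comp_id, Category.id_comp]
  · rw [Category.assoc, hX.lift_snd, reassoc_of% hv', w', Category.id_comp]
  · rw [w', hX.lift_snd]

theorem hasLeftFactorizations_glued {F : MorphismProperty B} [IsDisplayClass F] [SumClosed F]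
    (hpi : HasPiTypes D) (hFD : F ≤ D) (hF : HasLeftFactorizations D F) :
    HasLeftFactorizations (glued (D := D) D) (glued F) := by
  intro X Y J m y hy hmy
  obtain ⟨Z, l, d, hl, hs, hd, w⟩ := exists_factorization_glued hFD hF m y hy hmy
  exact ⟨Z, l, d, glued_llp_of_split hpi hl hs, hd, w⟩

end PolyModel

/-! ## Universes in the polynomial model -/

theorem HasClosedUniverse.of_smallMaps_eq {C : Type u} [Category.{v} C] [HasExtensiveSums C]
    {D F : MorphismProperty C} [IsDisplayClass D] [D.IsStableUnderComposition] [IsDisplayClass F]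
    [SumClosed F] [F.IsStableUnderComposition] {E U : C} {u : E ⟶ U} (hu : D u)
    (h : smallMaps u = F) (hpi : HasPiTypes F) (hid : HasLeftFactorizations D F) :
    HasClosedUniverse D := by
  subst h
  have hu' : IsUniverse D u := ⟨hu, inferInstance⟩
  exact ⟨E, U, u, hu', inferInstanceAs (smallMaps u).IsStableUnderComposition, hpi,
    hu'.hasIdentityTypes_iff.2 hid, .of_sumClosed,
    fun I => preservesFiniteCoproducts_changeProp hu'.smallMaps_le I⟩

namespace PolyModel

variable {B : Type u} [Category.{v} B] {D : MorphismProperty B} [IsDisplayClass D]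
  [HasExtensiveSums B] [SumClosed D]

/-- `V` is the object of pairs of `a` in `U` and a function `E_a ⟶ U`; `V'` adds a point of `E_a`,
and `ε` evaluates there. The universe is `V'`, with the family pulled back from `u` along `ε`,
mapping to `(V, 0)`. -/
theorem exists_smallMaps_eq_glued (hroot : IsWellRooted D) (hpi : HasPiTypes D) {E U : B}
    {u : E ⟶ U} (hu : IsUniverse D u) :
    ∃ (A V : PolyModel D) (w : A ⟶ V), smallMaps w = glued (smallMaps u) := by
  have := hroot.hasTerminal
  obtain ⟨V, V', π, e₁, e₂, ε, -, hPi⟩ := hpi.exists_isPi (terminal.from E) hu.display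
    (hroot.toTerminal terminalIsTerminal (terminal.from U))
  have : HasPullback u ε := MorphismProperty.HasPullbacks.hasPullback ε hu.display
  let A : PolyModel D := ⟨V', pullback u ε, pullback.snd u ε, D.pullback_snd _ _ hu.display⟩
  refine ⟨A, zero D V, toZero (X := A) e₁, ?_⟩
  ext X Y f
  constructor
  · rintro ⟨a, b, H⟩
    exact ⟨A, V, e₁, a, baseMap b, ⟨_, _, IsPullback.of_hasPullback u ε⟩,
      ⟨_, _, hPi.isPullback.flip⟩, H.congr rfl rfl rfl (zero_hom_ext rfl)⟩
  · rintro ⟨C, K, j, q, x, ⟨a, c, hc⟩, ⟨b, k, hk⟩, H⟩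
    -- The classifier `k` of `j` and the classifier `c` of the family combine into one map `r : K ⟶
    -- V`, which names both at once.
    obtain ⟨r, t, hr, ht₁, ht₂, ht⟩ := hPi.exists_lift k j b hk.flip c
      (terminalIsTerminal.hom_ext _ _)
    have ht' : IsPullback t j e₁ r :=
      IsPullback.of_right (hk.congr ht₂.symm rfl rfl hr.symm) ht₁ hPi.isPullback.flip
    let l : C.total ⟶ pullback u ε := pullback.lift a (C.map ≫ t) (by rw [hc.w, Category.assoc, ht])
    have hl : IsPullback l C.map (pullback.snd u ε) t :=
      IsPullback.of_right (hc.congr (pullback.lift_fst _ _ _).symm rfl rfl ht.symm)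
        (pullback.lift_snd _ _ _) (IsPullback.of_hasPullback u ε)
    exact ⟨_, _, H.paste_horiz (isPullback_cartHom (Y := A) t l hl ht')⟩

theorem hasClosedUniverse_glued [D.IsStableUnderComposition] (hroot : IsWellRooted D)
    (hext : IsStronglyExtensive D) (hpi : HasPiTypes D) (h : HasClosedUniverse D) :
    HasClosedUniverse (glued (D := D) D) := by
  obtain ⟨E, U, u, hu, hsigma, hpi', hid, hsum, hpres⟩ := h
  have := hroot.hasTerminal
  have := hu.isDisplayClass
  have : (smallMaps u).IsStableUnderComposition := hsigma
  have : SumClosed (smallMaps u) := hu.sumClosed hroot hext hsum hpres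
  have : (glued (D := D) (smallMaps u)).IsStableUnderComposition :=
    isStableUnderComposition_glued
  have : (glued (D := D) D).IsStableUnderComposition := isStableUnderComposition_glued
  obtain ⟨A, V, w, hw⟩ := exists_smallMaps_eq_glued hroot hpi hu
  have hw' : smallMaps w w := ⟨𝟙 _, 𝟙 _, IsPullback.of_horiz_isIso ⟨by simp⟩⟩
  refine .of_smallMaps_eq (u := w) (glued_mono hu.smallMaps_le _ (hw ▸ hw')) hw
    (hasPiTypes_glued hroot hu.smallMaps_le hpi')
    (hasLeftFactorizations_glued hpi hu.smallMaps_le (hu.hasIdentityTypes_iff.1 hid))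

end PolyModel

theorem mainTheorem1 {B : Type u} [Category.{v} B] (D : MorphismProperty B) [IsDisplayClass D]
    (hroot : IsWellRooted D) (hext : IsStronglyExtensive D) (hsigma : HasSigmaTypes D)
    (hpi : HasPiTypes D) (hid : HasIdentityTypes D) :
    ∃ _ : IsDisplayClass (PolyModel.displayMaps D),
      IsWellRooted (PolyModel.displayMaps D) ∧ IsStronglyExtensive (PolyModel.displayMaps D) ∧
      HasSigmaTypes (PolyModel.displayMaps D) ∧ HasPiTypes (PolyModel.displayMaps D) ∧
      HasIdentityTypes (PolyModel.displayMaps D) ∧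
      (HasClosedUniverse D → HasClosedUniverse (PolyModel.displayMaps D)) := by
  have := hroot.hasTerminal
  have : HasExtensiveSums B := hroot.hasExtensiveSums (hext.slice _)
  have : SumClosed D := hext.sumClosed hroot
  have : D.IsStableUnderComposition := hsigma
  have hcomp : (PolyModel.glued (D := D) D).IsStableUnderComposition :=
    PolyModel.isStableUnderComposition_glued
  have hfac : HasLeftFactorizations D D := hid.hasLeftFactorizations
  rw [PolyModel.displayMaps_eq_glued]
  exact ⟨inferInstance, PolyModel.isWellRooted_glued hroot le_rfl, .of_sumClosed, hcomp,
    PolyModel.hasPiTypes_glued hroot le_rfl hpi,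
    .of_elementary (PolyModel.hasLeftFactorizations_glued hpi le_rfl hfac)
      (PolyModel.isLeftClassStable_glued hpi hfac hid.isLeftClassStable),
    PolyModel.hasClosedUniverse_glued hroot hext hpi⟩
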